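/- All algebras are associative unital algebras over $\mathbb C$, and all algebra maps are unital; $\otimes=\otimes_{\mathbb C}$. Let $\mathcal G$ be a finite dimensional quasi-Hopf algebra $(\mathcal G,\Delta,\epsilon,\phi,S,\alpha,\beta)$ with invertible antipode $S$. That is, $\Delta:\mathcal G\to\mathcal G\otimes\mathcal G$ and $\epsilon:\mathcal G\to\mathbb C$ are algebra maps, $\phi\in\mathcal G^{\otimes 3}$ is invertible, $S$ is a bijective linear algebra anti-homomorphism, $\alpha,\beta\in\mathcal G$, and $(\mathrm{id}\otimes\Delta)(\Delta(a))\,\phi=\phi\,(\Delta\otimes\mathrm{id})(\Delta(a))$, $(\mathrm{id}\otimes\mathrm{id}\otimes\Delta)(\phi)(\Delta\otimes\mathrm{id}\otimes\mathrm{id})(\phi)=(1\otimes\phi)(\mathrm{id}\otimes\Delta\otimes\mathrm{id})(\phi)(\phi\otimes1)$, $(\epsilon\otimes\mathrm{id})\circ\Delta=\mathrm{id}=(\mathrm{id}\otimes\epsilon)\circ\Delta$, $(\mathrm{id}\otimes\epsilon\otimes\mathrm{id})(\phi)=1\otimes1$, $S(a_{(1)})\alpha a_{(2)}=\epsilon(a)\alpha$,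 $a_{(1)}\beta S(a_{(2)})=\epsilon(a)\beta$ for all $a\in\mathcal G$, and $\phi^1\beta S(\phi^2)\alpha\phi^3=1=S(\bar\phi^1)\alpha\bar\phi^2\beta S(\bar\phi^3)$, where we write $X=X^1\otimes X^2\otimes X^3$ (summation understood) for elements of threefold tensor products, and $\bar X=X^{-1}$. Let $(\lambda,\phi_\lambda,\rho,\phi_\rho,\phi_{\lambda\rho})$ be a quasi-commuting pair of $\mathcal G$-coactions on an algebra $\mathcal M$. That is, $\lambda:\mathcal M\to\mathcal G\otimes\mathcal M$ and $\rho:\mathcal M\to\mathcal M\otimes\mathcal G$ are algebra maps, $\phi_\lambda\in\mathcal G\otimes\mathcal G\otimes\mathcal M$, $\phi_\rho\in\mathcal M\otimes\mathcal G\otimes\mathcal G$ and $\phi_{\lambda\rho}\in\mathcal G\otimes\mathcal M\otimes\mathcal G$ are invertible, and the following hold for all $m\in\mathcal M$: * (left coaction) $(\mathrm{id}\otimes\lambda)(\lambda(m))\,\phi_\lambda=\phi_\lambda\,(\Delta\otimes\mathrm{id})(\lambda(m))$; $(1\otimes\phi_\lambda)(\mathrm{id}\otimes\Delta\otimes\mathrm{id})(\phi_\lambda)(\phi\otimes1)=(\mathrm{id}\otimes\mathrm{id}\otimes\lambda)(\phi_\lambda)(\Delta\otimes\mathrm{id}\otimes\mathrm{id})(\phi_\lambda)$;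 $(\epsilon\otimes\mathrm{id})\circ\lambda=\mathrm{id}$; $(\mathrm{id}\otimes\epsilon\otimes\mathrm{id})(\phi_\lambda)=(\epsilon\otimes\mathrm{id}\otimes\mathrm{id})(\phi_\lambda)=1\otimes1$; * (right coaction) $\phi_\rho\,(\rho\otimes\mathrm{id})(\rho(m))=(\mathrm{id}\otimes\Delta)(\rho(m))\,\phi_\rho$; $(1\otimes\phi)(\mathrm{id}\otimes\Delta\otimes\mathrm{id})(\phi_\rho)(\phi_\rho\otimes1)=(\mathrm{id}\otimes\mathrm{id}\otimes\Delta)(\phi_\rho)(\rho\otimes\mathrm{id}\otimes\mathrm{id})(\phi_\rho)$; $(\mathrm{id}\otimes\epsilon)\circ\rho=\mathrm{id}$; $(\mathrm{id}\otimes\epsilon\otimes\mathrm{id})(\phi_\rho)=(\mathrm{id}\otimes\mathrm{id}\otimes\epsilon)(\phi_\rho)=1\otimes1$; * (quasi-commutation) $\phi_{\lambda\rho}\,(\lambda\otimes\mathrm{id})(\rho(m))=(\mathrm{id}\otimes\rho)(\lambda(m))\,\phi_{\lambda\rho}$; $(1\otimes\phi_{\lambda\rho})(\mathrm{id}\otimes\lambda\otimes\mathrm{id})(\phi_{\lambda\rho})(\phi_\lambda\otimes1)=(\mathrm{id}\otimes\mathrm{id}\otimes\rho)(\phi_\lambda)(\Delta\otimes\mathrm{id}\otimes\mathrm{id})(\phi_{\lambda\rho})$;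 $(1\otimes\phi_\rho)(\mathrm{id}\otimes\rho\otimes\mathrm{id})(\phi_{\lambda\rho})(\phi_{\lambda\rho}\otimes1)=(\mathrm{id}\otimes\mathrm{id}\otimes\Delta)(\phi_{\lambda\rho})(\lambda\otimes\mathrm{id}\otimes\mathrm{id})(\phi_\rho)$. Let $\hat{\mathcal G}$ be the linear dual of $\mathcal G$, with coproduct $\varphi\mapsto\varphi_{(1)}\otimes\varphi_{(2)}$ determined by $\varphi_{(1)}(a)\varphi_{(2)}(b)=\varphi(ab)$. For an algebra map $\gamma:\mathcal M\to\mathcal A$, a subscript $\mathcal A$ means that $\gamma$ is applied to the tensor factor in $\mathcal M$, and $\rho^{op}(m)\in\mathcal G\otimes\mathcal M$ is the flip of $\rho(m)$. Call $T\in\mathcal G\otimes\mathcal A$ a *normal coherent $\lambda\rho$-intertwiner* (with respect to $\gamma$) if $(\epsilon\otimes\mathrm{id})(T)=1_{\mathcal A}$ and $$T\,\lambda_{\mathcal A}(m)=\rho^{op}_{\mathcal A}(m)\,T\quad\text{for all }m\in\mathcal M,$$ $$(\phi_\rho^{312})_{\mathcal A}\;T^{13}\;(\phi_{\lambda\rho}^{132})^{-1}_{\mathcal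 A}\;T^{23}\;(\phi_\lambda)_{\mathcal A}=(\Delta\otimes\mathrm{id})(T)\quad\text{in }\mathcal G\otimes\mathcal G\otimes\mathcal A,$$ where $\phi_\rho^{312}=\phi_\rho^2\otimes\phi_\rho^3\otimes\phi_\rho^1$, $\phi_{\lambda\rho}^{132}=\phi_{\lambda\rho}^1\otimes\phi_{\lambda\rho}^3\otimes\phi_{\lambda\rho}^2$, $T^{23}=1\otimes T$, and $T^{13}$ is $T$ with $1$ inserted in the second factor. **Theorem.** 1. There exist a unital algebra extension $\mathcal M_1\supset\mathcal M$ and a linear map $\Gamma:\hat{\mathcal G}\to\mathcal M_1$ with the following universal property: $\mathcal M_1$ is generated as an algebra by $\mathcal M$ and $\Gamma(\hat{\mathcal G})$, and for every algebra map $\gamma:\mathcal M\to\mathcal A$ into an arbitrary algebra $\mathcal A$ the relation $$\gamma_T(\Gamma(\varphi))=(\varphi\otimes\mathrm{id})(T)\quad\text{for all }\varphi\in\hat{\mathcal G}$$ provides a one-to-one correspondence between the algebra maps $\gamma_T:\mathcal M_1\to\mathcal A$ extending $\gamma$ and the normal coherent $\lambda\rho$-intertwiners $T\in\mathcal G\otimes\mathcal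 A$. 2. If $(\mathcal M_1,\Gamma)$ and $(\tilde{\mathcal M}_1,\tilde\Gamma)$ both have the universal property in 1, then there is a unique algebra isomorphism $f:\mathcal M_1\to\tilde{\mathcal M}_1$ which restricts to the identity on $\mathcal M$ and satisfies $\tilde\Gamma=f\circ\Gamma$. 3. There are elements $p_\lambda\in\mathcal G\otimes\mathcal M$ and $q_\rho\in\mathcal M\otimes\mathcal G$, namely $$p_\lambda=\phi_\lambda^2\,S^{-1}(\phi_\lambda^1\beta)\otimes\phi_\lambda^3,\qquad q_\rho=\phi_\rho^1\otimes S^{-1}(\alpha\phi_\rho^3)\,\phi_\rho^2,$$ such that for every $(\mathcal M_1,\Gamma)$ with the universal property in 1 the linear maps $$\mu_L:\hat{\mathcal G}\otimes\mathcal M\to\mathcal M_1,\quad \varphi\otimes m\mapsto(\mathrm{id}\otimes\varphi_{(1)})(q_\rho)\,\Gamma(\varphi_{(2)})\,m,$$ $$\mu_R:\mathcal M\otimes\hat{\mathcal G}\to\mathcal M_1,\quad m\otimes\varphi\mapsto m\,\Gamma(\varphi_{(1)})\,(\varphi_{(2)}\otimes\mathrm{id})(p_\lambda)$$ are isomorphisms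 of vector spaces. -/

import Mathlib

set_option maxSynthPendingDepth 3

open scoped TensorProduct

noncomputable section

/-! ### Operations on tensor products of algebras

Iterated tensor products are bracketed to the right: `X ⊗ (Y ⊗ (Z ⊗ W))`. -/

/-- `f ⊗ id : X ⊗ W → Y ⊗ Z ⊗ W` for `f : X → Y ⊗ Z`. -/
def tensorSplit {X Y Z : Type*} [Semiring X] [Algebra ℂ X] [Semiring Y] [Algebra ℂ Y]
    [Semiring Z] [Algebra ℂ Z] (f : X →ₐ[ℂ] Y ⊗[ℂ] Z) (W : Type*) [Semiring W] [Algebra ℂ W] :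
    X ⊗[ℂ] W →ₐ[ℂ] Y ⊗[ℂ] (Z ⊗[ℂ] W) :=
  (Algebra.TensorProduct.assoc ℂ ℂ ℂ Y Z W).toAlgHom.comp
    (Algebra.TensorProduct.map f (AlgHom.id ℂ W))

/-- `id ⊗ f : W ⊗ X → W ⊗ Y`. -/
def tensorRight (W : Type*) {X Y : Type*} [Semiring W] [Algebra ℂ W] [Semiring X] [Algebra ℂ X]
    [Semiring Y] [Algebra ℂ Y] (f : X →ₐ[ℂ] Y) : W ⊗[ℂ] X →ₐ[ℂ] W ⊗[ℂ] Y :=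
  Algebra.TensorProduct.map (AlgHom.id ℂ W) f

/-- `t ↦ t ⊗ 1 : X ⊗ Y ⊗ Z → X ⊗ Y ⊗ Z ⊗ W`. -/
def tensorOne (X Y Z W : Type*) [Semiring X] [Algebra ℂ X] [Semiring Y] [Algebra ℂ Y]
    [Semiring Z] [Algebra ℂ Z] [Semiring W] [Algebra ℂ W] :
    X ⊗[ℂ] (Y ⊗[ℂ] Z) →ₐ[ℂ] X ⊗[ℂ] (Y ⊗[ℂ] (Z ⊗[ℂ] W)) :=
  tensorRight X (tensorRight Y Algebra.TensorProduct.includeLeft)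

/-- `f ⊗ id : X ⊗ W → W` for `f : X → ℂ`. -/
def killLeft {X : Type*} [Semiring X] [Algebra ℂ X] (f : X →ₐ[ℂ] ℂ)
    (W : Type*) [Semiring W] [Algebra ℂ W] : X ⊗[ℂ] W →ₐ[ℂ] W :=
  (Algebra.TensorProduct.lid ℂ W).toAlgHom.comp
    (Algebra.TensorProduct.map f (AlgHom.id ℂ W))

/-- `id ⊗ f : W ⊗ X → W` for `f : X → ℂ`. -/
def killRight (W : Type*) [Semiring W] [Algebra ℂ W] {X : Type*} [Semiring X] [Algebra ℂ X]
    (f : X →ₐ[ℂ] ℂ) : W ⊗[ℂ] X →ₐ[ℂ] W :=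
  (Algebra.TensorProduct.rid ℂ ℂ W).toAlgHom.comp
    (Algebra.TensorProduct.map (AlgHom.id ℂ W) f)

/-- `φ ↦ (φ ⊗ id)(t)` for `t ∈ V ⊗ W`. -/
def sliceLeft {V W : Type*} [AddCommGroup V] [Module ℂ V] [AddCommGroup W] [Module ℂ W]
    (t : V ⊗[ℂ] W) : Module.Dual ℂ V →ₗ[ℂ] W :=
  (TensorProduct.lid ℂ W).toLinearMap ∘ₗ (LinearMap.rTensorHom W).flip t

/-- `φ ↦ (id ⊗ φ)(t)` for `t ∈ W ⊗ V`. -/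
def sliceRight {V W : Type*} [AddCommGroup V] [Module ℂ V] [AddCommGroup W] [Module ℂ W]
    (t : W ⊗[ℂ] V) : Module.Dual ℂ V →ₗ[ℂ] W :=
  (TensorProduct.rid ℂ W).toLinearMap ∘ₗ (LinearMap.lTensorHom W).flip t

/-- The coproduct `φ ↦ φ₍₁₎ ⊗ φ₍₂₎` on the dual of a finite dimensional algebra, dual to the
multiplication: `φ₍₁₎(a) φ₍₂₎(b) = φ(a b)`. -/
def dualComul (G : Type*) [Ring G] [Algebra ℂ G] [FiniteDimensional ℂ G] :
    Module.Dual ℂ G →ₗ[ℂ] Module.Dual ℂ G ⊗[ℂ] Module.Dual ℂ G :=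
  (TensorProduct.dualDistribEquiv ℂ G G).symm.toLinearMap ∘ₗ (LinearMap.mul' ℂ G).dualMap

/-! ### Quasi-Hopf algebras -/

/-- A quasi-bialgebra structure `(Δ, ε, φ)` on a complex unital algebra `G`. -/
structure QuasiBialgebra (G : Type*) [Ring G] [Algebra ℂ G] where
  comul : G →ₐ[ℂ] G ⊗[ℂ] G
  counit : G →ₐ[ℂ] ℂ
  /-- The reassociator. -/
  reassoc : (G ⊗[ℂ] (G ⊗[ℂ] G))ˣ
  quasi_coassoc : ∀ a : G,
    tensorRight G comul (comul a) * (reassoc : G ⊗[ℂ] (G ⊗[ℂ] G)) =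
      (reassoc : G ⊗[ℂ] (G ⊗[ℂ] G)) * tensorSplit comul G (comul a)
  pentagon :
    tensorRight G (tensorRight G comul) (reassoc : G ⊗[ℂ] (G ⊗[ℂ] G)) *
        tensorSplit comul (G ⊗[ℂ] G) (reassoc : G ⊗[ℂ] (G ⊗[ℂ] G)) =
      ((1 : G) ⊗ₜ[ℂ] (reassoc : G ⊗[ℂ] (G ⊗[ℂ] G))) *
        tensorRight G (tensorSplit comul G) (reassoc : G ⊗[ℂ] (G ⊗[ℂ] G)) *
        tensorOne G G G G (reassoc : G ⊗[ℂ] (G ⊗[ℂ] G))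
  counit_left : ∀ a : G, killLeft counit G (comul a) = a
  counit_right : ∀ a : G, killRight G counit (comul a) = a
  counit_reassoc :
    tensorRight G (killLeft counit G) (reassoc : G ⊗[ℂ] (G ⊗[ℂ] G)) = 1

/-- The linear map underlying an algebra isomorphism `S : G → G_op`. -/
def antipodeMap {G : Type*} [Ring G] [Algebra ℂ G] (S : G ≃ₐ[ℂ] Gᵐᵒᵖ) : G →ₗ[ℂ] G :=
  (MulOpposite.opLinearEquiv ℂ).symm.toLinearMap ∘ₗ S.toLinearMap

/-- The linear map underlying `S⁻¹`. -/
def antipodeInvMap {G : Type*} [Ring G] [Algebra ℂ G] (S : G ≃ₐ[ℂ] Gᵐᵒᵖ) : G →ₗ[ℂ] G :=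
  S.symm.toLinearMap ∘ₗ (MulOpposite.opLinearEquiv ℂ).toLinearMap

/-- `x ⊗ y ↦ f(x) g(y)`. -/
def mulTwo {X Y G : Type*} [AddCommGroup X] [Module ℂ X] [AddCommGroup Y] [Module ℂ Y]
    [Ring G] [Algebra ℂ G] (f : X →ₗ[ℂ] G) (g : Y →ₗ[ℂ] G) : X ⊗[ℂ] Y →ₗ[ℂ] G :=
  LinearMap.mul' ℂ G ∘ₗ TensorProduct.map f g

/-- A quasi-Hopf algebra structure on `G`: a quasi-bialgebra together with an invertible antipode
`S`, encoded as an algebra isomorphism from `G` to its opposite, and elements `α`, `β`. -/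
structure QuasiHopfAlgebra (G : Type*) [Ring G] [Algebra ℂ G] extends QuasiBialgebra G where
  antipode : G ≃ₐ[ℂ] Gᵐᵒᵖ
  α : G
  β : G
  /-- `S(a₍₁₎) α a₍₂₎ = α ε(a)` -/
  antipode_left : ∀ a : G,
    mulTwo (LinearMap.mulRight ℂ α ∘ₗ antipodeMap antipode) LinearMap.id (comul a) =
      counit a • α
  /-- `a₍₁₎ β S(a₍₂₎) = β ε(a)` -/
  antipode_right : ∀ a : G,
    mulTwo (LinearMap.mulRight ℂ β) (antipodeMap antipode) (comul a) = counit a • β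
  /-- `X β S(Y) α Z = 1`, where `φ = X ⊗ Y ⊗ Z` -/
  antipode_reassoc :
    mulTwo (LinearMap.mulRight ℂ β)
      (mulTwo (LinearMap.mulRight ℂ α ∘ₗ antipodeMap antipode) LinearMap.id)
      (reassoc : G ⊗[ℂ] (G ⊗[ℂ] G)) = 1
  /-- `S(P) α Q β S(R) = 1`, where `φ⁻¹ = P ⊗ Q ⊗ R` -/
  antipode_reassoc_inv :
    mulTwo (LinearMap.mulRight ℂ α ∘ₗ antipodeMap antipode)
      (mulTwo (LinearMap.mulRight ℂ β) (antipodeMap antipode))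
      ((reassoc⁻¹ : (G ⊗[ℂ] (G ⊗[ℂ] G))ˣ) : G ⊗[ℂ] (G ⊗[ℂ] G)) = 1

/-! ### Coactions -/

/-- A left coaction `(λ, φ_λ)` of a quasi-bialgebra on a unital algebra `M`. -/
structure LeftCoaction {G : Type*} [Ring G] [Algebra ℂ G] (H : QuasiBialgebra G)
    (M : Type*) [Ring M] [Algebra ℂ M] where
  coact : M →ₐ[ℂ] G ⊗[ℂ] M
  reassoc : (G ⊗[ℂ] (G ⊗[ℂ] M))ˣ
  intertwine : ∀ m : M,
    tensorRight G coact (coact m) * (reassoc : G ⊗[ℂ] (G ⊗[ℂ] M)) =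
      (reassoc : G ⊗[ℂ] (G ⊗[ℂ] M)) * tensorSplit H.comul M (coact m)
  pentagon :
    ((1 : G) ⊗ₜ[ℂ] (reassoc : G ⊗[ℂ] (G ⊗[ℂ] M))) *
        tensorRight G (tensorSplit H.comul M) (reassoc : G ⊗[ℂ] (G ⊗[ℂ] M)) *
        tensorOne G G G M (H.reassoc : G ⊗[ℂ] (G ⊗[ℂ] G)) =
      tensorRight G (tensorRight G coact) (reassoc : G ⊗[ℂ] (G ⊗[ℂ] M)) *
        tensorSplit H.comul (G ⊗[ℂ] M) (reassoc : G ⊗[ℂ] (G ⊗[ℂ] M))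
  counit_coact : ∀ m : M, killLeft H.counit M (coact m) = m
  counit_reassoc_middle :
    tensorRight G (killLeft H.counit M) (reassoc : G ⊗[ℂ] (G ⊗[ℂ] M)) = 1
  counit_reassoc_left :
    killLeft H.counit (G ⊗[ℂ] M) (reassoc : G ⊗[ℂ] (G ⊗[ℂ] M)) = 1

/-- A right coaction `(ρ, φ_ρ)` of a quasi-bialgebra on a unital algebra `M`. -/
structure RightCoaction {G : Type*} [Ring G] [Algebra ℂ G] (H : QuasiBialgebra G)
    (M : Type*) [Ring M] [Algebra ℂ M] where
  coact : M →ₐ[ℂ] M ⊗[ℂ] G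
  reassoc : (M ⊗[ℂ] (G ⊗[ℂ] G))ˣ
  intertwine : ∀ m : M,
    (reassoc : M ⊗[ℂ] (G ⊗[ℂ] G)) * tensorSplit coact G (coact m) =
      tensorRight M H.comul (coact m) * (reassoc : M ⊗[ℂ] (G ⊗[ℂ] G))
  pentagon :
    ((1 : M) ⊗ₜ[ℂ] (H.reassoc : G ⊗[ℂ] (G ⊗[ℂ] G))) *
        tensorRight M (tensorSplit H.comul G) (reassoc : M ⊗[ℂ] (G ⊗[ℂ] G)) *
        tensorOne M G G G (reassoc : M ⊗[ℂ] (G ⊗[ℂ] G)) =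
      tensorRight M (tensorRight G H.comul) (reassoc : M ⊗[ℂ] (G ⊗[ℂ] G)) *
        tensorSplit coact (G ⊗[ℂ] G) (reassoc : M ⊗[ℂ] (G ⊗[ℂ] G))
  counit_coact : ∀ m : M, killRight M H.counit (coact m) = m
  counit_reassoc_middle :
    tensorRight M (killLeft H.counit G) (reassoc : M ⊗[ℂ] (G ⊗[ℂ] G)) = 1
  counit_reassoc_right :
    tensorRight M (killRight G H.counit) (reassoc : M ⊗[ℂ] (G ⊗[ℂ] G)) = 1

/-- A quasi-commuting pair `(λ, φ_λ, ρ, φ_ρ, φ_λρ)` of left and right coactions on `M`. -/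
structure QuasiCommutingPair {G : Type*} [Ring G] [Algebra ℂ G] (H : QuasiBialgebra G)
    (M : Type*) [Ring M] [Algebra ℂ M] where
  left : LeftCoaction H M
  right : RightCoaction H M
  /-- The mixed reassociator `φ_λρ`. -/
  mixed : (G ⊗[ℂ] (M ⊗[ℂ] G))ˣ
  intertwine : ∀ m : M,
    (mixed : G ⊗[ℂ] (M ⊗[ℂ] G)) * tensorSplit left.coact G (right.coact m) =
      tensorRight G right.coact (left.coact m) * (mixed : G ⊗[ℂ] (M ⊗[ℂ] G))
  pentagon_left :
    ((1 : G) ⊗ₜ[ℂ] (mixed : G ⊗[ℂ] (M ⊗[ℂ] G))) *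
        tensorRight G (tensorSplit left.coact G) (mixed : G ⊗[ℂ] (M ⊗[ℂ] G)) *
        tensorOne G G M G (left.reassoc : G ⊗[ℂ] (G ⊗[ℂ] M)) =
      tensorRight G (tensorRight G right.coact) (left.reassoc : G ⊗[ℂ] (G ⊗[ℂ] M)) *
        tensorSplit H.comul (M ⊗[ℂ] G) (mixed : G ⊗[ℂ] (M ⊗[ℂ] G))
  pentagon_right :
    ((1 : G) ⊗ₜ[ℂ] (right.reassoc : M ⊗[ℂ] (G ⊗[ℂ] G))) *
        tensorRight G (tensorSplit right.coact G) (mixed : G ⊗[ℂ] (M ⊗[ℂ] G)) *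
        tensorOne G M G G (mixed : G ⊗[ℂ] (M ⊗[ℂ] G)) =
      tensorRight G (tensorRight M H.comul) (mixed : G ⊗[ℂ] (M ⊗[ℂ] G)) *
        tensorSplit left.coact (G ⊗[ℂ] G) (right.reassoc : M ⊗[ℂ] (G ⊗[ℂ] G))

/-! ### Normal coherent `λρ`-intertwiners -/

/-- `m ⊗ x ⊗ y ↦ x ⊗ y ⊗ γ(m)`, i.e. `t ↦ (t³¹²)_A`. -/
def leg312 {G M A : Type*} [Semiring G] [Algebra ℂ G] [Semiring M] [Algebra ℂ M] [Semiring A] [Algebra ℂ A]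
    (γ : M →ₐ[ℂ] A) : M ⊗[ℂ] (G ⊗[ℂ] G) →ₐ[ℂ] G ⊗[ℂ] (G ⊗[ℂ] A) :=
  (tensorRight G (tensorRight G γ)).comp
    ((Algebra.TensorProduct.assoc ℂ ℂ ℂ G G M).toAlgHom.comp
      (Algebra.TensorProduct.comm ℂ M (G ⊗[ℂ] G)).toAlgHom)

/-- `x ⊗ m ⊗ y ↦ x ⊗ y ⊗ γ(m)`, i.e. `t ↦ (t¹³²)_A`. -/
def leg132 {G M A : Type*} [Semiring G] [Algebra ℂ G] [Semiring M] [Algebra ℂ M] [Semiring A] [Algebra ℂ A]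
    (γ : M →ₐ[ℂ] A) : G ⊗[ℂ] (M ⊗[ℂ] G) →ₐ[ℂ] G ⊗[ℂ] (G ⊗[ℂ] A) :=
  (tensorRight G (tensorRight G γ)).comp
    (tensorRight G (Algebra.TensorProduct.comm ℂ M G).toAlgHom)

/-- `x ⊗ a ↦ x ⊗ 1 ⊗ a`, i.e. `T ↦ T¹³`. -/
def leg13 (G A : Type*) [Semiring G] [Algebra ℂ G] [Semiring A] [Algebra ℂ A] :
    G ⊗[ℂ] A →ₐ[ℂ] G ⊗[ℂ] (G ⊗[ℂ] A) :=
  tensorRight G Algebra.TensorProduct.includeRight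

/-- `T ∈ G ⊗ A` is a normal coherent `λρ`-intertwiner with respect to `γ : M → A`. -/
structure IsNormalCoherentIntertwiner {G : Type*} [Ring G] [Algebra ℂ G] {H : QuasiBialgebra G}
    {M : Type*} [Ring M] [Algebra ℂ M] (P : QuasiCommutingPair H M)
    {A : Type*} [Ring A] [Algebra ℂ A] (γ : M →ₐ[ℂ] A) (T : G ⊗[ℂ] A) : Prop where
  /-- `(ε ⊗ id)(T) = 1` -/
  normal : killLeft H.counit A T = 1
  /-- `T λ_A(m) = ρ^op_A(m) T` -/
  intertwine : ∀ m : M,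
    T * tensorRight G γ (P.left.coact m) =
      tensorRight G γ (Algebra.TensorProduct.comm ℂ M G (P.right.coact m)) * T
  /-- `(φ_ρ³¹²)_A T¹³ (φ_λρ¹³²)⁻¹_A T²³ (φ_λ)_A = (Δ ⊗ id)(T)` -/
  coherent :
    leg312 γ (P.right.reassoc : M ⊗[ℂ] (G ⊗[ℂ] G)) * leg13 G A T *
        leg132 γ ((P.mixed⁻¹ : (G ⊗[ℂ] (M ⊗[ℂ] G))ˣ) : G ⊗[ℂ] (M ⊗[ℂ] G)) *
        ((1 : G) ⊗ₜ[ℂ] T) *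
        tensorRight G (tensorRight G γ) (P.left.reassoc : G ⊗[ℂ] (G ⊗[ℂ] M)) =
      tensorSplit H.comul A T

/-! ### Universal extensions -/

/-- `M₁`, with the embedding `ι : M → M₁` and the linear map `Γ : Ĝ → M₁`, is a unital algebra
extension of `M` with the universal property: it is generated by `M` and `Γ(Ĝ)`, and for every
algebra map `γ : M → A` the relation `γ_T(Γ(φ)) = (φ ⊗ id)(T)` for all `φ ∈ Ĝ` is a one-to-one
correspondence between algebra maps `γ_T : M₁ → A` extending `γ` and normal coherent
`λρ`-intertwiners `T ∈ G ⊗ A`. -/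
structure IsUniversalExtension.{u, v, w} {G : Type u} [Ring G] [Algebra ℂ G]
    {H : QuasiBialgebra G} {M : Type v} [Ring M] [Algebra ℂ M] (P : QuasiCommutingPair H M)
    {M₁ : Type w} [Ring M₁] [Algebra ℂ M₁] (ι : M →ₐ[ℂ] M₁)
    (Γ : Module.Dual ℂ G →ₗ[ℂ] M₁) : Prop where
  injective : Function.Injective ι
  generated : Algebra.adjoin ℂ (Set.range ι ∪ Set.range Γ) = ⊤
  exists_unique_intertwiner : ∀ (A : Type w) [Ring A] [Algebra ℂ A] (γ : M →ₐ[ℂ] A)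
    (γT : M₁ →ₐ[ℂ] A), γT.comp ι = γ →
      ∃! T : G ⊗[ℂ] A, IsNormalCoherentIntertwiner P γ T ∧
        ∀ φ : Module.Dual ℂ G, γT (Γ φ) = sliceLeft T φ
  exists_unique_map : ∀ (A : Type w) [Ring A] [Algebra ℂ A] (γ : M →ₐ[ℂ] A)
    (T : G ⊗[ℂ] A), IsNormalCoherentIntertwiner P γ T →
      ∃! γT : M₁ →ₐ[ℂ] A, γT.comp ι = γ ∧
        ∀ φ : Module.Dual ℂ G, γT (Γ φ) = sliceLeft T φ

/-- `p_λ = φ_λ² S⁻¹(φ_λ¹ β) ⊗ φ_λ³ ∈ G ⊗ M`. -/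
def pLambda {G : Type*} [Ring G] [Algebra ℂ G] (H : QuasiHopfAlgebra G)
    {M : Type*} [Ring M] [Algebra ℂ M] (L : LeftCoaction H.toQuasiBialgebra M) : G ⊗[ℂ] M :=
  TensorProduct.map
    (mulTwo LinearMap.id (antipodeInvMap H.antipode ∘ₗ LinearMap.mulRight ℂ H.β) ∘ₗ
      (TensorProduct.comm ℂ G G).toLinearMap) LinearMap.id
    ((TensorProduct.assoc ℂ G G M).symm (L.reassoc : G ⊗[ℂ] (G ⊗[ℂ] M)))

/-- `q_ρ = φ_ρ¹ ⊗ S⁻¹(α φ_ρ³) φ_ρ² ∈ M ⊗ G`. -/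
def qRho {G : Type*} [Ring G] [Algebra ℂ G] (H : QuasiHopfAlgebra G)
    {M : Type*} [Ring M] [Algebra ℂ M] (R : RightCoaction H.toQuasiBialgebra M) : M ⊗[ℂ] G :=
  TensorProduct.map LinearMap.id
    (mulTwo (antipodeInvMap H.antipode ∘ₗ LinearMap.mulLeft ℂ H.α) LinearMap.id ∘ₗ
      (TensorProduct.comm ℂ G G).toLinearMap)
    (R.reassoc : M ⊗[ℂ] (G ⊗[ℂ] G))

/-- `μ_L : Ĝ ⊗ M → M₁`, `φ ⊗ m ↦ (id ⊗ φ₍₁₎)(q) Γ(φ₍₂₎) m`. -/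
def muLeft {G : Type*} [Ring G] [Algebra ℂ G] [FiniteDimensional ℂ G]
    {M : Type*} [Ring M] [Algebra ℂ M] {M₁ : Type*} [Ring M₁] [Algebra ℂ M₁]
    (ι : M →ₐ[ℂ] M₁) (Γ : Module.Dual ℂ G →ₗ[ℂ] M₁) (q : M ⊗[ℂ] G) :
    Module.Dual ℂ G ⊗[ℂ] M →ₗ[ℂ] M₁ :=
  mulTwo (mulTwo (ι.toLinearMap ∘ₗ sliceRight q) Γ ∘ₗ dualComul G) ι.toLinearMap

/-- `μ_R : M ⊗ Ĝ → M₁`, `m ⊗ φ ↦ m Γ(φ₍₁₎) (φ₍₂₎ ⊗ id)(p)`. -/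
def muRight {G : Type*} [Ring G] [Algebra ℂ G] [FiniteDimensional ℂ G]
    {M : Type*} [Ring M] [Algebra ℂ M] {M₁ : Type*} [Ring M₁] [Algebra ℂ M₁]
    (ι : M →ₐ[ℂ] M₁) (Γ : Module.Dual ℂ G →ₗ[ℂ] M₁) (p : G ⊗[ℂ] M) :
    M ⊗[ℂ] Module.Dual ℂ G →ₗ[ℂ] M₁ :=
  mulTwo ι.toLinearMap (mulTwo Γ (ι.toLinearMap ∘ₗ sliceLeft p) ∘ₗ dualComul G)

end

universe u v w

/-! The argument never writes down a product on `M ⊗ Ĝ` and never checks associativity of one. The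
algebra is realised by operators and then shown to be universal. Write `C(φ)` for `(φ ⊗ id)(C)`.

Straightening. The antipode axioms and the coaction pentagon give, besides `p_λ`, a companion `q_λ`
such that `C ↦ C p_λ` is a bijection from intertwiners to tensors `R` with `R (1 ⊗ m) = ρ^op(m₍₀₎) R
(S⁻¹(m₍₋₁₎) ⊗ 1)`. Its inverse lets `q_λ` act on `R` in the same two-sided way
(`AntipodeCoaction.isStraightening`). A right coaction is a left coaction for the opposite
coproduct, so the same lemma handles `C ↦ q_ρ C`.

Spanning. Multiplied by `p_λ`, coherence becomes a formula for `(T p_λ)¹³ T²³` whose entries lie in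
the span of `γ(M) T(Ĝ) γ(M)`. That span is therefore an algebra, and straightening reduces it to the
span of `γ(M) (T p_λ)(Ĝ)`, and also to that of `(q_ρ T)(Ĝ) γ(M)` (`adjoin_le_range_leftMap`,
`adjoin_le_range_rightMap`).

Model. If `μ_R` is bijective, the coinduced module `Hom_M(M₁, M)` is `Hom(Ĝ, M) = G ⊗ M`, so `M₁`
should act on `G ⊗ M`. Let `R` be the canonical tensor of `G ⊗ Hom(G ⊗ M, M)` and `C` the
intertwiner with `C p_λ = R`. The requirement `C¹³ φ_λρ⁻¹ T²³ = φ_ρ⁻¹ (Δ ⊗ id)(C) φ_λ⁻¹` becomes a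
prescription of `R¹³ T²³`, and because `R` is canonical it can be solved for `T`. The counit axioms
and the pentagons give normality and coherence of `T` after multiplication by `C`, and `R` cancels
(`BlockModel.legProduct_T_T`). Finally `(ε ⊗ id)(C)` commutes with `M` and composes with `T` to `C`,
so `R` can be read off from `T`, and `m ⊗ φ ↦ m (T p_λ)(φ)` is injective
(`leftMap_tensorIntertwiner_injective`).

Universality. Given a second normal coherent intertwiner, pair it with the first in the product
algebra. By spanning and injectivity, the subalgebra generated by the pair projects bijectively to
the first factor, so it is the graph of the required homomorphism (`exists_extension`).

Bijectivity. Any universal extension maps to the model, so `μ_R` is injective. For `μ_L` no second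
algebra is needed: an intertwiner `T'`, not necessarily coherent, with `q_ρ T'` canonical suffices,
because bijectivity of `μ_R` provides a left `M`-linear map which carries `T p_λ` to `T' p_λ` and
hence `μ_L` to its injective counterpart (`rightMap_injective`). -/

namespace DiagonalCrossedProduct

/-! ### Reduction to pure tensors -/

section Induction

variable {X Y Z W : Type*} [AddCommGroup X] [Module ℂ X] [AddCommGroup Y] [Module ℂ Y]
  [AddCommGroup Z] [Module ℂ Z] [AddCommGroup W] [Module ℂ W]

@[elab_as_elim] theorem tensor_induction {motive : X ⊗[ℂ] Y → Prop}
    (tmul : ∀ x y, motive (x ⊗ₜ y)) (add : ∀ a b, motive a → motive b → motive (a + b))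
    (t : X ⊗[ℂ] Y) : motive t :=
  t.induction_on (by simpa using tmul 0 0) tmul add

@[elab_as_elim] theorem tensor_induction₃ {motive : X ⊗[ℂ] (Y ⊗[ℂ] Z) → Prop}
    (tmul : ∀ x y z, motive (x ⊗ₜ (y ⊗ₜ z))) (add : ∀ a b, motive a → motive b → motive (a + b))
    (t : X ⊗[ℂ] (Y ⊗[ℂ] Z)) : motive t :=
  tensor_induction (motive := motive) (fun x t =>
    tensor_induction (motive := fun t => motive (x ⊗ₜ t)) (tmul x)
    (fun a b ha hb => by simpa only [TensorProduct.tmul_add] using add _ _ ha hb) t) add t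

@[elab_as_elim] theorem tensor_induction₄ {motive : X ⊗[ℂ] (Y ⊗[ℂ] (Z ⊗[ℂ] W)) → Prop}
    (tmul : ∀ x y z w, motive (x ⊗ₜ (y ⊗ₜ (z ⊗ₜ w))))
    (add : ∀ a b, motive a → motive b → motive (a + b))
    (t : X ⊗[ℂ] (Y ⊗[ℂ] (Z ⊗[ℂ] W))) : motive t :=
  tensor_induction (motive := motive) (fun x t =>
    tensor_induction₃ (motive := fun t => motive (x ⊗ₜ t)) (tmul x)
    (fun a b ha hb => by simpa only [TensorProduct.tmul_add] using add _ _ ha hb) t) add t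

end Induction

section Tmul

variable {X Y Z W : Type*} [Semiring X] [Algebra ℂ X] [Semiring Y] [Algebra ℂ Y]
  [Semiring Z] [Algebra ℂ Z] [Semiring W] [Algebra ℂ W]

@[simp] theorem tensorSplit_tmul (f : X →ₐ[ℂ] Y ⊗[ℂ] Z) (x : X) (w : W) :
    tensorSplit f W (x ⊗ₜ w) = Algebra.TensorProduct.assoc ℂ ℂ ℂ Y Z W (f x ⊗ₜ w) := rfl

@[simp] theorem tensorRight_tmul (f : X →ₐ[ℂ] Y) (w : W) (x : X) :
    tensorRight W f (w ⊗ₜ x) = w ⊗ₜ f x := rfl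

@[simp] theorem tensorOne_tmul (x : X) (y : Y) (z : Z) :
    tensorOne X Y Z W (x ⊗ₜ (y ⊗ₜ z)) = x ⊗ₜ (y ⊗ₜ (z ⊗ₜ 1)) := rfl

@[simp] theorem killLeft_tmul (f : X →ₐ[ℂ] ℂ) (x : X) (w : W) :
    killLeft f W (x ⊗ₜ w) = f x • w := rfl

@[simp] theorem killRight_tmul (f : X →ₐ[ℂ] ℂ) (x : X) (w : W) :
    killRight W f (w ⊗ₜ x) = f x • w := rfl

end Tmul

/-! ### Anti-automorphisms and their inverses -/

section Antipode

variable {G : Type*} [Ring G] [Algebra ℂ G] (S : G ≃ₐ[ℂ] Gᵐᵒᵖ)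

theorem antipodeMap_mul (x y : G) :
    antipodeMap S (x * y) = antipodeMap S y * antipodeMap S x := by
  simp [antipodeMap]

theorem antipodeInvMap_mul (x y : G) :
    antipodeInvMap S (x * y) = antipodeInvMap S y * antipodeInvMap S x := by
  simp [antipodeInvMap]

@[simp] theorem antipodeMap_one : antipodeMap S 1 = 1 := by simp [antipodeMap]

@[simp] theorem antipodeInvMap_one : antipodeInvMap S 1 = 1 := by simp [antipodeInvMap]

@[simp] theorem antipodeMap_antipodeInvMap (x : G) :
    antipodeMap S (antipodeInvMap S x) = x := by simp [antipodeMap, antipodeInvMap]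

@[simp] theorem antipodeInvMap_antipodeMap (x : G) :
    antipodeInvMap S (antipodeMap S x) = x := by simp [antipodeMap, antipodeInvMap]

theorem mulTwo_tmul {X Y : Type*} [AddCommGroup X] [Module ℂ X] [AddCommGroup Y] [Module ℂ Y]
    (f : X →ₗ[ℂ] G) (g : Y →ₗ[ℂ] G) (x : X) (y : Y) : mulTwo f g (x ⊗ₜ y) = f x * g y := rfl

/-- The inverse of an anti-automorphism, as an anti-automorphism. -/
def antipodeSymm : G ≃ₐ[ℂ] Gᵐᵒᵖ := (AlgEquiv.opOp ℂ G).trans (AlgEquiv.op S.symm)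

@[simp] theorem antipodeMap_antipodeSymm :
    antipodeMap (antipodeSymm S) = antipodeInvMap S := rfl

@[simp] theorem antipodeInvMap_antipodeSymm :
    antipodeInvMap (antipodeSymm S) = antipodeMap S := rfl

end Antipode

/-! ### Two-sided actions twisted by the antipode -/

section Conjugation

variable {G M B : Type*} [Ring G] [Algebra ℂ G] [Ring M] [Algebra ℂ M] [Ring B] [Algebra ℂ B]

/-- Right multiplication by `s (S⁻¹ x)`, as a representation of `G`. -/
def rightConj (S : G ≃ₐ[ℂ] Gᵐᵒᵖ) (s : G →ₐ[ℂ] B) : G →ₐ[ℂ] Module.End ℂ B :=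
  AlgHom.ofLinearMap ((LinearMap.mul ℂ B).flip ∘ₗ s.toLinearMap ∘ₗ antipodeInvMap S)
    (by ext; simp) (fun x y => by ext z; simp [antipodeInvMap_mul, mul_assoc])

/-- The action `(x ⊗ m) · Z = a(m) Z s(S⁻¹ x)` of `G ⊗ M` on `B`. -/
def conj (S : G ≃ₐ[ℂ] Gᵐᵒᵖ) (a : M →ₐ[ℂ] B) (s : G →ₐ[ℂ] B) :
    G ⊗[ℂ] M →ₐ[ℂ] Module.End ℂ B :=
  Algebra.TensorProduct.lift (rightConj S s) ((Algebra.lmul ℂ B).comp a)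
    (fun x m => by ext z; simp [rightConj, mul_assoc])

@[simp] theorem conj_tmul (S : G ≃ₐ[ℂ] Gᵐᵒᵖ) (a : M →ₐ[ℂ] B) (s : G →ₐ[ℂ] B) (x : G) (m : M)
    (Z : B) : conj S a s (x ⊗ₜ m) Z = a m * Z * s (antipodeInvMap S x) := by
  simp [conj, rightConj]

/-- The bilinear map `(x ⊗ m, Z) ↦ s(S x) Z b(m)`. -/
def coconj (S : G ≃ₐ[ℂ] Gᵐᵒᵖ) (b : M →ₐ[ℂ] B) (s : G →ₐ[ℂ] B) :
    G ⊗[ℂ] M →ₗ[ℂ] Module.End ℂ B :=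
  TensorProduct.lift (((LinearMap.mul ℂ (Module.End ℂ B)).compl₁₂
    ((LinearMap.mul ℂ B) ∘ₗ s.toLinearMap ∘ₗ antipodeMap S)
    ((LinearMap.mul ℂ B).flip ∘ₗ b.toLinearMap)))

@[simp] theorem coconj_tmul (S : G ≃ₐ[ℂ] Gᵐᵒᵖ) (b : M →ₐ[ℂ] B) (s : G →ₐ[ℂ] B) (x : G) (m : M)
    (Z : B) : coconj S b s (x ⊗ₜ m) Z = s (antipodeMap S x) * Z * b m := by
  simp [coconj, mul_assoc]

end Conjugation

/-! ### Contractions built from the antipode, `α` and `β` -/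

section Forms

variable {G M : Type*} [Ring G] [Algebra ℂ G] [Ring M] [Algebra ℂ M]

/-- `x ⊗ y ⊗ m ↦ y S⁻¹(x β) ⊗ m`. -/
def pForm (S : G ≃ₐ[ℂ] Gᵐᵒᵖ) (β : G) : G ⊗[ℂ] (G ⊗[ℂ] M) →ₗ[ℂ] G ⊗[ℂ] M :=
  TensorProduct.map
    (mulTwo LinearMap.id (antipodeInvMap S ∘ₗ LinearMap.mulRight ℂ β) ∘ₗ
      (TensorProduct.comm ℂ G G).toLinearMap) LinearMap.id ∘ₗ
    (TensorProduct.assoc ℂ G G M).symm.toLinearMap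

/-- `x ⊗ y ⊗ m ↦ S(x) α y ⊗ m`. -/
def qForm (S : G ≃ₐ[ℂ] Gᵐᵒᵖ) (α : G) : G ⊗[ℂ] (G ⊗[ℂ] M) →ₗ[ℂ] G ⊗[ℂ] M :=
  TensorProduct.map
    (mulTwo (LinearMap.mulRight ℂ α ∘ₗ antipodeMap S) LinearMap.id) LinearMap.id ∘ₗ
    (TensorProduct.assoc ℂ G G M).symm.toLinearMap

/-- `x ⊗ y ⊗ m ↦ x β y ⊗ m`. -/
def bForm (β : G) : G ⊗[ℂ] (G ⊗[ℂ] M) →ₗ[ℂ] G ⊗[ℂ] M :=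
  TensorProduct.map (mulTwo (LinearMap.mulRight ℂ β) LinearMap.id) LinearMap.id ∘ₗ
    (TensorProduct.assoc ℂ G G M).symm.toLinearMap

/-- `x ⊗ y ⊗ z ⊗ m ↦ x β S(y) α z ⊗ m`. -/
def bqForm (S : G ≃ₐ[ℂ] Gᵐᵒᵖ) (α β : G) :
    G ⊗[ℂ] (G ⊗[ℂ] (G ⊗[ℂ] M)) →ₗ[ℂ] G ⊗[ℂ] M :=
  bForm β ∘ₗ (qForm S α).lTensor G

variable (S : G ≃ₐ[ℂ] Gᵐᵒᵖ) (α β : G)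

@[simp] theorem pForm_tmul (x y : G) (m : M) :
    pForm S β (x ⊗ₜ (y ⊗ₜ m)) = (y * antipodeInvMap S (x * β)) ⊗ₜ m := by
  simp [pForm, mulTwo_tmul]

@[simp] theorem qForm_tmul (x y : G) (m : M) :
    qForm S α (x ⊗ₜ (y ⊗ₜ m)) = (antipodeMap S x * α * y) ⊗ₜ m := by
  simp [qForm, mulTwo_tmul]

@[simp] theorem bqForm_tmul (x y z : G) (m : M) :
    bqForm S α β (x ⊗ₜ (y ⊗ₜ (z ⊗ₜ m))) = (x * β * (antipodeMap S y * α * z)) ⊗ₜ m := by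
  simp [bqForm, bForm, mulTwo_tmul]

variable {S α β} {Δ : G →ₐ[ℂ] G ⊗[ℂ] G} {ε : G →ₐ[ℂ] ℂ}

/-- `S⁻¹` reverses products, so the first leg of the left factor comes out on the far right as
`S⁻¹`, while its coacted legs stay on the left. This is the shape of the `conj` action. -/
theorem pForm_tensorRight_mul (c : M →ₐ[ℂ] G ⊗[ℂ] M) (Y : G ⊗[ℂ] M) (Z : G ⊗[ℂ] (G ⊗[ℂ] M)) :
    pForm S β (tensorRight G c Y * Z) =
      conj S c Algebra.TensorProduct.includeLeft Y (pForm S β Z) := by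
  refine tensor_induction (fun x m => ?_)
    (fun a b ha hb => by simp only [map_add, add_mul, ha, hb, LinearMap.add_apply]) Y
  refine tensor_induction₃ (fun z₁ z₂ z₃ => ?_)
    (fun a b ha hb => by simp only [map_add, mul_add, ha, hb]) Z
  simp only [tensorRight_tmul, Algebra.TensorProduct.tmul_mul_tmul, conj_tmul, pForm_tmul]
  generalize c m = t
  refine tensor_induction (fun u v => ?_)
    (fun a b ha hb => by simp only [TensorProduct.tmul_add, map_add, add_mul, ha, hb]) t
  simp [antipodeInvMap_mul, mul_assoc]

theorem qForm_mul_tensorRight (c : M →ₐ[ℂ] G ⊗[ℂ] M) (Y : G ⊗[ℂ] M) (Z : G ⊗[ℂ] (G ⊗[ℂ] M)) :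
    qForm S α (Z * tensorRight G c Y) =
      coconj S c Algebra.TensorProduct.includeLeft Y (qForm S α Z) := by
  refine tensor_induction (fun x m => ?_)
    (fun a b ha hb => by simp only [map_add, mul_add, ha, hb, LinearMap.add_apply]) Y
  refine tensor_induction₃ (fun z₁ z₂ z₃ => ?_)
    (fun a b ha hb => by simp only [map_add, add_mul, ha, hb]) Z
  simp only [tensorRight_tmul, Algebra.TensorProduct.tmul_mul_tmul, coconj_tmul, qForm_tmul]
  generalize c m = t
  refine tensor_induction (fun u v => ?_)
    (fun a b ha hb => by simp only [TensorProduct.tmul_add, map_add, mul_add, ha, hb]) t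
  simp [antipodeMap_mul, mul_assoc]

/-- `S⁻¹` applied to `a₍₁₎ β S(a₍₂₎) = ε(a) β`; this is the form in which the axiom meets `pForm`.
-/
theorem antipodeInv_right
    (h : ∀ a, mulTwo (LinearMap.mulRight ℂ β) (antipodeMap S) (Δ a) = ε a • β) (a : G) :
    mulTwo LinearMap.id (antipodeInvMap S ∘ₗ LinearMap.mulRight ℂ β)
      (TensorProduct.comm ℂ G G (Δ a)) = ε a • antipodeInvMap S β := by
  rw [← map_smul, ← h]
  generalize Δ a = t
  refine tensor_induction (fun u v => ?_) (fun a b ha hb => by simp only [map_add, ha, hb]) t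
  simp [mulTwo_tmul, antipodeInvMap_mul, mul_assoc]

/-- The two halves of the coproduct become neighbours, as `a₍₂₎ S⁻¹(a₍₁₎ β)`, and collapse to
`ε(a)`. All the collapse lemmas below work this way, at `α` or at `β`. -/
theorem pForm_mul_tensorSplit
    (h : ∀ a, mulTwo (LinearMap.mulRight ℂ β) (antipodeMap S) (Δ a) = ε a • β)
    (Z : G ⊗[ℂ] (G ⊗[ℂ] M)) (Y : G ⊗[ℂ] M) :
    pForm S β (Z * tensorSplit Δ M Y) = pForm S β Z * ((1 : G) ⊗ₜ killLeft ε M Y) := by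
  refine tensor_induction (fun x m => ?_)
    (fun a b ha hb => by simp only [map_add, mul_add, TensorProduct.tmul_add, ha, hb]) Y
  refine tensor_induction₃ (fun z₁ z₂ z₃ => ?_)
    (fun a b ha hb => by simp only [map_add, add_mul, ha, hb]) Z
  have key : ∀ t : G ⊗[ℂ] G, pForm S β (z₁ ⊗ₜ (z₂ ⊗ₜ z₃) *
      Algebra.TensorProduct.assoc ℂ ℂ ℂ G G M (t ⊗ₜ m)) =
      (z₂ * mulTwo LinearMap.id (antipodeInvMap S ∘ₗ LinearMap.mulRight ℂ β)
        (TensorProduct.comm ℂ G G t) * antipodeInvMap S z₁) ⊗ₜ (z₃ * m) := fun t => by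
    refine tensor_induction (fun u v => ?_) (fun a b ha hb => by
      simp only [map_add, mul_add, add_mul, TensorProduct.add_tmul, ha, hb]) t
    simp [mulTwo_tmul, antipodeInvMap_mul, mul_assoc]
  rw [tensorSplit_tmul, key, antipodeInv_right h]
  simp [antipodeInvMap_mul, TensorProduct.smul_tmul, mul_assoc]

theorem qForm_tensorSplit_mul
    (h : ∀ a, mulTwo (LinearMap.mulRight ℂ α ∘ₗ antipodeMap S) LinearMap.id (Δ a) = ε a • α)
    (Y : G ⊗[ℂ] M) (Z : G ⊗[ℂ] (G ⊗[ℂ] M)) :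
    qForm S α (tensorSplit Δ M Y * Z) = ((1 : G) ⊗ₜ killLeft ε M Y) * qForm S α Z := by
  refine tensor_induction (fun x m => ?_)
    (fun a b ha hb => by simp only [map_add, add_mul, TensorProduct.tmul_add, ha, hb]) Y
  refine tensor_induction₃ (fun z₁ z₂ z₃ => ?_)
    (fun a b ha hb => by simp only [map_add, mul_add, ha, hb]) Z
  have key : ∀ t : G ⊗[ℂ] G, qForm S α
      (Algebra.TensorProduct.assoc ℂ ℂ ℂ G G M (t ⊗ₜ m) * z₁ ⊗ₜ (z₂ ⊗ₜ z₃)) =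
      (antipodeMap S z₁ * mulTwo (LinearMap.mulRight ℂ α ∘ₗ antipodeMap S) LinearMap.id t
        * z₂) ⊗ₜ (m * z₃) := fun t => by
    refine tensor_induction (fun u v => ?_) (fun a b ha hb => by
      simp only [map_add, mul_add, add_mul, TensorProduct.add_tmul, ha, hb]) t
    simp [mulTwo_tmul, antipodeMap_mul, mul_assoc]
  rw [tensorSplit_tmul, key, h]
  simp [TensorProduct.smul_tmul]

/-- The composite contraction is `x ⊗ y ⊗ z ⊗ m ↦ z S⁻¹(S(x) α y β) ⊗ m`, so a coproduct placed on
the right in the second and third legs meets at `β`. -/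
theorem pForm_qForm_mul_tensorRight
    (h : ∀ a, mulTwo (LinearMap.mulRight ℂ β) (antipodeMap S) (Δ a) = ε a • β)
    (W : G ⊗[ℂ] (G ⊗[ℂ] (G ⊗[ℂ] M))) (Y : G ⊗[ℂ] (G ⊗[ℂ] M)) :
    pForm S β (qForm S α (W * tensorRight G (tensorSplit Δ M) Y)) =
      pForm S β (qForm S α W) * tensorRight G (killLeft ε M) Y := by
  refine tensor_induction₃ (fun y₁ y₂ m => ?_)
    (fun a b ha hb => by simp only [map_add, mul_add, ha, hb]) Y
  refine tensor_induction₄ (fun w₁ w₂ w₃ w₄ => ?_)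
    (fun a b ha hb => by simp only [map_add, add_mul, ha, hb]) W
  have key : ∀ t : G ⊗[ℂ] G, pForm S β (qForm S α (w₁ ⊗ₜ (w₂ ⊗ₜ (w₃ ⊗ₜ w₄)) *
      y₁ ⊗ₜ Algebra.TensorProduct.assoc ℂ ℂ ℂ G G M (t ⊗ₜ m))) =
      (w₃ * mulTwo LinearMap.id (antipodeInvMap S ∘ₗ LinearMap.mulRight ℂ β)
        (TensorProduct.comm ℂ G G t) * antipodeInvMap S (antipodeMap S w₁ * α * w₂) * y₁)
        ⊗ₜ (w₄ * m) := fun t => by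
    refine tensor_induction (fun u v => ?_) (fun a b ha hb => by
      simp only [map_add, mul_add, add_mul, TensorProduct.add_tmul, TensorProduct.tmul_add,
        ha, hb]) t
    simp [mulTwo_tmul, antipodeInvMap_mul, antipodeMap_mul, mul_assoc]
  rw [tensorRight_tmul, tensorSplit_tmul, key, antipodeInv_right h]
  simp [antipodeInvMap_mul, TensorProduct.smul_tmul, mul_assoc]

/-- `z S⁻¹(S(x) α y β) = S⁻¹(S(x) α y β S(z))`: the contraction of the antipode axiom for `φ⁻¹`,
seen through `S⁻¹`. -/
theorem pForm_qForm_tensorOne (t : G ⊗[ℂ] (G ⊗[ℂ] G)) :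
    pForm S β (qForm S α (tensorOne G G G M t)) =
      antipodeInvMap S (mulTwo (LinearMap.mulRight ℂ α ∘ₗ antipodeMap S)
        (mulTwo (LinearMap.mulRight ℂ β) (antipodeMap S)) t) ⊗ₜ 1 := by
  refine tensor_induction₃ (fun x y z => ?_)
    (fun a b ha hb => by simp only [map_add, TensorProduct.add_tmul, ha, hb]) t
  simp [mulTwo_tmul, antipodeInvMap_mul, mul_assoc]

theorem pForm_qForm_mul (c : M →ₐ[ℂ] G ⊗[ℂ] M) (Y Z : G ⊗[ℂ] (G ⊗[ℂ] M)) :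
    pForm S β (qForm S α (tensorRight G (tensorRight G c) Y * ((1 : G) ⊗ₜ Z))) =
      conj S c Algebra.TensorProduct.includeLeft (qForm S α Y) (pForm S β Z) := by
  refine tensor_induction₃ (fun y₁ y₂ m => ?_)
    (fun a b ha hb => by simp only [map_add, add_mul, ha, hb, LinearMap.add_apply]) Y
  refine tensor_induction₃ (fun z₁ z₂ z₃ => ?_)
    (fun a b ha hb => by simp only [map_add, mul_add, TensorProduct.tmul_add, ha, hb]) Z
  simp only [tensorRight_tmul, Algebra.TensorProduct.tmul_mul_tmul, conj_tmul, pForm_tmul,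
    qForm_tmul]
  generalize c m = t
  refine tensor_induction (fun u v => ?_)
    (fun a b ha hb => by simp only [TensorProduct.tmul_add, map_add, add_mul, ha, hb]) t
  simp [antipodeInvMap_mul, mul_assoc]

/-- Rests on `S(z₂ S⁻¹(z₁ β)) = z₁ β S(z₂)`, which lets the contraction with `β` and `S` absorb the
one defining `p`. -/
theorem bqForm_mul (c : M →ₐ[ℂ] G ⊗[ℂ] M) (Y Z : G ⊗[ℂ] (G ⊗[ℂ] M)) :
    bqForm S α β (((1 : G) ⊗ₜ Y) * tensorRight G (tensorRight G c) Z) =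
      coconj S c Algebra.TensorProduct.includeLeft (pForm S β Z) (qForm S α Y) := by
  refine tensor_induction₃ (fun z₁ z₂ m => ?_)
    (fun a b ha hb => by simp only [map_add, mul_add, ha, hb, LinearMap.add_apply]) Z
  refine tensor_induction₃ (fun y₁ y₂ y₃ => ?_)
    (fun a b ha hb => by simp only [map_add, add_mul, TensorProduct.tmul_add, ha, hb]) Y
  simp only [tensorRight_tmul, Algebra.TensorProduct.tmul_mul_tmul, coconj_tmul, pForm_tmul,
    qForm_tmul]
  generalize c m = t
  refine tensor_induction (fun u v => ?_)
    (fun a b ha hb => by simp only [TensorProduct.tmul_add, map_add, mul_add, ha, hb]) t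
  simp [antipodeMap_mul, mul_assoc]

theorem bqForm_tensorOne (t : G ⊗[ℂ] (G ⊗[ℂ] G)) :
    bqForm S α β (tensorOne G G G M t) =
      mulTwo (LinearMap.mulRight ℂ β) (mulTwo (LinearMap.mulRight ℂ α ∘ₗ antipodeMap S)
        LinearMap.id) t ⊗ₜ 1 := by
  refine tensor_induction₃ (fun x y z => ?_)
    (fun a b ha hb => by simp only [map_add, TensorProduct.add_tmul, ha, hb]) t
  simp [mulTwo_tmul]

theorem bqForm_mul_tensorSplit
    (h : ∀ a, mulTwo (LinearMap.mulRight ℂ β) (antipodeMap S) (Δ a) = ε a • β)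
    (W : G ⊗[ℂ] (G ⊗[ℂ] (G ⊗[ℂ] M))) (Y : G ⊗[ℂ] (G ⊗[ℂ] M)) :
    bqForm S α β (W * tensorSplit Δ (G ⊗[ℂ] M) Y) =
      bqForm S α β W * killLeft ε (G ⊗[ℂ] M) Y := by
  refine tensor_induction₃ (fun y₁ y₂ m => ?_)
    (fun a b ha hb => by simp only [map_add, mul_add, ha, hb]) Y
  refine tensor_induction₄ (fun w₁ w₂ w₃ w₄ => ?_)
    (fun a b ha hb => by simp only [map_add, add_mul, ha, hb]) W
  have key : ∀ t : G ⊗[ℂ] G, bqForm S α β (w₁ ⊗ₜ (w₂ ⊗ₜ (w₃ ⊗ₜ w₄)) *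
      Algebra.TensorProduct.assoc ℂ ℂ ℂ G G (G ⊗[ℂ] M) (t ⊗ₜ (y₂ ⊗ₜ m))) =
      (w₁ * mulTwo (LinearMap.mulRight ℂ β) (antipodeMap S) t * antipodeMap S w₂ * α * w₃ * y₂)
        ⊗ₜ (w₄ * m) := fun t => by
    refine tensor_induction (fun u v => ?_) (fun a b ha hb => by
      simp only [map_add, mul_add, add_mul, TensorProduct.add_tmul, ha, hb]) t
    simp [mulTwo_tmul, antipodeMap_mul, mul_assoc]
  rw [tensorSplit_tmul, key, h]
  simp [mul_assoc, TensorProduct.smul_tmul']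

theorem bqForm_tensorRight_mul
    (h : ∀ a, mulTwo (LinearMap.mulRight ℂ α ∘ₗ antipodeMap S) LinearMap.id (Δ a) = ε a • α)
    (Y : G ⊗[ℂ] (G ⊗[ℂ] M)) (W : G ⊗[ℂ] (G ⊗[ℂ] (G ⊗[ℂ] M))) :
    bqForm S α β (tensorRight G (tensorSplit Δ M) Y * W) =
      tensorRight G (killLeft ε M) Y * bqForm S α β W := by
  refine tensor_induction₃ (fun y₁ y₂ m => ?_)
    (fun a b ha hb => by simp only [map_add, add_mul, ha, hb]) Y
  refine tensor_induction₄ (fun w₁ w₂ w₃ w₄ => ?_)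
    (fun a b ha hb => by simp only [map_add, mul_add, ha, hb]) W
  have key : ∀ t : G ⊗[ℂ] G, bqForm S α β (
      y₁ ⊗ₜ Algebra.TensorProduct.assoc ℂ ℂ ℂ G G M (t ⊗ₜ m) * w₁ ⊗ₜ (w₂ ⊗ₜ (w₃ ⊗ₜ w₄))) =
      (y₁ * w₁ * β * antipodeMap S w₂ *
        mulTwo (LinearMap.mulRight ℂ α ∘ₗ antipodeMap S) LinearMap.id t * w₃)
        ⊗ₜ (m * w₄) := fun t => by
    refine tensor_induction (fun u v => ?_) (fun a b ha hb => by
      simp only [map_add, mul_add, add_mul, TensorProduct.add_tmul, TensorProduct.tmul_add,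
        ha, hb]) t
    simp [mulTwo_tmul, antipodeMap_mul, mul_assoc]
  rw [tensorRight_tmul, tensorSplit_tmul, key, h]
  simp [mul_assoc, TensorProduct.smul_tmul]

end Forms

section Units

variable {A B : Type*} [Ring A] [Ring B] [Algebra ℂ A] [Algebra ℂ B] (f : A →ₐ[ℂ] B) (u : Aˣ)

theorem map_units_inv : f (u⁻¹ : Aˣ) = ((Units.map (f : A →* B) u)⁻¹ : Bˣ) := rfl

theorem map_inv_eq_one (h : f u = 1) : f (u⁻¹ : Aˣ) = 1 := by
  have := congrArg f u.mul_inv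
  rwa [map_mul, h, one_mul, map_one] at this

end Units

/-! ### Straightening elements of a coaction -/

section Frame

variable {G M : Type*} [Ring G] [Algebra ℂ G] [Ring M] [Algebra ℂ M]

/-- A left coaction of an algebra with antipode, with only those axioms of a quasi-Hopf algebra
that are needed to straighten the coaction. -/
structure AntipodeCoaction (G M : Type*) [Ring G] [Algebra ℂ G] [Ring M] [Algebra ℂ M] where
  comul : G →ₐ[ℂ] G ⊗[ℂ] G
  counit : G →ₐ[ℂ] ℂ
  base : (G ⊗[ℂ] (G ⊗[ℂ] G))ˣ
  antipode : G ≃ₐ[ℂ] Gᵐᵒᵖ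
  α : G
  β : G
  antipode_left : ∀ a : G,
    mulTwo (LinearMap.mulRight ℂ α ∘ₗ antipodeMap antipode) LinearMap.id (comul a) =
      counit a • α
  antipode_right : ∀ a : G,
    mulTwo (LinearMap.mulRight ℂ β) (antipodeMap antipode) (comul a) = counit a • β
  antipode_base :
    mulTwo (LinearMap.mulRight ℂ β)
      (mulTwo (LinearMap.mulRight ℂ α ∘ₗ antipodeMap antipode) LinearMap.id)
      (base : G ⊗[ℂ] (G ⊗[ℂ] G)) = 1
  antipode_base_inv :
    mulTwo (LinearMap.mulRight ℂ α ∘ₗ antipodeMap antipode)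
      (mulTwo (LinearMap.mulRight ℂ β) (antipodeMap antipode))
      ((base⁻¹ : (G ⊗[ℂ] (G ⊗[ℂ] G))ˣ) : G ⊗[ℂ] (G ⊗[ℂ] G)) = 1
  coact : M →ₐ[ℂ] G ⊗[ℂ] M
  reassoc : (G ⊗[ℂ] (G ⊗[ℂ] M))ˣ
  intertwine : ∀ m : M,
    tensorRight G coact (coact m) * (reassoc : G ⊗[ℂ] (G ⊗[ℂ] M)) =
      (reassoc : G ⊗[ℂ] (G ⊗[ℂ] M)) * tensorSplit comul M (coact m)
  pentagon :
    ((1 : G) ⊗ₜ[ℂ] (reassoc : G ⊗[ℂ] (G ⊗[ℂ] M))) *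
        tensorRight G (tensorSplit comul M) (reassoc : G ⊗[ℂ] (G ⊗[ℂ] M)) *
        tensorOne G G G M (base : G ⊗[ℂ] (G ⊗[ℂ] G)) =
      tensorRight G (tensorRight G coact) (reassoc : G ⊗[ℂ] (G ⊗[ℂ] M)) *
        tensorSplit comul (G ⊗[ℂ] M) (reassoc : G ⊗[ℂ] (G ⊗[ℂ] M))
  counit_coact : ∀ m : M, killLeft counit M (coact m) = m
  counit_reassoc_middle :
    tensorRight G (killLeft counit M) (reassoc : G ⊗[ℂ] (G ⊗[ℂ] M)) = 1
  counit_reassoc_left :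
    killLeft counit (G ⊗[ℂ] M) (reassoc : G ⊗[ℂ] (G ⊗[ℂ] M)) = 1

/-- Elements `p`, `q` straightening a coaction `m ↦ m₍₋₁₎ ⊗ m₍₀₎`. -/
structure IsStraightening (S : G ≃ₐ[ℂ] Gᵐᵒᵖ) (c : M →ₐ[ℂ] G ⊗[ℂ] M) (p q : G ⊗[ℂ] M) :
    Prop where
  /-- `c(m₍₀₎) p (S⁻¹(m₍₋₁₎) ⊗ 1) = p (1 ⊗ m)` -/
  conj_p : ∀ m, conj S c Algebra.TensorProduct.includeLeft (c m) p = p * ((1 : G) ⊗ₜ m)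
  /-- `c(q²) p (S⁻¹(q¹) ⊗ 1) = 1` -/
  conj_q_p : conj S c Algebra.TensorProduct.includeLeft q p = 1
  /-- `(S(m₍₋₁₎) ⊗ 1) q c(m₍₀₎) = (1 ⊗ m) q` -/
  coconj_q : ∀ m, coconj S c Algebra.TensorProduct.includeLeft (c m) q = ((1 : G) ⊗ₜ m) * q
  /-- `(S(p¹) ⊗ 1) q c(p²) = 1` -/
  coconj_p_q : coconj S c Algebra.TensorProduct.includeLeft p q = 1

namespace AntipodeCoaction

variable (L : AntipodeCoaction G M)

def p : G ⊗[ℂ] M := pForm L.antipode L.β (L.reassoc : G ⊗[ℂ] (G ⊗[ℂ] M))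

def q : G ⊗[ℂ] M :=
  qForm L.antipode L.α ((L.reassoc⁻¹ : (G ⊗[ℂ] (G ⊗[ℂ] M))ˣ) : G ⊗[ℂ] (G ⊗[ℂ] M))

theorem isStraightening : IsStraightening L.antipode L.coact L.p L.q where
  conj_p m := by
    rw [p, ← pForm_tensorRight_mul, L.intertwine, pForm_mul_tensorSplit L.antipode_right,
      L.counit_coact]
  coconj_q m := by
    -- `q` is built from the inverse reassociator, so the intertwining relation is needed with the
    -- inverse on both sides.
    have h := congrArg (fun t => ((L.reassoc⁻¹ : (G ⊗[ℂ] (G ⊗[ℂ] M))ˣ) : G ⊗[ℂ] (G ⊗[ℂ] M)) * t *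
      ((L.reassoc⁻¹ : (G ⊗[ℂ] (G ⊗[ℂ] M))ˣ) : G ⊗[ℂ] (G ⊗[ℂ] M))) (L.intertwine m)
    simp only [mul_assoc, Units.mul_inv, mul_one, Units.inv_mul_cancel_left] at h
    rw [q, ← qForm_mul_tensorRight, h, qForm_tensorSplit_mul L.antipode_left, L.counit_coact]
  conj_q_p := by
    -- The pentagon solved for the product of the two reassociators that enter `q` and `p`. On the
    -- other side, contraction collapses both coproducts to counits of reassociators, which are
    -- trivial, and leaves `base⁻¹` contracted to `1`.
    have h : tensorRight G (tensorRight G L.coact)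
          ((L.reassoc⁻¹ : (G ⊗[ℂ] (G ⊗[ℂ] M))ˣ) : G ⊗[ℂ] (G ⊗[ℂ] M)) *
          ((1 : G) ⊗ₜ[ℂ] (L.reassoc : G ⊗[ℂ] (G ⊗[ℂ] M))) =
        tensorSplit L.comul (G ⊗[ℂ] M) (L.reassoc : G ⊗[ℂ] (G ⊗[ℂ] M)) *
          (tensorOne G G G M ((L.base⁻¹ : (G ⊗[ℂ] (G ⊗[ℂ] G))ˣ) : G ⊗[ℂ] (G ⊗[ℂ] G)) *
          tensorRight G (tensorSplit L.comul M)
            ((L.reassoc⁻¹ : (G ⊗[ℂ] (G ⊗[ℂ] M))ˣ) : G ⊗[ℂ] (G ⊗[ℂ] M))) := by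
      rw [map_units_inv, map_units_inv, map_units_inv, Units.inv_mul_eq_iff_eq_mul, ← mul_assoc, ← mul_assoc,
        Units.eq_mul_inv_iff_mul_eq, Units.eq_mul_inv_iff_mul_eq]
      exact L.pentagon
    rw [p, q, ← pForm_qForm_mul, h, qForm_tensorSplit_mul L.antipode_left,
      L.counit_reassoc_left, ← Algebra.TensorProduct.one_def, one_mul,
      pForm_qForm_mul_tensorRight L.antipode_right, pForm_qForm_tensorOne, L.antipode_base_inv,
      map_inv_eq_one _ _ L.counit_reassoc_middle]
    simp [Algebra.TensorProduct.one_def]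
  coconj_p_q := by
    -- The opposite rearrangement of the pentagon. Here `base` itself survives, so the other
    -- normalisation of the antipode applies.
    have h : ((1 : G) ⊗ₜ[ℂ] ((L.reassoc⁻¹ : (G ⊗[ℂ] (G ⊗[ℂ] M))ˣ) : G ⊗[ℂ] (G ⊗[ℂ] M))) *
          tensorRight G (tensorRight G L.coact) (L.reassoc : G ⊗[ℂ] (G ⊗[ℂ] M)) =
        tensorRight G (tensorSplit L.comul M) (L.reassoc : G ⊗[ℂ] (G ⊗[ℂ] M)) *
          tensorOne G G G M (L.base : G ⊗[ℂ] (G ⊗[ℂ] G)) *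
        tensorSplit L.comul (G ⊗[ℂ] M)
          ((L.reassoc⁻¹ : (G ⊗[ℂ] (G ⊗[ℂ] M))ˣ) : G ⊗[ℂ] (G ⊗[ℂ] M)) := by
      have e' : ((1 : G) ⊗ₜ[ℂ] ((L.reassoc⁻¹ : (G ⊗[ℂ] (G ⊗[ℂ] M))ˣ) : G ⊗[ℂ] (G ⊗[ℂ] M))) =
        (Algebra.TensorProduct.includeRight : _ →ₐ[ℂ] G ⊗[ℂ] (G ⊗[ℂ] (G ⊗[ℂ] M)))
          ((L.reassoc⁻¹ : (G ⊗[ℂ] (G ⊗[ℂ] M))ˣ) : G ⊗[ℂ] (G ⊗[ℂ] M)) := rfl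
      rw [e', map_units_inv, map_units_inv, Units.inv_mul_eq_iff_eq_mul, ← mul_assoc, Units.eq_mul_inv_iff_mul_eq,
        ← mul_assoc]
      exact L.pentagon.symm
    rw [p, q, ← bqForm_mul, h, bqForm_mul_tensorSplit L.antipode_right,
      bqForm_tensorRight_mul L.antipode_left, L.counit_reassoc_middle, bqForm_tensorOne,
      L.antipode_base, map_inv_eq_one _ _ L.counit_reassoc_left]
    simp [Algebra.TensorProduct.one_def]

end AntipodeCoaction

/-! ### Straightening intertwiners -/

variable {B : Type*} [Ring B] [Algebra ℂ B] {S : G ≃ₐ[ℂ] Gᵐᵒᵖ} {c : M →ₐ[ℂ] G ⊗[ℂ] M}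
  {p q : G ⊗[ℂ] M} (s : G →ₐ[ℂ] B) (g : M →ₐ[ℂ] B) (hsg : ∀ x m, Commute (s x) (g m))
  (a : M →ₐ[ℂ] B)

theorem map_conj {B' N : Type*} [Ring B'] [Algebra ℂ B'] [Ring N] [Algebra ℂ N]
    (D : B →ₐ[ℂ] B') (a : N →ₐ[ℂ] B) (Y : G ⊗[ℂ] N) (Z : B) :
    D (conj S a s Y Z) = conj S (D.comp a) (D.comp s) Y (D Z) := by
  induction Y using tensor_induction with
  | tmul x m => simp
  | add a b ha hb => simp only [map_add, LinearMap.add_apply, ha, hb]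

theorem conj_mul {N : Type*} [Ring N] [Algebra ℂ N] (a : N →ₐ[ℂ] B) (Y : G ⊗[ℂ] N) (Z X : B)
    (h : ∀ x, Commute (s x) X) : conj S a s Y (Z * X) = conj S a s Y Z * X := by
  induction Y using tensor_induction with
  | tmul x m => simp only [conj_tmul, mul_assoc, (h _).eq]
  | add a b ha hb => simp only [map_add, LinearMap.add_apply, ha, hb, add_mul]

theorem conj_tensorRight {N : Type*} [Ring N] [Algebra ℂ N] (a : N →ₐ[ℂ] B) (b : M →ₐ[ℂ] N)
    (Y : G ⊗[ℂ] M) (Z : B) :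
    conj S a s (tensorRight G b Y) Z = conj S (a.comp b) s Y Z := by
  induction Y using tensor_induction with
  | tmul x m => simp
  | add a b ha hb => simp only [map_add, LinearMap.add_apply, ha, hb]

section

variable {s g a}

include hsg

/-- `C` turns left multiplication by `c(m)` into left multiplication by `a(m)` and does not see the
factors `s(S⁻¹ x)` on the right. Identities for `p` under `conj` therefore pass to `C p`. -/
theorem mul_lift_conj (C : B)
    (hC : ∀ m, C * Algebra.TensorProduct.lift s g hsg (c m) = a m * C) (Y Z : G ⊗[ℂ] M) :
    C * Algebra.TensorProduct.lift s g hsg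
        (conj S c Algebra.TensorProduct.includeLeft Y Z) =
      conj S a s Y (C * Algebra.TensorProduct.lift s g hsg Z) := by
  induction Y using tensor_induction with
  | tmul x m => simp [← mul_assoc, hC]
  | add a b ha hb => simp only [map_add, LinearMap.add_apply, mul_add, ha, hb]

theorem straighten_mul_right (hp : IsStraightening S c p q) (C : B)
    (hC : ∀ m, C * Algebra.TensorProduct.lift s g hsg (c m) = a m * C) (m : M) :
    C * Algebra.TensorProduct.lift s g hsg p * g m =
      conj S a s (c m) (C * Algebra.TensorProduct.lift s g hsg p) := by
  rw [← mul_lift_conj hsg C hC, hp.conj_p]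
  simp [mul_assoc]

theorem conj_straighten (hp : IsStraightening S c p q) (C : B)
    (hC : ∀ m, C * Algebra.TensorProduct.lift s g hsg (c m) = a m * C) :
    conj S a s q (C * Algebra.TensorProduct.lift s g hsg p) = C := by
  rw [← mul_lift_conj hsg C hC, hp.conj_q_p]
  simp

/-- The factor from `M` is moved through `R` by `hR`; the elements of `G` then collected on the
right recombine by `S⁻¹(u) S⁻¹(x) y = S⁻¹(S(y) x u)`, which is a `coconj` on the acting element. -/
theorem conj_mul_lift (R : B) (hR : ∀ m, R * g m = conj S a s (c m) R) (X Y : G ⊗[ℂ] M) :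
    conj S a s X R * Algebra.TensorProduct.lift s g hsg Y =
      conj S a s (coconj S c Algebra.TensorProduct.includeLeft Y X) R := by
  induction Y using tensor_induction with
  | add a b ha hb => simp only [map_add, LinearMap.add_apply, mul_add, ha, hb]
  | tmul y m =>
    induction X using tensor_induction with
    | add a b ha hb => simp only [map_add, LinearMap.add_apply, add_mul, ha, hb]
    | tmul x n =>
      have h : a n * R * s (antipodeInvMap S x) * (s y * g m) =
          a n * conj S a s (c m) R * s (antipodeInvMap S x) * s y := by
        rw [← hR]
        simp only [mul_assoc, ← (hsg _ m).eq]
      rw [Algebra.TensorProduct.lift_tmul, conj_tmul, h, coconj_tmul]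
      generalize c m = t
      induction t using tensor_induction with
      | add a b ha hb => simp only [map_add, LinearMap.add_apply, mul_add, add_mul, ha, hb]
      | tmul u v => simp [antipodeInvMap_mul, mul_assoc]

/-- Together with `conj_q_mul_lift_p` this makes the action of `q` a map from straightened elements
to intertwiners, inverse to `C ↦ C p`. -/
theorem conj_q_mul_lift (hp : IsStraightening S c p q) (R : B)
    (hR : ∀ m, R * g m = conj S a s (c m) R) (m : M) :
    conj S a s q R * Algebra.TensorProduct.lift s g hsg (c m) = a m * conj S a s q R := by
  rw [conj_mul_lift hsg R hR, hp.coconj_q, map_mul]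
  simp

theorem conj_q_mul_lift_p (hp : IsStraightening S c p q) (R : B)
    (hR : ∀ m, R * g m = conj S a s (c m) R) :
    conj S a s q R * Algebra.TensorProduct.lift s g hsg p = R := by
  rw [conj_mul_lift hsg R hR, hp.coconj_p_q, map_one]
  simp

variable {b : M →ₐ[ℂ] B}

/-- The mirror image of `mul_lift_conj`. From here to the end of the group, multiplication by `q` on
the left takes the place of multiplication by `p` on the right, and `coconj` that of `conj`. -/
theorem lift_coconj_mul (C : B)
    (hC : ∀ m, C * b m = Algebra.TensorProduct.lift s g hsg (c m) * C) (Y Z : G ⊗[ℂ] M) :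
    Algebra.TensorProduct.lift s g hsg
        (coconj S c Algebra.TensorProduct.includeLeft Y Z) * C =
      coconj S b s Y (Algebra.TensorProduct.lift s g hsg Z * C) := by
  induction Y using tensor_induction with
  | tmul x m => simp [mul_assoc, hC]
  | add a b ha hb => simp only [map_add, LinearMap.add_apply, add_mul, ha, hb]

theorem mul_costraighten (hp : IsStraightening S c p q) (C : B)
    (hC : ∀ m, C * b m = Algebra.TensorProduct.lift s g hsg (c m) * C) (m : M) :
    g m * (Algebra.TensorProduct.lift s g hsg q * C) =
      coconj S b s (c m) (Algebra.TensorProduct.lift s g hsg q * C) := by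
  rw [← lift_coconj_mul hsg C hC, hp.coconj_q]
  simp [mul_assoc]

theorem coconj_costraighten (hp : IsStraightening S c p q) (C : B)
    (hC : ∀ m, C * b m = Algebra.TensorProduct.lift s g hsg (c m) * C) :
    coconj S b s p (Algebra.TensorProduct.lift s g hsg q * C) = C := by
  rw [← lift_coconj_mul hsg C hC, hp.coconj_p_q]
  simp

theorem lift_mul_coconj (L : B) (hL : ∀ m, g m * L = coconj S b s (c m) L) (X Y : G ⊗[ℂ] M) :
    Algebra.TensorProduct.lift s g hsg Y * coconj S b s X L =
      coconj S b s (conj S c Algebra.TensorProduct.includeLeft Y X) L := by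
  induction Y using tensor_induction with
  | add a b ha hb => simp only [map_add, LinearMap.add_apply, add_mul, ha, hb]
  | tmul y m =>
    induction X using tensor_induction with
    | add a b ha hb => simp only [map_add, LinearMap.add_apply, mul_add, ha, hb]
    | tmul x n =>
      have h : s y * g m * (s (antipodeMap S x) * L * b n) =
          s y * s (antipodeMap S x) * coconj S b s (c m) L * b n := by
        rw [← hL]
        simp only [mul_assoc]
        rw [← mul_assoc (g m) (s _), ← (hsg _ m).eq]
        simp only [mul_assoc]
      rw [Algebra.TensorProduct.lift_tmul, coconj_tmul, h, conj_tmul]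
      generalize c m = t
      induction t using tensor_induction with
      | add a b ha hb => simp only [map_add, LinearMap.add_apply, mul_add, add_mul, ha, hb]
      | tmul u v => simp [antipodeMap_mul, mul_assoc]

theorem coconj_p_mul (hp : IsStraightening S c p q) (L : B)
    (hL : ∀ m, g m * L = coconj S b s (c m) L) (m : M) :
    coconj S b s p L * b m = Algebra.TensorProduct.lift s g hsg (c m) * coconj S b s p L := by
  rw [lift_mul_coconj hsg L hL, hp.conj_p]
  clear hp hL
  induction p using tensor_induction with
  | add a b ha hb => simp only [map_add, LinearMap.add_apply, add_mul, ha, hb]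
  | tmul u v => simp [mul_assoc]

theorem lift_q_mul_coconj_p (hp : IsStraightening S c p q) (L : B)
    (hL : ∀ m, g m * L = coconj S b s (c m) L) :
    Algebra.TensorProduct.lift s g hsg q * coconj S b s p L = L := by
  rw [lift_mul_coconj hsg L hL, hp.conj_q_p, Algebra.TensorProduct.one_def]
  simp

end

end Frame

/-! ### Reversal of tensor legs -/

section Flip

/-- `x ⊗ y ⊗ z ↦ z ⊗ y ⊗ x`. -/
def flip₃ (X Y Z : Type*) [Semiring X] [Algebra ℂ X] [Semiring Y] [Algebra ℂ Y]
    [Semiring Z] [Algebra ℂ Z] : X ⊗[ℂ] (Y ⊗[ℂ] Z) →ₐ[ℂ] Z ⊗[ℂ] (Y ⊗[ℂ] X) :=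
  (Algebra.TensorProduct.assoc ℂ ℂ ℂ Z Y X).toAlgHom.comp
    ((Algebra.TensorProduct.map (Algebra.TensorProduct.comm ℂ Y Z).toAlgHom (AlgHom.id ℂ X)).comp
      (Algebra.TensorProduct.comm ℂ X (Y ⊗[ℂ] Z)).toAlgHom)

/-- `x ⊗ y ⊗ z ⊗ w ↦ w ⊗ z ⊗ y ⊗ x`. -/
def flip₄ (X Y Z W : Type*) [Semiring X] [Algebra ℂ X] [Semiring Y] [Algebra ℂ Y]
    [Semiring Z] [Algebra ℂ Z] [Semiring W] [Algebra ℂ W] :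
    X ⊗[ℂ] (Y ⊗[ℂ] (Z ⊗[ℂ] W)) →ₐ[ℂ] W ⊗[ℂ] (Z ⊗[ℂ] (Y ⊗[ℂ] X)) :=
  (tensorRight W (Algebra.TensorProduct.assoc ℂ ℂ ℂ Z Y X).toAlgHom).comp
    ((Algebra.TensorProduct.assoc ℂ ℂ ℂ W (Z ⊗[ℂ] Y) X).toAlgHom.comp
      ((Algebra.TensorProduct.map (flip₃ Y Z W) (AlgHom.id ℂ X)).comp
        (Algebra.TensorProduct.comm ℂ X (Y ⊗[ℂ] (Z ⊗[ℂ] W))).toAlgHom))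

section

variable {X Y Z W : Type*} [Semiring X] [Algebra ℂ X] [Semiring Y] [Algebra ℂ Y]
  [Semiring Z] [Algebra ℂ Z] [Semiring W] [Algebra ℂ W]

@[simp] theorem flip₃_tmul (x : X) (y : Y) (z : Z) :
    flip₃ X Y Z (x ⊗ₜ (y ⊗ₜ z)) = z ⊗ₜ (y ⊗ₜ x) := rfl

@[simp] theorem flip₄_tmul (x : X) (y : Y) (z : Z) (w : W) :
    flip₄ X Y Z W (x ⊗ₜ (y ⊗ₜ (z ⊗ₜ w))) = w ⊗ₜ (z ⊗ₜ (y ⊗ₜ x)) := rfl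

end

variable {G M : Type*} [Ring G] [Algebra ℂ G] [Ring M] [Algebra ℂ M]

/-- The opposite comultiplication. -/
def comulFlip (Δ : G →ₐ[ℂ] G ⊗[ℂ] G) : G →ₐ[ℂ] G ⊗[ℂ] G :=
  (Algebra.TensorProduct.comm ℂ G G).toAlgHom.comp Δ

/-- A right coaction, viewed as a left coaction for the opposite comultiplication. -/
def coactFlip (c : M →ₐ[ℂ] M ⊗[ℂ] G) : M →ₐ[ℂ] G ⊗[ℂ] M :=
  (Algebra.TensorProduct.comm ℂ M G).toAlgHom.comp c

variable (Δ : G →ₐ[ℂ] G ⊗[ℂ] G) (c : M →ₐ[ℂ] M ⊗[ℂ] G)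

theorem comulFlip_apply (x : G) :
    comulFlip Δ x = Algebra.TensorProduct.comm ℂ G G (Δ x) := rfl

theorem coactFlip_apply (m : M) :
    coactFlip c m = Algebra.TensorProduct.comm ℂ M G (c m) := rfl

theorem flip₃_tensorSplit_coact (t : M ⊗[ℂ] G) :
    flip₃ M G G (tensorSplit c G t) =
      tensorRight G (coactFlip c) (Algebra.TensorProduct.comm ℂ M G t) := by
  induction t using tensor_induction with
  | add a b ha hb => simp only [map_add, ha, hb]
  | tmul m x =>
    rw [tensorSplit_tmul, Algebra.TensorProduct.comm_tmul, tensorRight_tmul, coactFlip_apply]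
    generalize c m = u
    induction u using tensor_induction with
    | add a b ha hb => simp only [map_add, TensorProduct.add_tmul, TensorProduct.tmul_add, ha, hb]
    | tmul => simp

theorem flip₃_tensorRight_comul (t : M ⊗[ℂ] G) :
    flip₃ M G G (tensorRight M Δ t) =
      tensorSplit (comulFlip Δ) M (Algebra.TensorProduct.comm ℂ M G t) := by
  induction t using tensor_induction with
  | add a b ha hb => simp only [map_add, ha, hb]
  | tmul m x =>
    rw [tensorRight_tmul, Algebra.TensorProduct.comm_tmul, tensorSplit_tmul, comulFlip_apply]
    generalize Δ x = u
    induction u using tensor_induction with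
    | add a b ha hb => simp only [map_add, TensorProduct.add_tmul, TensorProduct.tmul_add, ha, hb]
    | tmul => simp

theorem flip₄_one_tmul (t : G ⊗[ℂ] (G ⊗[ℂ] G)) :
    flip₄ M G G G ((1 : M) ⊗ₜ t) = tensorOne G G G M (flip₃ G G G t) := by
  induction t using tensor_induction₃ with
  | add a b ha hb => simp only [map_add, TensorProduct.tmul_add, ha, hb]
  | tmul => simp

theorem flip₄_tensorOne (t : M ⊗[ℂ] (G ⊗[ℂ] G)) :
    flip₄ M G G G (tensorOne M G G G t) = (1 : G) ⊗ₜ flip₃ M G G t := by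
  induction t using tensor_induction₃ with
  | add a b ha hb => simp only [map_add, TensorProduct.tmul_add, ha, hb]
  | tmul => simp

theorem flip₄_tensorRight_tensorSplit (t : M ⊗[ℂ] (G ⊗[ℂ] G)) :
    flip₄ M G G G (tensorRight M (tensorSplit Δ G) t) =
      tensorRight G (tensorSplit (comulFlip Δ) M) (flip₃ M G G t) := by
  induction t using tensor_induction₃ with
  | add a b ha hb => simp only [map_add, ha, hb]
  | tmul m x y =>
    rw [tensorRight_tmul, tensorSplit_tmul, flip₃_tmul, tensorRight_tmul, tensorSplit_tmul,
      comulFlip_apply]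
    generalize Δ x = u
    induction u using tensor_induction with
    | add a b ha hb => simp only [map_add, TensorProduct.add_tmul, TensorProduct.tmul_add, ha, hb]
    | tmul => simp

theorem flip₄_tensorRight_tensorRight (t : M ⊗[ℂ] (G ⊗[ℂ] G)) :
    flip₄ M G G G (tensorRight M (tensorRight G Δ) t) =
      tensorSplit (comulFlip Δ) (G ⊗[ℂ] M) (flip₃ M G G t) := by
  induction t using tensor_induction₃ with
  | add a b ha hb => simp only [map_add, ha, hb]
  | tmul m x y =>
    rw [tensorRight_tmul, tensorRight_tmul, flip₃_tmul, tensorSplit_tmul, comulFlip_apply]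
    generalize Δ y = u
    induction u using tensor_induction with
    | add a b ha hb => simp only [map_add, TensorProduct.add_tmul, TensorProduct.tmul_add, ha, hb]
    | tmul => simp

theorem flip₄_tensorSplit (t : M ⊗[ℂ] (G ⊗[ℂ] G)) :
    flip₄ M G G G (tensorSplit c (G ⊗[ℂ] G) t) =
      tensorRight G (tensorRight G (coactFlip c)) (flip₃ M G G t) := by
  induction t using tensor_induction₃ with
  | add a b ha hb => simp only [map_add, ha, hb]
  | tmul m x y =>
    rw [tensorSplit_tmul, flip₃_tmul, tensorRight_tmul, tensorRight_tmul, coactFlip_apply]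
    generalize c m = u
    induction u using tensor_induction with
    | add a b ha hb => simp only [map_add, TensorProduct.add_tmul, TensorProduct.tmul_add, ha, hb]
    | tmul => simp

theorem killLeft_comm {X W : Type*} [Ring X] [Algebra ℂ X] [Ring W] [Algebra ℂ W]
    (f : X →ₐ[ℂ] ℂ) (t : W ⊗[ℂ] X) :
    killLeft f W (Algebra.TensorProduct.comm ℂ W X t) = killRight W f t := by
  induction t using tensor_induction with
  | add a b ha hb => simp only [map_add, ha, hb]
  | tmul => simp

theorem tensorRight_killLeft_flip₃ (f : G →ₐ[ℂ] ℂ) (t : M ⊗[ℂ] (G ⊗[ℂ] G)) :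
    tensorRight G (killLeft f M) (flip₃ M G G t) =
      Algebra.TensorProduct.comm ℂ M G (tensorRight M (killLeft f G) t) := by
  induction t using tensor_induction₃ with
  | add a b ha hb => simp only [map_add, ha, hb]
  | tmul => simp [TensorProduct.smul_tmul']

theorem killLeft_flip₃ (f : G →ₐ[ℂ] ℂ) (t : M ⊗[ℂ] (G ⊗[ℂ] G)) :
    killLeft f (G ⊗[ℂ] M) (flip₃ M G G t) =
      Algebra.TensorProduct.comm ℂ M G (tensorRight M (killRight G f) t) := by
  induction t using tensor_induction₃ with
  | add a b ha hb => simp only [map_add, ha, hb]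
  | tmul => simp [TensorProduct.smul_tmul']

end Flip

/-! ### Straightening data of left and right coactions -/

section Coactions

variable {G M : Type*} [Ring G] [Algebra ℂ G] [Ring M] [Algebra ℂ M] (H : QuasiHopfAlgebra G)

/-- The straightening data of a left coaction. -/
def leftAntipodeCoaction (L : LeftCoaction H.toQuasiBialgebra M) : AntipodeCoaction G M where
  comul := H.comul
  counit := H.counit
  base := H.reassoc
  antipode := H.antipode
  α := H.α
  β := H.β
  antipode_left := H.antipode_left
  antipode_right := H.antipode_right
  antipode_base := H.antipode_reassoc
  antipode_base_inv := H.antipode_reassoc_inv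
  coact := L.coact
  reassoc := L.reassoc
  intertwine := L.intertwine
  pentagon := L.pentagon
  counit_coact := L.counit_coact
  counit_reassoc_middle := L.counit_reassoc_middle
  counit_reassoc_left := L.counit_reassoc_left

/-- The straightening data of a right coaction, viewed as a left coaction for the opposite
comultiplication. -/
def rightAntipodeCoaction (R : RightCoaction H.toQuasiBialgebra M) : AntipodeCoaction G M where
  comul := comulFlip H.comul
  counit := H.counit
  base := Units.map (flip₃ G G G : _ →* _) H.reassoc⁻¹
  antipode := antipodeSymm H.antipode
  α := antipodeInvMap H.antipode H.α
  β := antipodeInvMap H.antipode H.β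
  antipode_left a := by
    rw [← map_smul, ← H.antipode_left, comulFlip_apply]
    generalize H.comul a = t
    induction t using tensor_induction with
    | add a b ha hb => simp only [map_add, ha, hb]
    | tmul => simp [mulTwo_tmul, antipodeInvMap_mul, mul_assoc]
  antipode_right a := by
    rw [← map_smul, ← H.antipode_right, comulFlip_apply]
    generalize H.comul a = t
    induction t using tensor_induction with
    | add a b ha hb => simp only [map_add, ha, hb]
    | tmul => simp [mulTwo_tmul, antipodeInvMap_mul, mul_assoc]
  antipode_base := by
    rw [← antipodeInvMap_one H.antipode, ← H.antipode_reassoc_inv]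
    simp only [Units.coe_map, MonoidHom.coe_coe]
    generalize ((H.reassoc⁻¹ : (G ⊗[ℂ] (G ⊗[ℂ] G))ˣ) : G ⊗[ℂ] (G ⊗[ℂ] G)) = t
    induction t using tensor_induction₃ with
    | add a b ha hb => simp only [map_add, ha, hb]
    | tmul => simp [mulTwo_tmul, antipodeInvMap_mul, mul_assoc]
  antipode_base_inv := by
    rw [← antipodeInvMap_one H.antipode, ← H.antipode_reassoc, ← map_inv, inv_inv]
    simp only [Units.coe_map, MonoidHom.coe_coe]
    generalize (H.reassoc : G ⊗[ℂ] (G ⊗[ℂ] G)) = t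
    induction t using tensor_induction₃ with
    | add a b ha hb => simp only [map_add, ha, hb]
    | tmul => simp [mulTwo_tmul, antipodeInvMap_mul, mul_assoc]
  coact := coactFlip R.coact
  reassoc := Units.map (flip₃ M G G : _ →* _) R.reassoc⁻¹
  intertwine m := by
    rw [coactFlip_apply, ← flip₃_tensorSplit_coact, ← flip₃_tensorRight_comul]
    simp only [Units.coe_map, MonoidHom.coe_coe, ← map_mul]
    congr 1
    rw [Units.mul_inv_eq_iff_eq_mul, mul_assoc, ← R.intertwine, Units.inv_mul_cancel_left]
  pentagon := by
    simp only [Units.coe_map, MonoidHom.coe_coe, ← flip₄_one_tmul, ← flip₄_tensorOne,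
      ← flip₄_tensorSplit, ← flip₄_tensorRight_tensorRight, ← flip₄_tensorRight_tensorSplit,
      ← map_mul]
    congr 1
    have e : ((1 : M) ⊗ₜ[ℂ] ((H.reassoc⁻¹ : (G ⊗[ℂ] (G ⊗[ℂ] G))ˣ) : G ⊗[ℂ] (G ⊗[ℂ] G))) =
      (Algebra.TensorProduct.includeRight : _ →ₐ[ℂ] M ⊗[ℂ] (G ⊗[ℂ] (G ⊗[ℂ] G)))
          ((H.reassoc⁻¹ : (G ⊗[ℂ] (G ⊗[ℂ] G))ˣ) : G ⊗[ℂ] (G ⊗[ℂ] G)) := rfl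
    rw [e]
    -- Flipping reverses the legs but not the factors, whereas the left and right pentagons list
    -- their factors in opposite orders. With all reassociators inverted, what remains is the
    -- inverse of the right pentagon.
    simp only [map_units_inv, ← Units.val_mul, ← mul_inv_rev]
    refine congrArg Units.val (congrArg Inv.inv (Units.ext ?_))
    rw [← mul_assoc]
    exact R.pentagon
  counit_coact m := by rw [coactFlip_apply, killLeft_comm, R.counit_coact]
  counit_reassoc_middle := by
    simp only [Units.coe_map, MonoidHom.coe_coe]
    rw [tensorRight_killLeft_flip₃, map_inv_eq_one _ _ R.counit_reassoc_middle, map_one]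
  counit_reassoc_left := by
    simp only [Units.coe_map, MonoidHom.coe_coe]
    rw [killLeft_flip₃, map_inv_eq_one _ _ R.counit_reassoc_right, map_one]

/-- The flipped coaction carries the inverse reassociator and `q` inverts once more, so `φ_ρ` itself
appears. Hence the given `q_ρ`, up to order of legs, is the `q` of the flipped coaction. -/
theorem rightAntipodeCoaction_q (R : RightCoaction H.toQuasiBialgebra M) :
    (rightAntipodeCoaction H R).q = Algebra.TensorProduct.comm ℂ M G (qRho H R) := by
  simp only [AntipodeCoaction.q, rightAntipodeCoaction, ← map_inv, inv_inv, Units.coe_map,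
    MonoidHom.coe_coe, qRho]
  generalize (R.reassoc : M ⊗[ℂ] (G ⊗[ℂ] G)) = t
  induction t using tensor_induction₃ with
  | add a b ha hb => simp only [map_add, ha, hb]
  | tmul => simp [mulTwo_tmul, antipodeInvMap_mul, mul_assoc]

end Coactions

/-! ### The mixed reassociator: counits, and passage of `p_λ` -/

section Mixed

variable {G M : Type*} [Ring G] [Algebra ℂ G] [Ring M] [Algebra ℂ M]

section

variable {H : QuasiBialgebra G} (P : QuasiCommutingPair H M)

theorem tensorRight_killLeft_tensorSplit {N : Type*} [Ring N] [Algebra ℂ N] (ε : G →ₐ[ℂ] ℂ)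
    (c : M →ₐ[ℂ] G ⊗[ℂ] M)
    (h : ∀ m, killLeft ε M (c m) = m) (t : M ⊗[ℂ] N) :
    killLeft ε (M ⊗[ℂ] N) (tensorSplit c N t) = t := by
  induction t using tensor_induction with
  | add a b ha hb => simp only [map_add, ha, hb]
  | tmul m x =>
    conv_rhs => rw [← h m]
    rw [tensorSplit_tmul]
    generalize c m = u
    induction u using tensor_induction with
    | add a b ha hb => simp only [map_add, TensorProduct.add_tmul, ha, hb]
    | tmul => simp [TensorProduct.smul_tmul']

theorem tensorRight_killLeft_tensorSplit_comul {N : Type*} [Ring N] [Algebra ℂ N]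
    (Δ : G →ₐ[ℂ] G ⊗[ℂ] G) (ε : G →ₐ[ℂ] ℂ) (h : ∀ x, killRight G ε (Δ x) = x) (t : G ⊗[ℂ] N) :
    tensorRight G (killLeft ε N) (tensorSplit Δ N t) = t := by
  induction t using tensor_induction with
  | add a b ha hb => simp only [map_add, ha, hb]
  | tmul x n =>
    conv_rhs => rw [← h x]
    rw [tensorSplit_tmul]
    generalize Δ x = u
    induction u using tensor_induction with
    | add a b ha hb => simp only [map_add, TensorProduct.add_tmul, ha, hb]
    | tmul => simp [TensorProduct.smul_tmul']

theorem tensorRight_killRight_tensorSplit (ε : G →ₐ[ℂ] ℂ) (c : M →ₐ[ℂ] M ⊗[ℂ] G)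
    (h : ∀ m, killRight M ε (c m) = m) (t : M ⊗[ℂ] G) :
    tensorRight M (killLeft ε G) (tensorSplit c G t) = t := by
  induction t using tensor_induction with
  | add a b ha hb => simp only [map_add, ha, hb]
  | tmul m x =>
    conv_rhs => rw [← h m]
    rw [tensorSplit_tmul]
    generalize c m = u
    induction u using tensor_induction with
    | add a b ha hb => simp only [map_add, TensorProduct.add_tmul, ha, hb]
    | tmul => simp [TensorProduct.smul_tmul']

theorem tensorRight_tensorRight {X Y Z : Type*} [Ring X] [Algebra ℂ X] [Ring Y] [Algebra ℂ Y]
    [Ring Z] [Algebra ℂ Z] (f : X →ₐ[ℂ] Y) (g : Y →ₐ[ℂ] Z) (t : M ⊗[ℂ] X) :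
    tensorRight M g (tensorRight M f t) = tensorRight M (g.comp f) t := by
  induction t using tensor_induction with
  | add a b ha hb => simp only [map_add, ha, hb]
  | tmul => simp

theorem tensorRight_eq_self {X : Type*} [Ring X] [Algebra ℂ X] (f : X →ₐ[ℂ] X)
    (hf : ∀ x, f x = x) (t : M ⊗[ℂ] X) : tensorRight M f t = t := by
  induction t using tensor_induction with
  | add a b ha hb => simp only [map_add, ha, hb]
  | tmul => simp [hf]

theorem one_tmul_eq_one (ε : G →ₐ[ℂ] ℂ) {m : M} (h : (1 : G) ⊗ₜ[ℂ] m = 1) : m = 1 := by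
  simpa using congrArg (killLeft ε M) h

/-- This is not an axiom. The counit on the second leg of the left mixed pentagon leaves `(1 ⊗ (ε ⊗
id)(φ_λρ)) φ_λρ = φ_λρ`, and `φ_λρ` is invertible. -/
theorem killLeft_mixed :
    killLeft H.counit (M ⊗[ℂ] G) (P.mixed : G ⊗[ℂ] (M ⊗[ℂ] G)) = 1 := by
  have h := congrArg (tensorRight G (killLeft H.counit (M ⊗[ℂ] G))) P.pentagon_left
  have h₁ : ∀ t : G ⊗[ℂ] (G ⊗[ℂ] M), tensorRight G (killLeft H.counit (M ⊗[ℂ] G))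
      (tensorOne G G M G t) = tensorRight G Algebra.TensorProduct.includeLeft
        (tensorRight G (killLeft H.counit M) t) := fun t => by
    induction t using tensor_induction₃ with
    | add a b ha hb => simp only [map_add, ha, hb]
    | tmul => simp
  have h₂ : ∀ t : G ⊗[ℂ] (G ⊗[ℂ] M), tensorRight G (killLeft H.counit (M ⊗[ℂ] G))
      (tensorRight G (tensorRight G P.right.coact) t) = tensorRight G P.right.coact
        (tensorRight G (killLeft H.counit M) t) := fun t => by
    induction t using tensor_induction₃ with
    | add a b ha hb => simp only [map_add, ha, hb]
    | tmul => simp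
  simp only [map_mul, h₁, h₂, P.left.counit_reassoc_middle, map_one, mul_one, one_mul,
    tensorRight_killLeft_tensorSplit_comul _ _ H.counit_right, tensorRight_tmul,
    tensorRight_tensorRight] at h
  rw [tensorRight_eq_self _ (tensorRight_killLeft_tensorSplit _ _ P.left.counit_coact)] at h
  exact one_tmul_eq_one H.counit ((Units.mul_left_inj P.mixed).1 (h.trans (one_mul _).symm))

/-- The same cancellation, with the counit on the third leg of the right mixed pentagon. -/
theorem tensorRight_killRight_mixed :
    tensorRight G (killRight M H.counit) (P.mixed : G ⊗[ℂ] (M ⊗[ℂ] G)) = 1 := by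
  have h := congrArg (tensorRight G (tensorRight M (killLeft H.counit G))) P.pentagon_right
  have h₁ : ∀ t : G ⊗[ℂ] (M ⊗[ℂ] G), tensorRight G (tensorRight M (killLeft H.counit G))
      (tensorOne G M G G t) = tensorRight G (Algebra.TensorProduct.includeLeft)
        (tensorRight G (killRight M H.counit) t) := fun t => by
    induction t using tensor_induction₃ with
    | add a b ha hb => simp only [map_add, ha, hb]
    | tmul => simp
  have h₂ : ∀ t : M ⊗[ℂ] (G ⊗[ℂ] G), tensorRight G (tensorRight M (killLeft H.counit G))
      (tensorSplit P.left.coact (G ⊗[ℂ] G) t) = tensorSplit P.left.coact G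
        (tensorRight M (killLeft H.counit G) t) := fun t => by
    induction t using tensor_induction₃ with
    | add a b ha hb => simp only [map_add, ha, hb]
    | tmul m x y =>
      simp only [tensorSplit_tmul, tensorRight_tmul]
      generalize P.left.coact m = u
      induction u using tensor_induction with
      | add a b ha hb => simp only [map_add, TensorProduct.add_tmul, ha, hb]
      | tmul => simp
  simp only [map_mul, h₁, h₂, P.right.counit_reassoc_middle, map_one, mul_one,
    tensorRight_tmul, tensorRight_tensorRight] at h
  rw [← Algebra.TensorProduct.one_def, one_mul, tensorRight_eq_self _
    (tensorRight_killRight_tensorSplit _ _ P.right.counit_coact)] at h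
  rw [tensorRight_eq_self ((tensorRight M (killLeft H.counit G)).comp (tensorRight M H.comul))
    (fun t => by rw [AlgHom.comp_apply, tensorRight_tensorRight,
      tensorRight_eq_self _ H.counit_left])] at h
  have h' := congrArg (tensorRight G (killRight M H.counit)) ((Units.mul_right_inj P.mixed).1 (h.trans (mul_one _).symm))
  rw [tensorRight_tensorRight, map_one] at h'
  have e : (killRight M H.counit).comp (Algebra.TensorProduct.includeLeft.comp
      (killRight M H.counit)) = killRight M H.counit := AlgHom.ext fun t => by simp
  rwa [e] at h'

end

section PForm

variable {N : Type*} [Ring N] [Algebra ℂ N] (S : G ≃ₐ[ℂ] Gᵐᵒᵖ) (β : G)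

theorem pForm_one_tmul_mul (X : G ⊗[ℂ] M) (Z : G ⊗[ℂ] (G ⊗[ℂ] M)) :
    pForm S β (((1 : G) ⊗ₜ X) * Z) = X * pForm S β Z := by
  induction Z using tensor_induction₃ with
  | add a b ha hb => simp only [map_add, mul_add, ha, hb]
  | tmul x y m =>
    induction X using tensor_induction with
    | add a b ha hb => simp_all only [map_add, TensorProduct.tmul_add, add_mul]
    | tmul => simp [mul_assoc]

theorem pForm_tensorRight_tensorRight (f : M →ₐ[ℂ] N) (Z : G ⊗[ℂ] (G ⊗[ℂ] M)) :
    pForm S β (tensorRight G (tensorRight G f) Z) = tensorRight G f (pForm S β Z) := by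
  induction Z using tensor_induction₃ with
  | add a b ha hb => simp only [map_add, ha, hb]
  | tmul => simp

/-- `φ_λρ⁻¹ (id ⊗ ρ)(p_λ) = (λ ⊗ id)(φ_λρ²³) (p_λ ⊗ 1) (S⁻¹(φ_λρ¹) ⊗ 1 ⊗ 1)`. -/
theorem mixed_inv_mul_pLambda (H : QuasiHopfAlgebra G)
    (P : QuasiCommutingPair H.toQuasiBialgebra M) :
    ((P.mixed⁻¹ : (G ⊗[ℂ] (M ⊗[ℂ] G))ˣ) : G ⊗[ℂ] (M ⊗[ℂ] G)) *
        tensorRight G P.right.coact (pLambda H P.left) =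
      conj H.antipode (tensorSplit P.left.coact G) Algebra.TensorProduct.includeLeft
        (P.mixed : G ⊗[ℂ] (M ⊗[ℂ] G))
        (tensorRight G Algebra.TensorProduct.includeLeft (pLambda H P.left)) := by
  -- Contracting the first two legs turns `φ_λ` into `p_λ` and collapses the coproduct of `φ_λρ` to
  -- its counit, which is `1`.
  have h := congrArg (pForm H.antipode H.β) P.pentagon_left
  rw [mul_assoc, pForm_one_tmul_mul, pForm_tensorRight_mul,
    pForm_mul_tensorSplit H.antipode_right, killLeft_mixed, ← Algebra.TensorProduct.one_def,
    mul_one, pForm_tensorRight_tensorRight] at h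
  rw [Units.inv_mul_eq_iff_eq_mul]
  refine h.symm.trans ?_
  congr 2
  exact pForm_tensorRight_tensorRight _ _ _ _

end PForm

end Mixed

/-! ### Intertwiners in several legs -/

section Legs

variable {G M A : Type*} [Ring G] [Algebra ℂ G] [Ring M] [Algebra ℂ M] [Ring A] [Algebra ℂ A]
  {H : QuasiHopfAlgebra G} (P : QuasiCommutingPair H.toQuasiBialgebra M) (γ : M →ₐ[ℂ] A)

/-- `λ_A : M → G ⊗ A`. -/
def lamA : M →ₐ[ℂ] G ⊗[ℂ] A := (tensorRight G γ).comp P.left.coact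

/-- `ρ^op_A : M → G ⊗ A`. -/
def rhoA : M →ₐ[ℂ] G ⊗[ℂ] A := (tensorRight G γ).comp (coactFlip P.right.coact)

/-- `(ρ ⊗ id)_A³¹² : M ⊗ G → G ⊗ G ⊗ A`. -/
def rhoTwo : M ⊗[ℂ] G →ₐ[ℂ] G ⊗[ℂ] (G ⊗[ℂ] A) := (leg312 γ).comp (tensorSplit P.right.coact G)

/-- `λρ`-intertwiners, not necessarily coherent or normal. -/
def IsIntertwiner (T : G ⊗[ℂ] A) : Prop := ∀ m : M, T * lamA P γ m = rhoA P γ m * T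

/-- `φ_ρ⁻¹ (Δ ⊗ id)(C) φ_λ⁻¹`. -/
def reducedComul (C : G ⊗[ℂ] A) : G ⊗[ℂ] (G ⊗[ℂ] A) :=
  leg312 γ ((P.right.reassoc⁻¹ : (M ⊗[ℂ] (G ⊗[ℂ] G))ˣ) : M ⊗[ℂ] (G ⊗[ℂ] G)) *
    tensorSplit H.comul A C *
    tensorRight G (tensorRight G γ)
      ((P.left.reassoc⁻¹ : (G ⊗[ℂ] (G ⊗[ℂ] M))ˣ) : G ⊗[ℂ] (G ⊗[ℂ] M))

/-- `C¹³ φ_λρ⁻¹ T²³`. -/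
def legProduct (C T : G ⊗[ℂ] A) : G ⊗[ℂ] (G ⊗[ℂ] A) :=
  leg13 G A C * leg132 γ ((P.mixed⁻¹ : (G ⊗[ℂ] (M ⊗[ℂ] G))ˣ) : G ⊗[ℂ] (M ⊗[ℂ] G)) *
    ((1 : G) ⊗ₜ[ℂ] T)

variable {P γ}

@[simp] theorem leg13_tmul (x : G) (a : A) : leg13 G A (x ⊗ₜ a) = x ⊗ₜ (1 ⊗ₜ a) := rfl

@[simp] theorem leg132_tmul (x y : G) (m : M) :
    leg132 γ (x ⊗ₜ (m ⊗ₜ y)) = x ⊗ₜ (y ⊗ₜ γ m) := rfl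

@[simp] theorem leg312_tmul (x y : G) (m : M) :
    leg312 γ (m ⊗ₜ (x ⊗ₜ y)) = x ⊗ₜ (y ⊗ₜ γ m) := rfl

theorem leg13_mul_middle (C : G ⊗[ℂ] A) (h : G) :
    leg13 G A C * ((1 : G) ⊗ₜ (h ⊗ₜ (1 : A))) = ((1 : G) ⊗ₜ (h ⊗ₜ (1 : A))) * leg13 G A C := by
  induction C using tensor_induction with
  | add a b ha hb => simp only [map_add, add_mul, mul_add, ha, hb]
  | tmul => simp

theorem leg132_tensorSplit_tmul (m : M) (h : G) :
    leg132 γ (tensorSplit P.left.coact G (m ⊗ₜ h)) =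
      leg13 G A (lamA P γ m) * ((1 : G) ⊗ₜ (h ⊗ₜ (1 : A))) := by
  rw [tensorSplit_tmul, lamA, AlgHom.comp_apply]
  generalize P.left.coact m = u
  induction u using tensor_induction with
  | add a b ha hb => simp only [map_add, TensorProduct.add_tmul, add_mul, ha, hb]
  | tmul => simp

theorem rhoTwo_tmul (m : M) (h : G) :
    rhoTwo P γ (m ⊗ₜ h) = leg13 G A (rhoA P γ m) * ((1 : G) ⊗ₜ (h ⊗ₜ (1 : A))) := by
  rw [rhoTwo, AlgHom.comp_apply, tensorSplit_tmul, rhoA, AlgHom.comp_apply, coactFlip_apply]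
  generalize P.right.coact m = u
  induction u using tensor_induction with
  | add a b ha hb => simp only [map_add, TensorProduct.add_tmul, add_mul, ha, hb]
  | tmul => simp

/-- `C¹³` commutes with the middle leg, so only the coaction meets `C`, and the intertwining
property replaces `λ` by `ρ^op`. -/
theorem leg13_mul_leg132 {C : G ⊗[ℂ] A} (hC : IsIntertwiner P γ C) (y : M ⊗[ℂ] G) :
    leg13 G A C * leg132 γ (tensorSplit P.left.coact G y) =
      rhoTwo P γ y * leg13 G A C := by
  induction y using tensor_induction with
  | add a b ha hb => simp only [map_add, add_mul, mul_add, ha, hb]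
  | tmul m h =>
    rw [leg132_tensorSplit_tmul, rhoTwo_tmul, ← mul_assoc, ← map_mul, hC, map_mul, mul_assoc,
      leg13_mul_middle, mul_assoc]

theorem leg132_tensorRight (Y : G ⊗[ℂ] M) :
    leg132 γ (tensorRight G P.right.coact Y) = tensorRight G (rhoA P γ) Y := by
  induction Y using tensor_induction with
  | add a b ha hb => simp only [map_add, ha, hb]
  | tmul x m => rfl

theorem one_tmul_mul_tensorRight {T : G ⊗[ℂ] A} (hT : IsIntertwiner P γ T) (Y : G ⊗[ℂ] M) :
    ((1 : G) ⊗ₜ[ℂ] T) * tensorRight G (lamA P γ) Y =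
      tensorRight G (rhoA P γ) Y * ((1 : G) ⊗ₜ[ℂ] T) := by
  induction Y using tensor_induction with
  | add a b ha hb => simp only [map_add, add_mul, mul_add, ha, hb]
  | tmul x m => simp [hT m]

theorem leg13_mul_leg132_conj {C : G ⊗[ℂ] A} (hC : IsIntertwiner P γ C) (p : G ⊗[ℂ] M)
    (S : G ≃ₐ[ℂ] Gᵐᵒᵖ) (Y : G ⊗[ℂ] (M ⊗[ℂ] G)) :
    leg13 G A C * leg132 γ (conj S (tensorSplit P.left.coact G)
        Algebra.TensorProduct.includeLeft Y (tensorRight G Algebra.TensorProduct.includeLeft p)) =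
      conj S (rhoTwo P γ) Algebra.TensorProduct.includeLeft Y
        (leg13 G A (C * tensorRight G γ p)) := by
  have hp : leg132 γ (tensorRight G (Algebra.TensorProduct.includeLeft : M →ₐ[ℂ] M ⊗[ℂ] G) p) =
      leg13 G A (tensorRight G γ p) := by
    induction p using tensor_induction with
    | add a b ha hb => simp only [map_add, ha, hb]
    | tmul => simp
  induction Y using tensor_induction with
  | add a b ha hb => simp only [map_add, LinearMap.add_apply, mul_add, ha, hb]
  | tmul x y =>
    rw [conj_tmul, map_mul, map_mul, ← mul_assoc, ← mul_assoc, leg13_mul_leg132 hC, hp,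
      conj_tmul, map_mul, mul_assoc, mul_assoc, mul_assoc, mul_assoc]
    simp [Algebra.TensorProduct.one_def]

theorem commute_includeLeft_one_tmul {N : Type*} [Ring N] [Algebra ℂ N] (x : G) (T : N) :
    Commute ((Algebra.TensorProduct.includeLeft : G →ₐ[ℂ] G ⊗[ℂ] N) x) ((1 : G) ⊗ₜ[ℂ] T) := by
  simp [Commute, SemiconjBy]

/-- `p_λ` passes `T²³` as `(id ⊗ ρ)(p_λ)` and meets `φ_λρ⁻¹`; `mixed_inv_mul_pLambda` then puts
`p_λ` next to `C`. The mixed reassociator no longer separates `C` from `T`: it only acts invertibly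
on `(C p_λ)¹³ T²³`. -/
theorem legProduct_mul_pLambda {C T : G ⊗[ℂ] A} (hC : IsIntertwiner P γ C)
    (hT : IsIntertwiner P γ T) :
    legProduct P γ C T * tensorRight G (lamA P γ) (pLambda H P.left) =
      conj H.antipode (rhoTwo P γ) Algebra.TensorProduct.includeLeft
        (P.mixed : G ⊗[ℂ] (M ⊗[ℂ] G))
        (leg13 G A (C * tensorRight G γ (pLambda H P.left)) * ((1 : G) ⊗ₜ[ℂ] T)) := by
  rw [legProduct, mul_assoc, one_tmul_mul_tensorRight hT, ← leg132_tensorRight,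
    ← mul_assoc, mul_assoc (leg13 G A C), ← map_mul, mixed_inv_mul_pLambda,
    leg13_mul_leg132_conj hC, conj_mul _ _ _ _ _ fun x => commute_includeLeft_one_tmul x T]

theorem legProduct_intertwine {C T : G ⊗[ℂ] A} (hC : IsIntertwiner P γ C)
    (hT : IsIntertwiner P γ T) (m : M) :
    legProduct P γ C T * tensorRight G (lamA P γ) (P.left.coact m) =
      rhoTwo P γ (P.right.coact m) * legProduct P γ C T := by
  have h : ((P.mixed⁻¹ : (G ⊗[ℂ] (M ⊗[ℂ] G))ˣ) : G ⊗[ℂ] (M ⊗[ℂ] G)) *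
      tensorRight G P.right.coact (P.left.coact m) =
      tensorSplit P.left.coact G (P.right.coact m) *
        ((P.mixed⁻¹ : (G ⊗[ℂ] (M ⊗[ℂ] G))ˣ) : G ⊗[ℂ] (M ⊗[ℂ] G)) := by
    rw [Units.inv_mul_eq_iff_eq_mul, ← mul_assoc, P.intertwine, Units.mul_inv_cancel_right]
  rw [legProduct, mul_assoc, one_tmul_mul_tensorRight hT, ← leg132_tensorRight,
    ← mul_assoc, mul_assoc (leg13 G A C), ← map_mul, h, map_mul, ← mul_assoc,
    leg13_mul_leg132 hC]
  simp only [mul_assoc]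

theorem tensorSplit_tensorRight (Δ : G →ₐ[ℂ] G ⊗[ℂ] G) (t : G ⊗[ℂ] M) :
    tensorSplit Δ A (tensorRight G γ t) = tensorRight G (tensorRight G γ) (tensorSplit Δ M t) := by
  induction t using tensor_induction with
  | add a b ha hb => simp only [map_add, ha, hb]
  | tmul x m =>
    rw [tensorRight_tmul, tensorSplit_tmul, tensorSplit_tmul]
    generalize Δ x = u
    induction u using tensor_induction with
    | add a b ha hb => simp only [map_add, TensorProduct.add_tmul, ha, hb]
    | tmul => simp

theorem leg312_tensorRight (Δ : G →ₐ[ℂ] G ⊗[ℂ] G) (t : M ⊗[ℂ] G) :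
    tensorSplit Δ A (tensorRight G γ (Algebra.TensorProduct.comm ℂ M G t)) =
      leg312 γ (tensorRight M Δ t) := by
  induction t using tensor_induction with
  | add a b ha hb => simp only [map_add, ha, hb]
  | tmul m x =>
    rw [Algebra.TensorProduct.comm_tmul, tensorRight_tmul, tensorRight_tmul, tensorSplit_tmul]
    generalize Δ x = u
    induction u using tensor_induction with
    | add a b ha hb => simp only [map_add, TensorProduct.add_tmul, TensorProduct.tmul_add, ha, hb]
    | tmul => simp

/-- This is the relation satisfied by `legProduct`. Both sides of the coherence equation thus
intertwine `(id ⊗ λ)λ` with `(ρ ⊗ id)ρ`, and straightening in `G ⊗ (G ⊗ A)` can compare them after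
multiplication by `p_λ`. -/
theorem reducedComul_intertwine {C : G ⊗[ℂ] A} (hC : IsIntertwiner P γ C) (m : M) :
    reducedComul P γ C * tensorRight G (lamA P γ) (P.left.coact m) =
      rhoTwo P γ (P.right.coact m) * reducedComul P γ C := by
  have h₁ : ((P.left.reassoc⁻¹ : (G ⊗[ℂ] (G ⊗[ℂ] M))ˣ) : G ⊗[ℂ] (G ⊗[ℂ] M)) *
      tensorRight G P.left.coact (P.left.coact m) =
      tensorSplit H.comul M (P.left.coact m) *
        ((P.left.reassoc⁻¹ : (G ⊗[ℂ] (G ⊗[ℂ] M))ˣ) : G ⊗[ℂ] (G ⊗[ℂ] M)) := by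
    rw [Units.inv_mul_eq_iff_eq_mul, ← mul_assoc, ← P.left.intertwine,
      Units.mul_inv_cancel_right]
  have h₂ : ((P.right.reassoc⁻¹ : (M ⊗[ℂ] (G ⊗[ℂ] G))ˣ) : M ⊗[ℂ] (G ⊗[ℂ] G)) *
      tensorRight M H.comul (P.right.coact m) =
      tensorSplit P.right.coact G (P.right.coact m) *
        ((P.right.reassoc⁻¹ : (M ⊗[ℂ] (G ⊗[ℂ] G))ˣ) : M ⊗[ℂ] (G ⊗[ℂ] G)) := by
    rw [Units.inv_mul_eq_iff_eq_mul, ← mul_assoc, P.right.intertwine,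
      Units.mul_inv_cancel_right]
  have h₃ : tensorSplit H.comul A C *
      tensorRight G (tensorRight G γ) (tensorSplit H.comul M (P.left.coact m)) =
      leg312 γ (tensorRight M H.comul (P.right.coact m)) * tensorSplit H.comul A C := by
    rw [← tensorSplit_tensorRight, ← leg312_tensorRight, ← map_mul, ← map_mul]
    exact congrArg _ (hC m)
  rw [reducedComul, lamA, ← tensorRight_tensorRight, mul_assoc, ← map_mul, h₁, map_mul,
    ← mul_assoc, mul_assoc (leg312 γ _), h₃, ← mul_assoc (leg312 γ _), ← map_mul, h₂, map_mul]
  simp only [mul_assoc, rhoTwo, AlgHom.comp_apply]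

end Legs

/-! ### Straightening inside `G ⊗ N` -/

section FrameTensor

variable {G M N : Type*} [Ring G] [Algebra ℂ G] [Ring M] [Algebra ℂ M] [Ring N] [Algebra ℂ N]
  {S : G ≃ₐ[ℂ] Gᵐᵒᵖ} {c : M →ₐ[ℂ] G ⊗[ℂ] M} {p q : G ⊗[ℂ] M} (f : M →ₐ[ℂ] N)
  {a b : M →ₐ[ℂ] G ⊗[ℂ] N}

theorem commute_includeLeft_includeRight_comp (x : G) (m : M) :
    Commute ((Algebra.TensorProduct.includeLeft : G →ₐ[ℂ] G ⊗[ℂ] N) x)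
      (((Algebra.TensorProduct.includeRight : N →ₐ[ℂ] G ⊗[ℂ] N).comp f) m) :=
  commute_includeLeft_one_tmul x (f m)

theorem lift_includeLeft_includeRight_comp :
    Algebra.TensorProduct.lift (Algebra.TensorProduct.includeLeft : G →ₐ[ℂ] G ⊗[ℂ] N)
      ((Algebra.TensorProduct.includeRight : N →ₐ[ℂ] G ⊗[ℂ] N).comp f)
      (commute_includeLeft_includeRight_comp f) = tensorRight G f :=
  Algebra.TensorProduct.ext' fun x m => by rw [Algebra.TensorProduct.lift_tmul]; simp

variable {f}

theorem tensor_straighten_mul_right (hp : IsStraightening S c p q) (C : G ⊗[ℂ] N)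
    (hC : ∀ m, C * tensorRight G f (c m) = a m * C) (m : M) :
    C * tensorRight G f p * ((1 : G) ⊗ₜ f m) =
      conj S a Algebra.TensorProduct.includeLeft (c m) (C * tensorRight G f p) := by
  simp only [← lift_includeLeft_includeRight_comp] at hC ⊢
  exact straighten_mul_right _ hp C hC m

theorem tensor_conj_straighten (hp : IsStraightening S c p q) (C : G ⊗[ℂ] N)
    (hC : ∀ m, C * tensorRight G f (c m) = a m * C) :
    conj S a Algebra.TensorProduct.includeLeft q (C * tensorRight G f p) = C := by
  simp only [← lift_includeLeft_includeRight_comp] at hC ⊢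
  exact conj_straighten _ hp C hC

theorem tensor_conj_mul (R : G ⊗[ℂ] N)
    (hR : ∀ m, R * ((1 : G) ⊗ₜ f m) = conj S a Algebra.TensorProduct.includeLeft (c m) R)
    (X Y : G ⊗[ℂ] M) :
    conj S a Algebra.TensorProduct.includeLeft X R * tensorRight G f Y =
      conj S a Algebra.TensorProduct.includeLeft
        (coconj S c Algebra.TensorProduct.includeLeft Y X) R := by
  rw [← lift_includeLeft_includeRight_comp]
  exact conj_mul_lift _ R hR X Y

theorem tensor_conj_q_mul (hp : IsStraightening S c p q) (R : G ⊗[ℂ] N)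
    (hR : ∀ m, R * ((1 : G) ⊗ₜ f m) = conj S a Algebra.TensorProduct.includeLeft (c m) R)
    (m : M) :
    conj S a Algebra.TensorProduct.includeLeft q R * tensorRight G f (c m) =
      a m * conj S a Algebra.TensorProduct.includeLeft q R := by
  rw [← lift_includeLeft_includeRight_comp]
  exact conj_q_mul_lift _ hp R hR m

theorem tensor_conj_q_mul_p (hp : IsStraightening S c p q) (R : G ⊗[ℂ] N)
    (hR : ∀ m, R * ((1 : G) ⊗ₜ f m) = conj S a Algebra.TensorProduct.includeLeft (c m) R) :
    conj S a Algebra.TensorProduct.includeLeft q R * tensorRight G f p = R := by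
  rw [← lift_includeLeft_includeRight_comp]
  exact conj_q_mul_lift_p _ hp R hR

theorem tensor_coconj_costraighten (hp : IsStraightening S c p q) (C : G ⊗[ℂ] N)
    (hC : ∀ m, C * b m = tensorRight G f (c m) * C) :
    coconj S b Algebra.TensorProduct.includeLeft p (tensorRight G f q * C) = C := by
  simp only [← lift_includeLeft_includeRight_comp] at hC ⊢
  exact coconj_costraighten _ hp C hC

theorem tensor_mul_costraighten (hp : IsStraightening S c p q) (C : G ⊗[ℂ] N)
    (hC : ∀ m, C * b m = tensorRight G f (c m) * C) (m : M) :
    ((1 : G) ⊗ₜ f m) * (tensorRight G f q * C) =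
      coconj S b Algebra.TensorProduct.includeLeft (c m) (tensorRight G f q * C) := by
  simp only [← lift_includeLeft_includeRight_comp] at hC ⊢
  exact mul_costraighten _ hp C hC m

theorem tensor_mul_coconj (L : G ⊗[ℂ] N)
    (hL : ∀ m, ((1 : G) ⊗ₜ f m) * L = coconj S b Algebra.TensorProduct.includeLeft (c m) L)
    (X Y : G ⊗[ℂ] M) :
    tensorRight G f Y * coconj S b Algebra.TensorProduct.includeLeft X L =
      coconj S b Algebra.TensorProduct.includeLeft
        (conj S c Algebra.TensorProduct.includeLeft Y X) L := by
  rw [← lift_includeLeft_includeRight_comp]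
  exact lift_mul_coconj _ L hL X Y

theorem tensor_coconj_p_mul (hp : IsStraightening S c p q) (L : G ⊗[ℂ] N)
    (hL : ∀ m, ((1 : G) ⊗ₜ f m) * L = coconj S b Algebra.TensorProduct.includeLeft (c m) L)
    (m : M) :
    coconj S b Algebra.TensorProduct.includeLeft p L * b m =
      tensorRight G f (c m) * coconj S b Algebra.TensorProduct.includeLeft p L := by
  rw [← lift_includeLeft_includeRight_comp]
  exact coconj_p_mul _ hp L hL m

theorem tensor_q_mul_coconj_p (hp : IsStraightening S c p q) (L : G ⊗[ℂ] N)
    (hL : ∀ m, ((1 : G) ⊗ₜ f m) * L = coconj S b Algebra.TensorProduct.includeLeft (c m) L) :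
    tensorRight G f q * coconj S b Algebra.TensorProduct.includeLeft p L = L := by
  rw [← lift_includeLeft_includeRight_comp]
  exact lift_q_mul_coconj_p _ hp L hL

end FrameTensor

/-! ### Slices of tensors and stable subspaces -/

section Slices

variable {G A : Type*} [Ring G] [Algebra ℂ G] [Ring A] [Algebra ℂ A]

@[simp] theorem sliceLeft_tmul {V W : Type*} [AddCommGroup V] [Module ℂ V] [AddCommGroup W]
    [Module ℂ W] (φ : Module.Dual ℂ V) (x : V) (a : W) :
    sliceLeft (x ⊗ₜ[ℂ] a) φ = φ x • a := by
  simp [sliceLeft]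

theorem sliceLeft_add {V W : Type*} [AddCommGroup V] [Module ℂ V] [AddCommGroup W]
    [Module ℂ W] (φ : Module.Dual ℂ V) (s t : V ⊗[ℂ] W) :
    sliceLeft (s + t) φ = sliceLeft s φ + sliceLeft t φ := by
  simp [sliceLeft]

theorem sliceLeft_smul {V W : Type*} [AddCommGroup V] [Module ℂ V] [AddCommGroup W]
    [Module ℂ W] (φ : Module.Dual ℂ V) (c : ℂ) (t : V ⊗[ℂ] W) :
    sliceLeft (c • t) φ = c • sliceLeft t φ := by
  simp [sliceLeft]

/-- A tensor is recovered from its slices along a basis. -/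
theorem sum_tmul_sliceLeft {V W ι : Type*} [AddCommGroup V] [Module ℂ V] [AddCommGroup W]
    [Module ℂ W] [Fintype ι] (e : Module.Basis ι ℂ V) (t : V ⊗[ℂ] W) :
    ∑ i, e i ⊗ₜ[ℂ] sliceLeft t (e.coord i) = t := by
  induction t using tensor_induction with
  | add a b ha hb =>
    simp only [sliceLeft_add, TensorProduct.tmul_add, Finset.sum_add_distrib, ha, hb]
  | tmul x a =>
    simp only [sliceLeft_tmul, ← TensorProduct.smul_tmul, ← TensorProduct.sum_tmul,
      Module.Basis.coord_apply, e.sum_repr]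

theorem sliceLeft_injective {V W : Type*} [AddCommGroup V] [Module ℂ V] [AddCommGroup W]
    [Module ℂ W] [FiniteDimensional ℂ V] :
    Function.Injective (sliceLeft : V ⊗[ℂ] W → Module.Dual ℂ V →ₗ[ℂ] W) := fun s t h => by
  rw [← sum_tmul_sliceLeft (Module.finBasis ℂ V) s, h, sum_tmul_sliceLeft]

theorem killLeft_eq_sliceLeft (ε : G →ₐ[ℂ] ℂ) (t : G ⊗[ℂ] A) :
    killLeft ε A t = sliceLeft t ε.toLinearMap := by
  induction t using tensor_induction with
  | add a b ha hb => simp only [map_add, sliceLeft_add, ha, hb]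
  | tmul => simp

theorem map_sliceLeft {V W W' : Type*} [AddCommGroup V] [Module ℂ V] [AddCommGroup W]
    [Module ℂ W] [AddCommGroup W'] [Module ℂ W'] (f : W →ₗ[ℂ] W') (t : V ⊗[ℂ] W)
    (φ : Module.Dual ℂ V) : f (sliceLeft t φ) = sliceLeft (f.lTensor V t) φ := by
  induction t using tensor_induction with
  | add a b ha hb => simp only [map_add, sliceLeft_add, ha, hb]
  | tmul => simp

theorem sliceLeft_mul_one_tmul (t : G ⊗[ℂ] A) (a : A) (φ : Module.Dual ℂ G) :
    sliceLeft (t * ((1 : G) ⊗ₜ a)) φ = sliceLeft t φ * a := by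
  induction t using tensor_induction with
  | add a b ha hb => simp only [add_mul, sliceLeft_add, ha, hb]
  | tmul => simp

theorem sliceLeft_one_tmul_mul (t : G ⊗[ℂ] A) (a : A) (φ : Module.Dual ℂ G) :
    sliceLeft (((1 : G) ⊗ₜ a) * t) φ = a * sliceLeft t φ := by
  induction t using tensor_induction with
  | add a b ha hb => simp only [mul_add, sliceLeft_add, ha, hb]
  | tmul => simp

/-- Products of values on `Ĝ` are double slices of a product of legs, so coherence is a
multiplication rule for the generators. -/
theorem sliceLeft_sliceLeft_leg13_mul (s t : G ⊗[ℂ] A) (φ ψ : Module.Dual ℂ G) :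
    sliceLeft (sliceLeft (leg13 G A s * ((1 : G) ⊗ₜ t)) φ) ψ =
      sliceLeft s φ * sliceLeft t ψ := by
  induction s using tensor_induction with
  | add a b ha hb => simp only [map_add, add_mul, sliceLeft_add, ha, hb]
  | tmul x a =>
    induction t using tensor_induction with
    | add a b ha hb => simp only [TensorProduct.tmul_add, mul_add, sliceLeft_add, ha, hb]
    | tmul y b =>
      simp [sliceLeft_smul, smul_smul, mul_comm]

/-- The subspace `G ⊗ N ⊆ G ⊗ A`. -/
def tensorSub (G : Type*) [Ring G] [Algebra ℂ G] (N : Submodule ℂ A) :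
    Submodule ℂ (G ⊗[ℂ] A) :=
  Submodule.span ℂ {t | ∃ x : G, ∃ n ∈ N, x ⊗ₜ n = t}

variable {N : Submodule ℂ A}

theorem tmul_mem_tensorSub (x : G) {n : A} (hn : n ∈ N) : x ⊗ₜ n ∈ tensorSub G N :=
  Submodule.subset_span ⟨x, n, hn, rfl⟩

theorem sliceLeft_mem {t : G ⊗[ℂ] A} (ht : t ∈ tensorSub G N) (φ : Module.Dual ℂ G) :
    sliceLeft t φ ∈ N := by
  induction ht using Submodule.span_induction with
  | mem t h => obtain ⟨x, n, hn, rfl⟩ := h; simpa using N.smul_mem _ hn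
  | zero => simp [sliceLeft]
  | add x y _ _ hx hy => rw [sliceLeft_add]; exact N.add_mem hx hy
  | smul c x _ hx => simpa [sliceLeft] using N.smul_mem c hx

theorem mem_tensorSub [FiniteDimensional ℂ G] {t : G ⊗[ℂ] A}
    (ht : ∀ φ, sliceLeft t φ ∈ N) : t ∈ tensorSub G N := by
  rw [← sum_tmul_sliceLeft (Module.finBasis ℂ G) t]
  exact Submodule.sum_mem _ fun i _ => tmul_mem_tensorSub _ (ht _)

/-- A subspace stable under left multiplication by the range of `f`. -/
def LeftStable {X : Type*} [Ring X] [Algebra ℂ X] (f : X →ₐ[ℂ] A) (N : Submodule ℂ A) : Prop :=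
  ∀ x, ∀ n ∈ N, f x * n ∈ N

/-- A subspace stable under right multiplication by the range of `f`. -/
def RightStable {X : Type*} [Ring X] [Algebra ℂ X] (f : X →ₐ[ℂ] A) (N : Submodule ℂ A) : Prop :=
  ∀ x, ∀ n ∈ N, n * f x ∈ N

variable {X : Type*} [Ring X] [Algebra ℂ X] {f : X →ₐ[ℂ] A}

theorem LeftStable.tensorRight (h : LeftStable f N) :
    LeftStable (tensorRight G f) (tensorSub G N) := fun t n hn => by
  induction t using tensor_induction with
  | add a b ha hb => rw [map_add, add_mul]; exact Submodule.add_mem _ ha hb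
  | tmul x y =>
    induction hn using Submodule.span_induction with
    | mem t ht =>
      obtain ⟨z, n, hn, rfl⟩ := ht
      rw [tensorRight_tmul, Algebra.TensorProduct.tmul_mul_tmul]
      exact tmul_mem_tensorSub _ (h _ _ hn)
    | zero => simp
    | add x y _ _ hx hy => rw [mul_add]; exact Submodule.add_mem _ hx hy
    | smul c x _ hx => rw [mul_smul_comm]; exact Submodule.smul_mem _ _ hx

theorem RightStable.tensorRight (h : RightStable f N) :
    RightStable (tensorRight G f) (tensorSub G N) := fun t n hn => by
  induction t using tensor_induction with
  | add a b ha hb => rw [map_add, mul_add]; exact Submodule.add_mem _ ha hb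
  | tmul x y =>
    induction hn using Submodule.span_induction with
    | mem t ht =>
      obtain ⟨z, n, hn, rfl⟩ := ht
      rw [tensorRight_tmul, Algebra.TensorProduct.tmul_mul_tmul]
      exact tmul_mem_tensorSub _ (h _ _ hn)
    | zero => simp
    | add x y _ _ hx hy => rw [add_mul]; exact Submodule.add_mem _ hx hy
    | smul c x _ hx => rw [smul_mul_assoc]; exact Submodule.smul_mem _ _ hx

theorem rightStable_includeLeft :
    RightStable (Algebra.TensorProduct.includeLeft : G →ₐ[ℂ] G ⊗[ℂ] A) (tensorSub G N) :=
  fun x n hn => by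
    have h : RightStable (X := ℂ) (Algebra.ofId ℂ A) N := fun c n hn => by
      rw [Algebra.ofId_apply, ← Algebra.commutes, ← Algebra.smul_def]
      exact N.smul_mem _ hn
    simpa using h.tensorRight (G := G) (x ⊗ₜ[ℂ] (1 : ℂ)) n hn

theorem leftStable_includeLeft :
    LeftStable (Algebra.TensorProduct.includeLeft : G →ₐ[ℂ] G ⊗[ℂ] A) (tensorSub G N) :=
  fun x n hn => by
    have h : LeftStable (X := ℂ) (Algebra.ofId ℂ A) N := fun c n hn => by
      rw [Algebra.ofId_apply, ← Algebra.smul_def]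
      exact N.smul_mem _ hn
    simpa using h.tensorRight (G := G) (x ⊗ₜ[ℂ] (1 : ℂ)) n hn

theorem conj_mem {S : G ≃ₐ[ℂ] Gᵐᵒᵖ} {s : G →ₐ[ℂ] A} (h : LeftStable f N) (hs : RightStable s N)
    (Y : G ⊗[ℂ] X) {n : A} (hn : n ∈ N) : conj S f s Y n ∈ N := by
  induction Y using tensor_induction with
  | add a b ha hb => rw [map_add]; exact N.add_mem ha hb
  | tmul x y => rw [conj_tmul]; exact hs _ _ (h _ _ hn)

theorem coconj_mem {S : G ≃ₐ[ℂ] Gᵐᵒᵖ} {s : G →ₐ[ℂ] A} (h : RightStable f N) (hs : LeftStable s N)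
    (Y : G ⊗[ℂ] X) {n : A} (hn : n ∈ N) : coconj S f s Y n ∈ N := by
  induction Y using tensor_induction with
  | add a b ha hb => rw [map_add]; exact N.add_mem ha hb
  | tmul x y => rw [coconj_tmul]; exact h _ _ (hs _ _ hn)

theorem tensorSplit_mem (Δ : G →ₐ[ℂ] G ⊗[ℂ] G) {t : G ⊗[ℂ] A} (ht : t ∈ tensorSub G N) :
    tensorSplit Δ A t ∈ tensorSub G (tensorSub G N) := by
  induction ht using Submodule.span_induction with
  | mem t h =>
    obtain ⟨x, n, hn, rfl⟩ := h
    rw [tensorSplit_tmul]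
    generalize Δ x = u
    induction u using tensor_induction with
    | add a b ha hb =>
      rw [TensorProduct.add_tmul, map_add]; exact Submodule.add_mem _ ha hb
    | tmul y z => exact tmul_mem_tensorSub _ (tmul_mem_tensorSub _ hn)
  | zero => simp
  | add x y _ _ hx hy => rw [map_add]; exact Submodule.add_mem _ hx hy
  | smul c x _ hx => rw [map_smul]; exact Submodule.smul_mem _ _ hx

end Slices

/-! ### Spanning sets of the generated algebra -/

section Span

variable {G M A : Type*} [Ring G] [Algebra ℂ G] [Ring M] [Algebra ℂ M] [Ring A] [Algebra ℂ A]
  {H : QuasiHopfAlgebra G} (P : QuasiCommutingPair H.toQuasiBialgebra M) {γ : M →ₐ[ℂ] A}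
  {T : G ⊗[ℂ] A}

theorem isStraightening_left : IsStraightening H.antipode P.left.coact (pLambda H P.left)
    (leftAntipodeCoaction H P.left).q :=
  (leftAntipodeCoaction H P.left).isStraightening

theorem isStraightening_right : IsStraightening (antipodeSymm H.antipode)
    (coactFlip P.right.coact) (rightAntipodeCoaction H P.right).p
    (Algebra.TensorProduct.comm ℂ M G (qRho H P.right)) := by
  rw [← rightAntipodeCoaction_q]
  exact (rightAntipodeCoaction H P.right).isStraightening

variable {P}

theorem coherent_iff :
    leg312 γ (P.right.reassoc : M ⊗[ℂ] (G ⊗[ℂ] G)) * leg13 G A T *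
        leg132 γ ((P.mixed⁻¹ : (G ⊗[ℂ] (M ⊗[ℂ] G))ˣ) : G ⊗[ℂ] (M ⊗[ℂ] G)) *
        ((1 : G) ⊗ₜ[ℂ] T) *
        tensorRight G (tensorRight G γ) (P.left.reassoc : G ⊗[ℂ] (G ⊗[ℂ] M)) =
      tensorSplit H.comul A T ↔ legProduct P γ T T = reducedComul P γ T := by
  rw [reducedComul, legProduct, map_units_inv (leg312 (G := G) γ),
    map_units_inv (tensorRight G (tensorRight G γ)),
    Units.eq_mul_inv_iff_mul_eq, Units.eq_inv_mul_iff_mul_eq]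
  simp only [mul_assoc, Units.coe_map, MonoidHom.coe_coe]

/-- `T` is recovered from `T p_λ` by the action of `q_λ`, and a further right factor `m` only
changes the acting element. Right multiplication of `T` by `M` is thus expressed through `T p_λ`,
with `M` acting on the left and `G` on its own leg. -/
theorem intertwiner_mul (hT : IsIntertwiner P γ T) (m : M) :
    T * ((1 : G) ⊗ₜ γ m) = conj H.antipode (rhoA P γ) Algebra.TensorProduct.includeLeft
      (coconj H.antipode P.left.coact Algebra.TensorProduct.includeLeft ((1 : G) ⊗ₜ m)
        (leftAntipodeCoaction H P.left).q) (T * tensorRight G γ (pLambda H P.left)) := by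
  have h := tensor_straighten_mul_right (isStraightening_left P) T hT
  rw [← tensor_conj_mul _ h, tensor_conj_straighten (isStraightening_left P) T hT,
    tensorRight_tmul]

theorem mul_intertwiner (hT : IsIntertwiner P γ T) (m : M) :
    ((1 : G) ⊗ₜ γ m) * T = coconj (antipodeSymm H.antipode) (lamA P γ)
      Algebra.TensorProduct.includeLeft
      (conj (antipodeSymm H.antipode) (coactFlip P.right.coact)
        Algebra.TensorProduct.includeLeft ((1 : G) ⊗ₜ m) (rightAntipodeCoaction H P.right).p)
      (tensorRight G γ (Algebra.TensorProduct.comm ℂ M G (qRho H P.right)) * T) := by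
  have h := tensor_mul_costraighten (isStraightening_right P) T hT
  rw [← tensor_mul_coconj _ h, tensor_coconj_costraighten (isStraightening_right P) T hT,
    tensorRight_tmul]

/-- The span of `γ(M) T(Ĝ) γ(M)`. -/
def bimoduleSpan (γ : M →ₐ[ℂ] A) (T : G ⊗[ℂ] A) : Submodule ℂ A :=
  Submodule.span ℂ {a | ∃ (m : M) (φ : Module.Dual ℂ G) (m' : M), γ m * sliceLeft T φ * γ m' = a}

theorem leftStable_bimoduleSpan : LeftStable γ (bimoduleSpan γ T) := fun m n hn => by
  induction hn using Submodule.span_induction with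
  | mem t ht =>
    obtain ⟨m₁, φ, m₂, rfl⟩ := ht
    exact Submodule.subset_span ⟨m * m₁, φ, m₂, by simp [mul_assoc]⟩
  | zero => simp
  | add x y _ _ hx hy => rw [mul_add]; exact Submodule.add_mem _ hx hy
  | smul c x _ hx => rw [mul_smul_comm]; exact Submodule.smul_mem _ _ hx

theorem rightStable_bimoduleSpan : RightStable γ (bimoduleSpan γ T) := fun m n hn => by
  induction hn using Submodule.span_induction with
  | mem t ht =>
    obtain ⟨m₁, φ, m₂, rfl⟩ := ht
    exact Submodule.subset_span ⟨m₁, φ, m₂ * m, by simp [mul_assoc]⟩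
  | zero => simp
  | add x y _ _ hx hy => rw [add_mul]; exact Submodule.add_mem _ hx hy
  | smul c x _ hx => rw [smul_mul_assoc]; exact Submodule.smul_mem _ _ hx

theorem leg312_eq (t : M ⊗[ℂ] (G ⊗[ℂ] G)) :
    leg312 γ t = tensorRight G (tensorRight G γ) (leg312 (AlgHom.id ℂ M) t) := by
  induction t using tensor_induction₃ with
  | add a b ha hb => simp only [map_add, ha, hb]
  | tmul => simp

theorem leg13_tensorRight (t : G ⊗[ℂ] M) : leg13 G A (tensorRight G γ t) =
    tensorRight G (tensorRight G γ) (leg13 G M t) := by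
  induction t using tensor_induction with
  | add a b ha hb => simp only [map_add, ha, hb]
  | tmul => simp

theorem LeftStable.rhoA {N : Submodule ℂ A} (h : LeftStable γ N) :
    LeftStable (rhoA P γ) (tensorSub G N) := fun m n hn => by
  rw [DiagonalCrossedProduct.rhoA, AlgHom.comp_apply]
  exact h.tensorRight (coactFlip P.right.coact m) n hn

theorem RightStable.lamA {N : Submodule ℂ A} (h : RightStable γ N) :
    RightStable (lamA P γ) (tensorSub G N) := fun m n hn => by
  rw [DiagonalCrossedProduct.lamA, AlgHom.comp_apply]
  exact h.tensorRight (P.left.coact m) n hn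

theorem LeftStable.leg312 {N : Submodule ℂ A} (h : LeftStable γ N) :
    LeftStable (leg312 γ) (tensorSub G (tensorSub G N)) := fun t n hn => by
  rw [leg312_eq]
  exact (h.tensorRight (G := G)).tensorRight (G := G) _ n hn

theorem LeftStable.rhoTwo {N : Submodule ℂ A} (h : LeftStable γ N) :
    LeftStable (rhoTwo P γ) (tensorSub G (tensorSub G N)) := fun t n hn => by
  rw [DiagonalCrossedProduct.rhoTwo, AlgHom.comp_apply]
  exact h.leg312 _ n hn

theorem LeftStable.leg13_rhoA {N : Submodule ℂ A} (h : LeftStable γ N) :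
    LeftStable ((leg13 G A).comp (DiagonalCrossedProduct.rhoA P γ))
      (tensorSub G (tensorSub G N)) := fun m n hn => by
  rw [AlgHom.comp_apply, DiagonalCrossedProduct.rhoA, AlgHom.comp_apply, leg13_tensorRight]
  exact (h.tensorRight (G := G)).tensorRight (G := G) _ n hn

theorem RightStable.tensorRight_lamA {N : Submodule ℂ A} (h : RightStable γ N) :
    RightStable (_root_.tensorRight G (DiagonalCrossedProduct.lamA P γ))
      (tensorSub G (tensorSub G N)) := fun t n hn => by
  rw [DiagonalCrossedProduct.lamA, ← tensorRight_tensorRight]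
  exact (h.tensorRight (G := G)).tensorRight (G := G) _ n hn

theorem reducedComul_mem {N : Submodule ℂ A} (hl : LeftStable γ N) (hr : RightStable γ N)
    (hT : T ∈ tensorSub G N) : reducedComul P γ T ∈ tensorSub G (tensorSub G N) := by
  rw [reducedComul]
  refine (hr.tensorRight (G := G)).tensorRight (G := G) _ _ ?_
  exact hl.leg312 _ _ (tensorSplit_mem _ hT)

theorem sliceLeft_mem_bimoduleSpan (φ : Module.Dual ℂ G) :
    sliceLeft T φ ∈ bimoduleSpan γ T :=
  Submodule.subset_span ⟨1, φ, 1, by simp⟩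

/-- The span of `γ(M) (T p)(Ĝ)`. -/
def leftSpan (γ : M →ₐ[ℂ] A) (R : G ⊗[ℂ] A) : Submodule ℂ A :=
  Submodule.span ℂ {a | ∃ (m : M) (φ : Module.Dual ℂ G), γ m * sliceLeft R φ = a}

/-- The span of `(q T)(Ĝ) γ(M)`. -/
def rightSpan (γ : M →ₐ[ℂ] A) (L : G ⊗[ℂ] A) : Submodule ℂ A :=
  Submodule.span ℂ {a | ∃ (φ : Module.Dual ℂ G) (m : M), sliceLeft L φ * γ m = a}

theorem leftStable_leftSpan {R : G ⊗[ℂ] A} : LeftStable γ (leftSpan γ R) := fun m n hn => by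
  induction hn using Submodule.span_induction with
  | mem t ht =>
    obtain ⟨m₁, φ, rfl⟩ := ht
    exact Submodule.subset_span ⟨m * m₁, φ, by simp [mul_assoc]⟩
  | zero => simp
  | add x y _ _ hx hy => rw [mul_add]; exact Submodule.add_mem _ hx hy
  | smul c x _ hx => rw [mul_smul_comm]; exact Submodule.smul_mem _ _ hx

theorem rightStable_rightSpan {L : G ⊗[ℂ] A} : RightStable γ (rightSpan γ L) := fun m n hn => by
  induction hn using Submodule.span_induction with
  | mem t ht =>
    obtain ⟨φ, m₁, rfl⟩ := ht
    exact Submodule.subset_span ⟨φ, m₁ * m, by simp [mul_assoc]⟩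
  | zero => simp
  | add x y _ _ hx hy => rw [add_mul]; exact Submodule.add_mem _ hx hy
  | smul c x _ hx => rw [smul_mul_assoc]; exact Submodule.smul_mem _ _ hx

/-- Coherence multiplied by `p_λ`, with the invertible action of `φ_λρ` moved to the other side: a
product of two generators, the first straightened, is expressed through a single copy of `T`. -/
theorem leg13_mul_pLambda_mul (hT : IsNormalCoherentIntertwiner P γ T) :
    leg13 G A (T * tensorRight G γ (pLambda H P.left)) * ((1 : G) ⊗ₜ[ℂ] T) =
      conj H.antipode (rhoTwo P γ) Algebra.TensorProduct.includeLeft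
        ((P.mixed⁻¹ : (G ⊗[ℂ] (M ⊗[ℂ] G))ˣ) : G ⊗[ℂ] (M ⊗[ℂ] G))
        (reducedComul P γ T * tensorRight G (lamA P γ) (pLambda H P.left)) := by
  rw [← coherent_iff.1 hT.coherent, legProduct_mul_pLambda hT.intertwine hT.intertwine,
    ← Module.End.mul_apply, ← map_mul, Units.inv_mul, map_one, Module.End.one_apply]

variable [FiniteDimensional ℂ G]

/-- An arbitrary `m` between two copies of `T` is no harder than `p_λ`: `intertwiner_mul` writes `T
(1 ⊗ γ m)` as an action on `T p_λ`, and that action commutes with multiplication by `T²³` on the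
right. -/
theorem leg13_mul_mem (hT : IsNormalCoherentIntertwiner P γ T) (m : M) :
    leg13 G A (T * ((1 : G) ⊗ₜ γ m)) * ((1 : G) ⊗ₜ T) ∈
      tensorSub G (tensorSub G (bimoduleSpan γ T)) := by
  have hl : LeftStable γ (bimoduleSpan γ T) := leftStable_bimoduleSpan
  have hr : RightStable γ (bimoduleSpan γ T) := rightStable_bimoduleSpan
  have hT' : T ∈ tensorSub G (bimoduleSpan γ T) :=
    mem_tensorSub fun φ => sliceLeft_mem_bimoduleSpan φ
  have h₁ : leg13 G A (T * tensorRight G γ (pLambda H P.left)) * ((1 : G) ⊗ₜ[ℂ] T) ∈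
      tensorSub G (tensorSub G (bimoduleSpan γ T)) := by
    rw [leg13_mul_pLambda_mul hT]
    exact conj_mem hl.rhoTwo rightStable_includeLeft _
      (hr.tensorRight_lamA _ _ (reducedComul_mem hl hr hT'))
  have e : (leg13 G A).comp Algebra.TensorProduct.includeLeft =
    Algebra.TensorProduct.includeLeft := AlgHom.ext fun x => rfl
  rw [intertwiner_mul hT.intertwine, map_conj, e]
  have h₂ := conj_mem (S := H.antipode) (s := Algebra.TensorProduct.includeLeft)
    (hl.leg13_rhoA (P := P)) rightStable_includeLeft
    (coconj H.antipode P.left.coact Algebra.TensorProduct.includeLeft ((1 : G) ⊗ₜ m)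
        (leftAntipodeCoaction H P.left).q) h₁
  rwa [conj_mul _ _ _ _ _ fun x => commute_includeLeft_one_tmul x T] at h₂

theorem sliceLeft_mul_sliceLeft_mem (hT : IsNormalCoherentIntertwiner P γ T) (m : M)
    (φ ψ : Module.Dual ℂ G) :
    sliceLeft T φ * γ m * sliceLeft T ψ ∈ bimoduleSpan γ T := by
  rw [← sliceLeft_mul_one_tmul, ← sliceLeft_sliceLeft_leg13_mul]
  exact sliceLeft_mem (sliceLeft_mem (leg13_mul_mem hT m) φ) ψ

theorem bimoduleSpan_mul_mem (hT : IsNormalCoherentIntertwiner P γ T) {a b : A}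
    (ha : a ∈ bimoduleSpan γ T) (hb : b ∈ bimoduleSpan γ T) : a * b ∈ bimoduleSpan γ T := by
  induction ha using Submodule.span_induction with
  | zero => simp
  | add x y _ _ hx hy => rw [add_mul]; exact Submodule.add_mem _ hx hy
  | smul c x _ hx => rw [smul_mul_assoc]; exact Submodule.smul_mem _ _ hx
  | mem t ht =>
    obtain ⟨m₁, φ, m₂, rfl⟩ := ht
    induction hb using Submodule.span_induction with
    | zero => simp
    | add x y _ _ hx hy => rw [mul_add]; exact Submodule.add_mem _ hx hy
    | smul c x _ hx => rw [mul_smul_comm]; exact Submodule.smul_mem _ _ hx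
    | mem t ht =>
      obtain ⟨m₃, ψ, m₄, rfl⟩ := ht
      have := rightStable_bimoduleSpan m₄ _ (leftStable_bimoduleSpan m₁ _
        (sliceLeft_mul_sliceLeft_mem hT (m₂ * m₃) φ ψ))
      simpa only [map_mul, mul_assoc] using this

/-- `γ(M) T(Ĝ) γ(M)` spans the subalgebra generated by `γ(M)` and `T(Ĝ)`. -/
theorem mem_bimoduleSpan_of_mem_adjoin (hT : IsNormalCoherentIntertwiner P γ T) {a : A}
    (ha : a ∈ Algebra.adjoin ℂ (Set.range γ ∪ Set.range (sliceLeft T))) :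
    a ∈ bimoduleSpan γ T := by
  have h1 : (1 : A) ∈ bimoduleSpan γ T := by
    rw [← hT.normal, killLeft_eq_sliceLeft]
    exact sliceLeft_mem_bimoduleSpan _
  induction ha using Algebra.adjoin_induction with
  | mem x hx =>
    rcases hx with ⟨m, rfl⟩ | ⟨φ, rfl⟩
    · simpa using leftStable_bimoduleSpan m _ h1
    · exact sliceLeft_mem_bimoduleSpan φ
  | algebraMap r => rw [Algebra.algebraMap_eq_smul_one]; exact Submodule.smul_mem _ _ h1
  | add x y _ _ hx hy => exact Submodule.add_mem _ hx hy
  | mul x y _ _ hx hy => exact bimoduleSpan_mul_mem hT hx hy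

theorem mem_tensorSub_leftSpan (R : G ⊗[ℂ] A) : R ∈ tensorSub G (leftSpan γ R) :=
  mem_tensorSub fun φ => Submodule.subset_span ⟨1, φ, by simp⟩

theorem mem_tensorSub_rightSpan (L : G ⊗[ℂ] A) : L ∈ tensorSub G (rightSpan γ L) :=
  mem_tensorSub fun φ => Submodule.subset_span ⟨φ, 1, by simp⟩

theorem bimoduleSpan_le_leftSpan (hT : IsIntertwiner P γ T) :
    bimoduleSpan γ T ≤ leftSpan γ (T * tensorRight G γ (pLambda H P.left)) := by
  refine Submodule.span_le.2 ?_
  rintro _ ⟨m, φ, m', rfl⟩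
  rw [mul_assoc, ← sliceLeft_mul_one_tmul, intertwiner_mul hT]
  exact leftStable_leftSpan _ _ (sliceLeft_mem (conj_mem leftStable_leftSpan.rhoA
    rightStable_includeLeft _ (mem_tensorSub_leftSpan _)) φ)

theorem bimoduleSpan_le_rightSpan (hT : IsIntertwiner P γ T) :
    bimoduleSpan γ T ≤ rightSpan γ
      (tensorRight G γ (Algebra.TensorProduct.comm ℂ M G (qRho H P.right)) * T) := by
  refine Submodule.span_le.2 ?_
  rintro _ ⟨m, φ, m', rfl⟩
  rw [← sliceLeft_one_tmul_mul, mul_intertwiner hT]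
  exact rightStable_rightSpan _ _ (sliceLeft_mem (coconj_mem rightStable_rightSpan.lamA
    leftStable_includeLeft _ (mem_tensorSub_rightSpan _)) φ)

end Span

/-- An associativity argument for three factors. `c` absorbs `T₂` by `e₁` and the result absorbs
`T₃` by `e₂`, which yields `X₁`; quasi-coassociativity `hX` turns `X₁` into `X₂`, and `e₃` read
backwards returns to `c` and `dT`. Between these steps the reassociators are moved through `c`,
`T₂`, `T₃`, and `p₁` to `p₄` match them; `q₁` to `q₄` are those pentagons solved for the products
that occur. -/
theorem coherence_of_pentagons {R : Type*} [Ring R] {c T₂ T₃ dC dT X₁ X₂ : R}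
    {a12 a23 aD3 a1D r1 l1 f m12 m23 m1D mD3 r2 l2 b12 b23 bD3 b1D r3 l3 : Rˣ}
    (hc : c * l1 = r1 * c) (h₂ : T₂ * l2 = r2 * T₂) (h₃ : T₃ * l3 = r3 * T₃)
    (e₁ : c * (m12⁻¹ : Rˣ) * T₂ = (a12⁻¹ : Rˣ) * dC * (b12⁻¹ : Rˣ))
    (e₂ : dC * (mD3⁻¹ : Rˣ) * T₃ = (aD3⁻¹ : Rˣ) * X₁ * (bD3⁻¹ : Rˣ))
    (e₃ : c * (m1D⁻¹ : Rˣ) * dT = (a1D⁻¹ : Rˣ) * X₂ * (b1D⁻¹ : Rˣ))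
    (hX : X₂ * f = f * X₁)
    (p₁ : a23 * r2 * m12 = m1D * l1) (p₂ : m23 * l2 * b12 = r3 * mD3)
    (p₃ : f * aD3 * a12 = a1D * r1) (p₄ : b23 * b1D * f = l3 * bD3) :
    c * (m1D⁻¹ : Rˣ) * (a23 * T₂ * (m23⁻¹ : Rˣ) * T₃ * b23) = c * (m1D⁻¹ : Rˣ) * dT := by
  have q₁ : (m1D⁻¹ : Rˣ) * (a23 : R) = l1 * (m12⁻¹ : Rˣ) * (r2⁻¹ : Rˣ) := by
    simp only [← Units.val_mul]; congr 1
    rw [eq_mul_inv_iff_mul_eq, eq_mul_inv_iff_mul_eq, mul_assoc, mul_assoc, inv_mul_eq_iff_eq_mul,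
      ← mul_assoc, p₁]
  have q₂ : (b12⁻¹ : Rˣ) * ((l2⁻¹ : Rˣ) * ((m23⁻¹ : Rˣ) : R)) = (mD3⁻¹ : Rˣ) * (r3⁻¹ : Rˣ) := by
    simp only [← Units.val_mul, ← mul_inv_rev, p₂]
  have q₃ : (r1 : R) * ((a12⁻¹ : Rˣ) * ((aD3⁻¹ : Rˣ) : R)) = (a1D⁻¹ : Rˣ) * f := by
    simp only [← Units.val_mul]; congr 1
    rw [← mul_inv_rev, mul_inv_eq_iff_eq_mul, mul_assoc, eq_inv_mul_iff_mul_eq, ← p₃, mul_assoc]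
  have q₄ : (bD3⁻¹ : Rˣ) * ((l3⁻¹ : Rˣ) * (b23 : R)) = (f⁻¹ : Rˣ) * (b1D⁻¹ : Rˣ) := by
    simp only [← Units.val_mul]; congr 1
    rw [← mul_assoc, ← mul_inv_rev, ← p₄]
    group
  have k₂ : (r2⁻¹ : Rˣ) * T₂ = T₂ * (l2⁻¹ : Rˣ) := by
    rw [Units.inv_mul_eq_iff_eq_mul, ← mul_assoc, ← h₂, Units.mul_inv_cancel_right]
  have k₃ : (r3⁻¹ : Rˣ) * T₃ = T₃ * (l3⁻¹ : Rˣ) := by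
    rw [Units.inv_mul_eq_iff_eq_mul, ← mul_assoc, ← h₃, Units.mul_inv_cancel_right]
  have kX : X₁ * (f⁻¹ : Rˣ) = (f⁻¹ : Rˣ) * X₂ := by
    rw [Units.mul_inv_eq_iff_eq_mul, mul_assoc, hX, Units.inv_mul_cancel_left]
  calc c * (m1D⁻¹ : Rˣ) * (a23 * T₂ * (m23⁻¹ : Rˣ) * T₃ * b23)
      = c * ((m1D⁻¹ : Rˣ) * a23) * T₂ * (m23⁻¹ : Rˣ) * T₃ * b23 := by simp only [mul_assoc]
    _ = c * l1 * (m12⁻¹ : Rˣ) * ((r2⁻¹ : Rˣ) * T₂) * (m23⁻¹ : Rˣ) * T₃ * b23 := by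
        rw [q₁]; simp only [mul_assoc]
    _ = r1 * (c * (m12⁻¹ : Rˣ) * T₂) * (l2⁻¹ : Rˣ) * (m23⁻¹ : Rˣ) * T₃ * b23 := by
        rw [k₂, hc]; simp only [mul_assoc]
    _ = r1 * (a12⁻¹ : Rˣ) * dC * ((b12⁻¹ : Rˣ) * ((l2⁻¹ : Rˣ) * (m23⁻¹ : Rˣ))) * T₃ * b23 := by
        rw [e₁]; simp only [mul_assoc]
    _ = r1 * (a12⁻¹ : Rˣ) * dC * (mD3⁻¹ : Rˣ) * ((r3⁻¹ : Rˣ) * T₃) * b23 := by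
        rw [q₂]; simp only [mul_assoc]
    _ = r1 * (a12⁻¹ : Rˣ) * (dC * (mD3⁻¹ : Rˣ) * T₃) * (l3⁻¹ : Rˣ) * b23 := by
        rw [k₃]; simp only [mul_assoc]
    _ = (r1 * ((a12⁻¹ : Rˣ) * (aD3⁻¹ : Rˣ))) * X₁ * ((bD3⁻¹ : Rˣ) * ((l3⁻¹ : Rˣ) * b23)) := by
        rw [e₂]; simp only [mul_assoc]
    _ = (a1D⁻¹ : Rˣ) * (f * (X₁ * (f⁻¹ : Rˣ))) * (b1D⁻¹ : Rˣ) := by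
        rw [q₃, q₄]; simp only [mul_assoc]
    _ = c * (m1D⁻¹ : Rˣ) * dT := by rw [kX, Units.mul_inv_cancel_left, e₃]

/-! ### Coherence in three legs -/

section Coherence

variable {G M A : Type*} [Ring G] [Algebra ℂ G] [Ring M] [Algebra ℂ M] [Ring A] [Algebra ℂ A]
  {H : QuasiHopfAlgebra G} {P : QuasiCommutingPair H.toQuasiBialgebra M} {γ : M →ₐ[ℂ] A}
  (Δ : G →ₐ[ℂ] G ⊗[ℂ] G)

/-- `x ⊗ a ↦ x ⊗ 1 ⊗ 1 ⊗ a`. -/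
def leg₁ (G A : Type*) [Ring G] [Algebra ℂ G] [Ring A] [Algebra ℂ A] :
    G ⊗[ℂ] A →ₐ[ℂ] G ⊗[ℂ] (G ⊗[ℂ] (G ⊗[ℂ] A)) :=
  tensorRight G (Algebra.TensorProduct.includeRight.comp Algebra.TensorProduct.includeRight)

/-- `x ⊗ y ⊗ a ↦ x ⊗ y ⊗ 1 ⊗ a`. -/
def leg₁₂ (G A : Type*) [Ring G] [Algebra ℂ G] [Ring A] [Algebra ℂ A] :
    G ⊗[ℂ] (G ⊗[ℂ] A) →ₐ[ℂ] G ⊗[ℂ] (G ⊗[ℂ] (G ⊗[ℂ] A)) :=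
  tensorRight G (leg13 G A)

/-- `m ⊗ x ⊗ y ⊗ z ↦ x ⊗ y ⊗ z ⊗ γ(m)`. -/
def leg4123 (γ : M →ₐ[ℂ] A) :
    M ⊗[ℂ] (G ⊗[ℂ] (G ⊗[ℂ] G)) →ₐ[ℂ] G ⊗[ℂ] (G ⊗[ℂ] (G ⊗[ℂ] A)) :=
  (Algebra.TensorProduct.lift
    ((Algebra.TensorProduct.includeRight.comp (Algebra.TensorProduct.includeRight.comp
      Algebra.TensorProduct.includeRight)).comp γ) (tensorOne G G G A) fun m t => by
      induction t using tensor_induction₃ with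
      | add a b ha hb => rw [map_add]; exact ha.add_right hb
      | tmul => simp [Commute, SemiconjBy])

@[simp] theorem leg₁_tmul (x : G) (a : A) :
    leg₁ G A (x ⊗ₜ a) = x ⊗ₜ (1 ⊗ₜ (1 ⊗ₜ a)) := rfl

@[simp] theorem leg₁₂_tmul (x y : G) (a : A) :
    leg₁₂ G A (x ⊗ₜ (y ⊗ₜ a)) = x ⊗ₜ (y ⊗ₜ (1 ⊗ₜ a)) := rfl

@[simp] theorem leg4123_tmul (x y z : G) (m : M) :
    leg4123 γ (m ⊗ₜ (x ⊗ₜ (y ⊗ₜ z))) = x ⊗ₜ (y ⊗ₜ (z ⊗ₜ γ m)) := by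
  simp [leg4123]

theorem leg₁₂_leg13 (t : G ⊗[ℂ] A) : leg₁₂ G A (leg13 G A t) = leg₁ G A t := by
  induction t using tensor_induction with
  | add a b ha hb => simp only [map_add, ha, hb]
  | tmul => simp

theorem tensorRight_tensorSplit_leg13 (t : G ⊗[ℂ] A) :
    tensorRight G (tensorSplit Δ A) (leg13 G A t) = leg₁ G A t := by
  induction t using tensor_induction with
  | add a b ha hb => simp only [map_add, ha, hb]
  | tmul => simp [Algebra.TensorProduct.one_def]

theorem tensorSplit_leg13 (t : G ⊗[ℂ] A) :
    tensorSplit Δ (G ⊗[ℂ] A) (leg13 G A t) = leg₁₂ G A (tensorSplit Δ A t) := by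
  induction t using tensor_induction with
  | add a b ha hb => simp only [map_add, ha, hb]
  | tmul x a =>
    rw [leg13_tmul, tensorSplit_tmul, tensorSplit_tmul]
    generalize Δ x = u
    induction u using tensor_induction with
    | add a b ha hb => simp only [map_add, TensorProduct.add_tmul, ha, hb]
    | tmul => simp

theorem tensorSplit_one_tmul {N : Type*} [Ring N] [Algebra ℂ N] (t : N) :
    tensorSplit Δ N ((1 : G) ⊗ₜ t) = (1 : G) ⊗ₜ ((1 : G) ⊗ₜ t) := by
  simp [Algebra.TensorProduct.one_def]

theorem tensorSplit_tensorSplit (C : G ⊗[ℂ] A) :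
    tensorRight G (tensorSplit H.comul A) (tensorSplit H.comul A C) *
        tensorOne G G G A (H.reassoc : G ⊗[ℂ] (G ⊗[ℂ] G)) =
      tensorOne G G G A (H.reassoc : G ⊗[ℂ] (G ⊗[ℂ] G)) *
        tensorSplit H.comul (G ⊗[ℂ] A) (tensorSplit H.comul A C) := by
  induction C using tensor_induction with
  | add a b ha hb => simp only [map_add, add_mul, mul_add, ha, hb]
  | tmul x a =>
    have h₁ : ∀ u : G ⊗[ℂ] G, tensorRight G (tensorSplit H.comul A)
        (Algebra.TensorProduct.assoc ℂ ℂ ℂ G G A (u ⊗ₜ a)) =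
        (1 ⊗ₜ (1 ⊗ₜ (1 ⊗ₜ a))) * tensorOne G G G A (tensorRight G H.comul u) := fun u => by
      induction u using tensor_induction with
      | add a b ha hb => simp only [map_add, TensorProduct.add_tmul, mul_add, ha, hb]
      | tmul y z =>
        rw [Algebra.TensorProduct.assoc_tmul, tensorRight_tmul, tensorRight_tmul, tensorSplit_tmul]
        generalize H.comul z = v
        induction v using tensor_induction with
        | add a b ha hb => simp only [map_add, TensorProduct.add_tmul, TensorProduct.tmul_add,
            mul_add, ha, hb]
        | tmul => simp
    have h₂ : ∀ u : G ⊗[ℂ] G, tensorSplit H.comul (G ⊗[ℂ] A)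
        (Algebra.TensorProduct.assoc ℂ ℂ ℂ G G A (u ⊗ₜ a)) =
        tensorOne G G G A (tensorSplit H.comul G u) * (1 ⊗ₜ (1 ⊗ₜ (1 ⊗ₜ a))) := fun u => by
      induction u using tensor_induction with
      | add a b ha hb => simp only [map_add, TensorProduct.add_tmul, add_mul, ha, hb]
      | tmul y z =>
        rw [Algebra.TensorProduct.assoc_tmul, tensorSplit_tmul, tensorSplit_tmul]
        generalize H.comul y = v
        induction v using tensor_induction with
        | add a b ha hb => simp only [map_add, TensorProduct.add_tmul, add_mul,
            ha, hb]
        | tmul => simp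
    rw [tensorSplit_tmul, h₁, h₂, mul_assoc, ← map_mul, H.quasi_coassoc, ← mul_assoc, ← map_mul]
    generalize (H.reassoc : G ⊗[ℂ] (G ⊗[ℂ] G)) * tensorSplit H.comul G (H.comul x) = t
    induction t using tensor_induction₃ with
    | add a b ha hb => simp only [map_add, mul_add, add_mul, ha, hb]
    | tmul => simp

theorem tensorRight_leg312_tensorOne (t : G ⊗[ℂ] (M ⊗[ℂ] G)) :
    tensorRight G (leg312 γ) (tensorOne G M G G t) = leg₁₂ G A (leg132 γ t) := by
  induction t using tensor_induction₃ with
  | add a b ha hb => simp only [map_add, ha, hb]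
  | tmul => simp

theorem tensorRight_leg312_tensorRight (t : G ⊗[ℂ] (M ⊗[ℂ] G)) :
    tensorRight G (leg312 γ) (tensorRight G (tensorRight M Δ) t) =
      tensorRight G (tensorSplit Δ A) (leg132 γ t) := by
  induction t using tensor_induction₃ with
  | add a b ha hb => simp only [map_add, ha, hb]
  | tmul x m y =>
    rw [tensorRight_tmul, tensorRight_tmul, tensorRight_tmul, leg132_tmul, tensorRight_tmul,
      tensorSplit_tmul]
    generalize Δ y = v
    induction v using tensor_induction with
    | add a b ha hb => simp only [map_add, TensorProduct.add_tmul, TensorProduct.tmul_add, ha, hb]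
    | tmul => simp

theorem tensorRight_leg132_tensorOne (t : G ⊗[ℂ] (G ⊗[ℂ] M)) :
    tensorRight G (leg132 γ) (tensorOne G G M G t) =
      leg₁₂ G A (tensorRight G (tensorRight G γ) t) := by
  induction t using tensor_induction₃ with
  | add a b ha hb => simp only [map_add, ha, hb]
  | tmul => simp

theorem tensorRight_leg132_tensorSplit (t : G ⊗[ℂ] (M ⊗[ℂ] G)) :
    tensorRight G (leg132 γ) (tensorSplit Δ (M ⊗[ℂ] G) t) =
      tensorSplit Δ (G ⊗[ℂ] A) (leg132 γ t) := by
  induction t using tensor_induction₃ with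
  | add a b ha hb => simp only [map_add, ha, hb]
  | tmul x m y =>
    rw [leg132_tmul, tensorSplit_tmul, tensorSplit_tmul]
    generalize Δ x = v
    induction v using tensor_induction with
    | add a b ha hb => simp only [map_add, TensorProduct.add_tmul, ha, hb]
    | tmul => simp

theorem leg4123_one_tmul (t : G ⊗[ℂ] (G ⊗[ℂ] G)) :
    leg4123 γ ((1 : M) ⊗ₜ t) = tensorOne G G G A t := by
  induction t using tensor_induction₃ with
  | add a b ha hb => simp only [map_add, TensorProduct.tmul_add, ha, hb]
  | tmul => simp

theorem leg4123_tensorOne (t : M ⊗[ℂ] (G ⊗[ℂ] G)) :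
    leg4123 γ (tensorOne M G G G t) = leg₁₂ G A (leg312 γ t) := by
  induction t using tensor_induction₃ with
  | add a b ha hb => simp only [map_add, ha, hb]
  | tmul => simp

theorem leg4123_tensorRight_tensorSplit (t : M ⊗[ℂ] (G ⊗[ℂ] G)) :
    leg4123 γ (tensorRight M (tensorSplit Δ G) t) = tensorSplit Δ (G ⊗[ℂ] A) (leg312 γ t) := by
  induction t using tensor_induction₃ with
  | add a b ha hb => simp only [map_add, ha, hb]
  | tmul m x y =>
    rw [tensorRight_tmul, leg312_tmul, tensorSplit_tmul, tensorSplit_tmul]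
    generalize Δ x = v
    induction v using tensor_induction with
    | add a b ha hb => simp only [map_add, TensorProduct.add_tmul, TensorProduct.tmul_add, ha, hb]
    | tmul => simp

theorem leg4123_tensorRight_tensorRight (t : M ⊗[ℂ] (G ⊗[ℂ] G)) :
    leg4123 γ (tensorRight M (tensorRight G Δ) t) =
      tensorRight G (tensorSplit Δ A) (leg312 γ t) := by
  induction t using tensor_induction₃ with
  | add a b ha hb => simp only [map_add, ha, hb]
  | tmul m x y =>
    rw [tensorRight_tmul, tensorRight_tmul, leg312_tmul, tensorRight_tmul, tensorSplit_tmul]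
    generalize Δ y = v
    induction v using tensor_induction with
    | add a b ha hb => simp only [map_add, TensorProduct.add_tmul, TensorProduct.tmul_add, ha, hb]
    | tmul => simp

theorem tensorRight₃_tensorOne (t : G ⊗[ℂ] (G ⊗[ℂ] G)) :
    tensorRight G (tensorRight G (tensorRight G γ)) (tensorOne G G G M t) =
      tensorOne G G G A t := by
  induction t using tensor_induction₃ with
  | add a b ha hb => simp only [map_add, ha, hb]
  | tmul => simp

theorem tensorRight₃_tensorSplit (t : G ⊗[ℂ] (G ⊗[ℂ] M)) :
    tensorRight G (tensorRight G (tensorRight G γ)) (tensorSplit Δ (G ⊗[ℂ] M) t) =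
      tensorSplit Δ (G ⊗[ℂ] A) (tensorRight G (tensorRight G γ) t) := by
  induction t using tensor_induction₃ with
  | add a b ha hb => simp only [map_add, ha, hb]
  | tmul x y m =>
    rw [tensorRight_tmul, tensorRight_tmul, tensorSplit_tmul, tensorSplit_tmul]
    generalize Δ x = v
    induction v using tensor_induction with
    | add a b ha hb => simp only [map_add, TensorProduct.add_tmul, ha, hb]
    | tmul => simp

theorem tensorRight₃_tensorRight_tensorSplit (t : G ⊗[ℂ] (G ⊗[ℂ] M)) :
    tensorRight G (tensorRight G (tensorRight G γ)) (tensorRight G (tensorSplit Δ M) t) =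
      tensorRight G (tensorSplit Δ A) (tensorRight G (tensorRight G γ) t) := by
  rw [tensorRight_tensorRight, tensorRight_tensorRight]
  congr 2
  exact AlgHom.ext fun t => (tensorSplit_tensorRight Δ t).symm

theorem leg₁_mul (C : G ⊗[ℂ] A) (u v : G) :
    leg₁ G A C * ((1 : G) ⊗ₜ (u ⊗ₜ (v ⊗ₜ (1 : A)))) =
      ((1 : G) ⊗ₜ (u ⊗ₜ (v ⊗ₜ (1 : A)))) * leg₁ G A C := by
  induction C using tensor_induction with
  | add a b ha hb => simp only [map_add, add_mul, mul_add, ha, hb]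
  | tmul => simp

/-- The factors of `t` in `G` occupy legs on which `C` is trivial, so the intertwining relation is
applied only to the factor in `M`. -/
theorem leg₁_intertwine {C : G ⊗[ℂ] A} (hC : IsIntertwiner P γ C) (t : M ⊗[ℂ] (G ⊗[ℂ] G)) :
    leg₁ G A C * tensorRight G (leg312 γ) (tensorSplit P.left.coact (G ⊗[ℂ] G) t) =
      leg4123 γ (tensorSplit P.right.coact (G ⊗[ℂ] G) t) * leg₁ G A C := by
  induction t using tensor_induction₃ with
  | add a b ha hb => simp only [map_add, add_mul, mul_add, ha, hb]
  | tmul m u v =>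
    have h₁ : tensorRight G (leg312 γ) (tensorSplit P.left.coact (G ⊗[ℂ] G) (m ⊗ₜ (u ⊗ₜ v))) =
        leg₁ G A (lamA P γ m) * ((1 : G) ⊗ₜ (u ⊗ₜ (v ⊗ₜ (1 : A)))) := by
      rw [tensorSplit_tmul, lamA, AlgHom.comp_apply]
      generalize P.left.coact m = w
      induction w using tensor_induction with
      | add a b ha hb => simp only [map_add, TensorProduct.add_tmul, add_mul, ha, hb]
      | tmul => simp
    have h₂ : leg4123 γ (tensorSplit P.right.coact (G ⊗[ℂ] G) (m ⊗ₜ (u ⊗ₜ v))) =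
        leg₁ G A (rhoA P γ m) * ((1 : G) ⊗ₜ (u ⊗ₜ (v ⊗ₜ (1 : A)))) := by
      rw [tensorSplit_tmul, rhoA, AlgHom.comp_apply, coactFlip_apply]
      generalize P.right.coact m = w
      induction w using tensor_induction with
      | add a b ha hb => simp only [map_add, TensorProduct.add_tmul, add_mul, ha, hb]
      | tmul => simp
    rw [h₁, h₂, ← mul_assoc, ← map_mul, hC, map_mul, mul_assoc, leg₁_mul, mul_assoc]

theorem one_tmul_leg13_intertwine {T : G ⊗[ℂ] A} (hT : IsIntertwiner P γ T)
    (t : G ⊗[ℂ] (M ⊗[ℂ] G)) :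
    ((1 : G) ⊗ₜ leg13 G A T) *
        tensorRight G (leg132 γ) (tensorRight G (tensorSplit P.left.coact G) t) =
      tensorRight G (leg312 γ) (tensorRight G (tensorSplit P.right.coact G) t) *
        ((1 : G) ⊗ₜ leg13 G A T) := by
  induction t using tensor_induction with
  | add a b ha hb => simp only [map_add, add_mul, mul_add, ha, hb]
  | tmul x y =>
    simp only [tensorRight_tmul, Algebra.TensorProduct.tmul_mul_tmul, one_mul, mul_one,
      leg13_mul_leg132 hT]
    rfl

theorem one_tmul_one_tmul_intertwine {T : G ⊗[ℂ] A} (hT : IsIntertwiner P γ T)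
    (t : G ⊗[ℂ] (G ⊗[ℂ] M)) :
    ((1 : G) ⊗ₜ ((1 : G) ⊗ₜ T)) * tensorRight G (tensorRight G (tensorRight G γ))
        (tensorRight G (tensorRight G P.left.coact) t) =
      tensorRight G (leg132 γ) (tensorRight G (tensorRight G P.right.coact) t) *
        ((1 : G) ⊗ₜ ((1 : G) ⊗ₜ T)) := by
  induction t using tensor_induction with
  | add a b ha hb => simp only [map_add, add_mul, mul_add, ha, hb]
  | tmul x y =>
    simp only [tensorRight_tmul, Algebra.TensorProduct.tmul_mul_tmul, one_mul, mul_one,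
      leg132_tensorRight, ← one_tmul_mul_tensorRight hT, tensorRight_tensorRight]
    rfl

/-- The hexagon for `T` after composition with an intertwiner `C` such that
`C¹³ φ_λρ⁻¹ T²³ = φ_ρ⁻¹ (Δ ⊗ id)(C) φ_λ⁻¹`. -/
theorem leg₁_mul_coherence {C T : G ⊗[ℂ] A} (hC : IsIntertwiner P γ C)
    (hT : IsIntertwiner P γ T) (h : legProduct P γ C T = reducedComul P γ C) :
    leg₁ G A C * tensorRight G (tensorSplit H.comul A)
        (leg132 γ ((P.mixed⁻¹ : (G ⊗[ℂ] (M ⊗[ℂ] G))ˣ) : G ⊗[ℂ] (M ⊗[ℂ] G))) *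
        ((1 : G) ⊗ₜ (leg312 γ (P.right.reassoc : M ⊗[ℂ] (G ⊗[ℂ] G)) * leg13 G A T *
        leg132 γ ((P.mixed⁻¹ : (G ⊗[ℂ] (M ⊗[ℂ] G))ˣ) : G ⊗[ℂ] (M ⊗[ℂ] G)) *
        ((1 : G) ⊗ₜ[ℂ] T) *
        tensorRight G (tensorRight G γ) (P.left.reassoc : G ⊗[ℂ] (G ⊗[ℂ] M)))) =
      leg₁ G A C * tensorRight G (tensorSplit H.comul A)
        (leg132 γ ((P.mixed⁻¹ : (G ⊗[ℂ] (M ⊗[ℂ] G))ˣ) : G ⊗[ℂ] (M ⊗[ℂ] G))) *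
        ((1 : G) ⊗ₜ tensorSplit H.comul A T) := by
  let J : G ⊗[ℂ] (G ⊗[ℂ] A) →ₐ[ℂ] G ⊗[ℂ] (G ⊗[ℂ] (G ⊗[ℂ] A)) :=
    Algebra.TensorProduct.includeRight
  let D₁ := tensorSplit H.comul (G ⊗[ℂ] A)
  let D₂ := tensorRight G (tensorSplit H.comul A)
  have e₁ := congrArg (leg₁₂ G A) h
  have e₂ := congrArg D₁ h
  have e₃ := congrArg D₂ h
  simp only [legProduct, reducedComul, map_mul] at e₁ e₂ e₃
  rw [leg₁₂_leg13] at e₁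
  rw [show D₁ (leg13 G A C) = _ from tensorSplit_leg13 _ _,
    show D₁ ((1 : G) ⊗ₜ T) = _ from tensorSplit_one_tmul _ _] at e₂
  rw [show D₂ (leg13 G A C) = _ from tensorRight_tensorSplit_leg13 _ _,
    show D₂ ((1 : G) ⊗ₜ T) = _ from tensorRight_tmul _ _ _] at e₃
  have p₁ := congrArg (tensorRight G (leg312 γ)) P.pentagon_right
  have p₂ := congrArg (tensorRight G (leg132 γ)) P.pentagon_left
  have p₃ := congrArg (leg4123 γ) P.right.pentagon
  have p₄ := congrArg (tensorRight G (tensorRight G (tensorRight G γ))) P.left.pentagon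
  simp only [map_mul] at p₁ p₂ p₃ p₄
  rw [tensorRight_leg312_tensorOne, tensorRight_leg312_tensorRight] at p₁
  rw [tensorRight_leg132_tensorOne, tensorRight_leg132_tensorSplit] at p₂
  rw [leg4123_one_tmul, leg4123_tensorOne, leg4123_tensorRight_tensorSplit,
    leg4123_tensorRight_tensorRight] at p₃
  rw [tensorRight₃_tensorOne, tensorRight₃_tensorSplit, tensorRight₃_tensorRight_tensorSplit] at p₄
  -- `a`, `b`, `m` stand for `φ_ρ`, `φ_λ`, `φ_λρ`. Digits give the legs occupied, and `D` marks a
  -- pair of legs made by the coproduct. The `l` and `r` units are the reassociators with a coaction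
  -- applied, before and after they pass an intertwiner.
  have key := coherence_of_pentagons
    (a12 := Units.map ((leg₁₂ G A).comp (leg312 γ) : _ →* _) P.right.reassoc)
    (a23 := Units.map (J.comp (leg312 γ) : _ →* _) P.right.reassoc)
    (aD3 := Units.map (D₁.comp (leg312 γ) : _ →* _) P.right.reassoc)
    (a1D := Units.map (D₂.comp (leg312 γ) : _ →* _) P.right.reassoc)
    (m12 := Units.map ((leg₁₂ G A).comp (leg132 γ) : _ →* _) P.mixed)
    (m23 := Units.map (J.comp (leg132 γ) : _ →* _) P.mixed)
    (mD3 := Units.map (D₁.comp (leg132 γ) : _ →* _) P.mixed)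
    (m1D := Units.map (D₂.comp (leg132 γ) : _ →* _) P.mixed)
    (b12 := Units.map ((leg₁₂ G A).comp (tensorRight G (tensorRight G γ)) : _ →* _)
      P.left.reassoc)
    (b23 := Units.map (J.comp (tensorRight G (tensorRight G γ)) : _ →* _) P.left.reassoc)
    (bD3 := Units.map (D₁.comp (tensorRight G (tensorRight G γ)) : _ →* _) P.left.reassoc)
    (b1D := Units.map (D₂.comp (tensorRight G (tensorRight G γ)) : _ →* _) P.left.reassoc)
    (f := Units.map (tensorOne G G G A : _ →* _) H.reassoc)
    (l1 := Units.map ((tensorRight G (leg312 γ)).comp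
      (tensorSplit P.left.coact (G ⊗[ℂ] G)) : _ →* _) P.right.reassoc)
    (r1 := Units.map ((leg4123 γ).comp
      (tensorSplit P.right.coact (G ⊗[ℂ] G)) : _ →* _) P.right.reassoc)
    (l2 := Units.map ((tensorRight G (leg132 γ)).comp
      (tensorRight G (tensorSplit P.left.coact G)) : _ →* _) P.mixed)
    (r2 := Units.map ((tensorRight G (leg312 γ)).comp
      (tensorRight G (tensorSplit P.right.coact G)) : _ →* _) P.mixed)
    (l3 := Units.map ((tensorRight G (tensorRight G (tensorRight G γ))).comp
      (tensorRight G (tensorRight G P.left.coact)) : _ →* _) P.left.reassoc)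
    (r3 := Units.map ((tensorRight G (leg132 γ)).comp
      (tensorRight G (tensorRight G P.right.coact)) : _ →* _) P.left.reassoc)
    (c := leg₁ G A C) (T₂ := (1 : G) ⊗ₜ leg13 G A T) (T₃ := (1 : G) ⊗ₜ ((1 : G) ⊗ₜ T))
    (dC := leg₁₂ G A (tensorSplit H.comul A C)) (dT := (1 : G) ⊗ₜ tensorSplit H.comul A T)
    (X₁ := D₁ (tensorSplit H.comul A C)) (X₂ := D₂ (tensorSplit H.comul A C))
    (by exact leg₁_intertwine hC _) (by exact one_tmul_leg13_intertwine hT _)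
    (by exact one_tmul_one_tmul_intertwine hT _)
    (by exact e₁) (by exact e₂) (by exact e₃) (by exact tensorSplit_tensorSplit C)
    (by exact Units.ext p₁) (by exact Units.ext p₂) (by exact Units.ext p₃)
    (by exact Units.ext p₄)
  refine Eq.trans ?_ key
  congr 1
  change J _ = _
  simp only [map_mul]
  rfl

end Coherence

/-! ### Solving the coherence equation from a canonical tensor -/

section BlockModel

variable {G M A : Type*} [Ring G] [Algebra ℂ G] [Ring M] [Algebra ℂ M] [Ring A] [Algebra ℂ A]
  {H : QuasiHopfAlgebra G}

/-- An element `R` of `G ⊗ A` behaving like the canonical tensor of `G ⊗ Hom(G ⊗ N, N)` in the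
endomorphisms of `N ⊕ (G ⊗ N)`, with `e` the projection to `G ⊗ N`. -/
structure BlockModel (P : QuasiCommutingPair H.toQuasiBialgebra M) (γ : M →ₐ[ℂ] A) where
  e : A
  R : G ⊗[ℂ] A
  j : G ⊗[ℂ] A →ₗ[ℂ] A
  e_comm : ∀ m, e * γ m = γ m * e
  e_mul_j : ∀ Y, e * j Y = j Y
  R_mul_e : R * ((1 : G) ⊗ₜ e) = R
  e_mul_R : ((1 : G) ⊗ₜ e) * R = 0
  R_mul_j : ∀ Y, R * ((1 : G) ⊗ₜ j Y) = ((1 : G) ⊗ₜ (1 - e)) * Y * ((1 : G) ⊗ₜ e)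
  j_R_mul : ∀ a, j (R * ((1 : G) ⊗ₜ a)) = e * a
  R_mul : ∀ m, R * ((1 : G) ⊗ₜ γ m) =
    conj H.antipode (rhoA P γ) Algebra.TensorProduct.includeLeft (P.left.coact m) R

/-- `x ⊗ y ⊗ a ↦ y ⊗ j(x ⊗ a)`. -/
def liftJ {X : Type*} [AddCommGroup X] [Module ℂ X] {N : Type*} [AddCommGroup N] [Module ℂ N]
    (j : X ⊗[ℂ] N →ₗ[ℂ] N) (Y : Type*) [AddCommGroup Y] [Module ℂ Y] :
    X ⊗[ℂ] (Y ⊗[ℂ] N) →ₗ[ℂ] Y ⊗[ℂ] N :=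
  j.lTensor Y ∘ₗ (TensorProduct.leftComm ℂ X Y N).toLinearMap

@[simp] theorem liftJ_tmul {X : Type*} [AddCommGroup X] [Module ℂ X] {N : Type*} [AddCommGroup N]
    [Module ℂ N] (j : X ⊗[ℂ] N →ₗ[ℂ] N) {Y : Type*} [AddCommGroup Y] [Module ℂ Y]
    (x : X) (y : Y) (n : N) : liftJ j Y (x ⊗ₜ (y ⊗ₜ n)) = y ⊗ₜ j (x ⊗ₜ n) := by
  simp [liftJ]

/-- `liftJ` undoes left multiplication by `R¹³`, up to the projection. Stated over an arbitrary
algebra so that it can be iterated when there is one more leg, as in `cancel₃`. -/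
theorem liftJ_mul {N : Type*} [Ring N] [Algebra ℂ N] {j : G ⊗[ℂ] N →ₗ[ℂ] N} {R : G ⊗[ℂ] N} {e : N}
    (h : ∀ a, j (R * ((1 : G) ⊗ₜ a)) = e * a) (Z : G ⊗[ℂ] N) :
    liftJ j G (leg13 G N R * ((1 : G) ⊗ₜ Z)) = ((1 : G) ⊗ₜ e) * Z := by
  induction Z using tensor_induction with
  | add a b ha hb => simp only [TensorProduct.tmul_add, mul_add, map_add, ha, hb]
  | tmul y a =>
    rw [Algebra.TensorProduct.tmul_mul_tmul, one_mul, ← h]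
    generalize R = Q
    induction Q using tensor_induction with
    | add a b ha hb => simp only [TensorProduct.tmul_add, add_mul, map_add, ha, hb]
    | tmul => simp

theorem mul_liftJ {N : Type*} [Ring N] [Algebra ℂ N] {j : G ⊗[ℂ] N →ₗ[ℂ] N} {R : G ⊗[ℂ] N}
    {e₁ e₂ : N} (h : ∀ Y, R * ((1 : G) ⊗ₜ j Y) = ((1 : G) ⊗ₜ e₁) * Y * ((1 : G) ⊗ₜ e₂))
    (Y : G ⊗[ℂ] (G ⊗[ℂ] N)) :
    leg13 G N R * ((1 : G) ⊗ₜ liftJ j G Y) =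
      ((1 : G) ⊗ₜ ((1 : G) ⊗ₜ e₁)) * Y * ((1 : G) ⊗ₜ ((1 : G) ⊗ₜ e₂)) := by
  induction Y using tensor_induction₃ with
  | add a b ha hb => simp only [TensorProduct.tmul_add, mul_add, add_mul, map_add, ha, hb]
  | tmul x y a =>
    have h₁ : leg13 G N R * ((1 : G) ⊗ₜ (y ⊗ₜ j (x ⊗ₜ a))) =
        leg13 G N (R * ((1 : G) ⊗ₜ j (x ⊗ₜ a))) * ((1 : G) ⊗ₜ (y ⊗ₜ (1 : N))) := by
      rw [map_mul, mul_assoc]; simp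
    rw [liftJ_tmul, h₁, h]
    simp

namespace BlockModel

variable {P : QuasiCommutingPair H.toQuasiBialgebra M} {γ : M →ₐ[ℂ] A} (B : BlockModel P γ)

theorem cancel {a b : A} (h : B.R * ((1 : G) ⊗ₜ a) = B.R * ((1 : G) ⊗ₜ b)) :
    B.e * a = B.e * b := by
  rw [← B.j_R_mul, h, B.j_R_mul]

theorem cancel₂ {a b : G ⊗[ℂ] A}
    (h : leg13 G A B.R * ((1 : G) ⊗ₜ a) = leg13 G A B.R * ((1 : G) ⊗ₜ b)) :
    ((1 : G) ⊗ₜ B.e) * a = ((1 : G) ⊗ₜ B.e) * b := by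
  rw [← liftJ_mul B.j_R_mul, h, liftJ_mul B.j_R_mul]

theorem leg13_leg13 {N : Type*} [Ring N] [Algebra ℂ N] (t : G ⊗[ℂ] N) :
    leg13 G (G ⊗[ℂ] N) (leg13 G N t) = leg₁ G N t := by
  induction t using tensor_induction with
  | add a b ha hb => simp only [map_add, ha, hb]
  | tmul => simp

theorem cancel₃ {a b : G ⊗[ℂ] (G ⊗[ℂ] A)}
    (h : leg₁ G A B.R * ((1 : G) ⊗ₜ a) = leg₁ G A B.R * ((1 : G) ⊗ₜ b)) :
    ((1 : G) ⊗ₜ ((1 : G) ⊗ₜ B.e)) * a = ((1 : G) ⊗ₜ ((1 : G) ⊗ₜ B.e)) * b := by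
  rw [← leg13_leg13] at h
  rw [← liftJ_mul (liftJ_mul B.j_R_mul), h, liftJ_mul (liftJ_mul B.j_R_mul)]

theorem e_comm_tensor (t : G ⊗[ℂ] M) :
    Commute ((1 : G) ⊗ₜ[ℂ] B.e) (tensorRight G γ t) := by
  induction t using tensor_induction with
  | add a b ha hb => rw [map_add]; exact ha.add_right hb
  | tmul x m => simp [Commute, SemiconjBy, B.e_comm]

theorem e_comm_tensor₂ (t : G ⊗[ℂ] (G ⊗[ℂ] M)) :
    Commute ((1 : G) ⊗ₜ[ℂ] ((1 : G) ⊗ₜ[ℂ] B.e)) (tensorRight G (tensorRight G γ) t) := by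
  induction t using tensor_induction with
  | add a b ha hb => rw [map_add]; exact ha.add_right hb
  | tmul x m => simp [Commute, SemiconjBy, (B.e_comm_tensor m).eq]

theorem commute_conj {N N' : Type*} [Ring N] [Algebra ℂ N] [Ring N'] [Algebra ℂ N']
    {S : G ≃ₐ[ℂ] Gᵐᵒᵖ} {a : N →ₐ[ℂ] N'} {s : G →ₐ[ℂ] N'} {x : N'}
    (ha : ∀ n, Commute x (a n)) (Y : G ⊗[ℂ] N) (Z : N') :
    x * conj S a s Y Z = conj S a s Y (x * Z) := by
  induction Y using tensor_induction with
  | add a b ha hb => simp only [map_add, LinearMap.add_apply, mul_add, ha, hb]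
  | tmul u v => simp only [conj_tmul, ← mul_assoc, (ha v).eq]

theorem conj_conj_inv {N N' : Type*} [Ring N] [Algebra ℂ N] [Ring N'] [Algebra ℂ N']
    {S : G ≃ₐ[ℂ] Gᵐᵒᵖ} {a : N →ₐ[ℂ] N'} {s : G →ₐ[ℂ] N'} (u : (G ⊗[ℂ] N)ˣ) (Z : N') :
    conj S a s (u : G ⊗[ℂ] N) (conj S a s ((u⁻¹ : (G ⊗[ℂ] N)ˣ) : G ⊗[ℂ] N) Z) = Z := by
  rw [← Module.End.mul_apply, ← map_mul, Units.mul_inv, map_one, Module.End.one_apply]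

theorem conj_inv_conj {N N' : Type*} [Ring N] [Algebra ℂ N] [Ring N'] [Algebra ℂ N']
    {S : G ≃ₐ[ℂ] Gᵐᵒᵖ} {a : N →ₐ[ℂ] N'} {s : G →ₐ[ℂ] N'} (u : (G ⊗[ℂ] N)ˣ) (Z : N') :
    conj S a s ((u⁻¹ : (G ⊗[ℂ] N)ˣ) : G ⊗[ℂ] N) (conj S a s (u : G ⊗[ℂ] N) Z) = Z := by
  rw [← Module.End.mul_apply, ← map_mul, Units.inv_mul, map_one, Module.End.one_apply]

theorem e_comm_rhoA (m : M) : Commute ((1 : G) ⊗ₜ[ℂ] B.e) (rhoA P γ m) := B.e_comm_tensor _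

theorem e_comm_leg312 (t : M ⊗[ℂ] (G ⊗[ℂ] G)) :
    Commute ((1 : G) ⊗ₜ[ℂ] ((1 : G) ⊗ₜ[ℂ] B.e)) (leg312 γ t) := by
  rw [leg312_eq]; exact B.e_comm_tensor₂ _

theorem e_comm_rhoTwo (t : M ⊗[ℂ] G) :
    Commute ((1 : G) ⊗ₜ[ℂ] ((1 : G) ⊗ₜ[ℂ] B.e)) (rhoTwo P γ t) := B.e_comm_leg312 _

theorem e_comm_tensorRight_lamA (t : G ⊗[ℂ] M) :
    Commute ((1 : G) ⊗ₜ[ℂ] ((1 : G) ⊗ₜ[ℂ] B.e)) (tensorRight G (lamA P γ) t) := by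
  rw [lamA, ← tensorRight_tensorRight]; exact B.e_comm_tensor₂ _

/-- The intertwiner with `C p_λ = R`. -/
def C : G ⊗[ℂ] A :=
  conj H.antipode (rhoA P γ) Algebra.TensorProduct.includeLeft
    (leftAntipodeCoaction H P.left).q B.R

theorem isIntertwiner_C : IsIntertwiner P γ B.C :=
  tensor_conj_q_mul (isStraightening_left P) B.R B.R_mul

theorem C_mul_p : B.C * tensorRight G γ (pLambda H P.left) = B.R :=
  tensor_conj_q_mul_p (isStraightening_left P) B.R B.R_mul

theorem C_mul_e : B.C * ((1 : G) ⊗ₜ B.e) = B.C := by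
  rw [C, ← conj_mul _ _ _ _ _ fun x => commute_includeLeft_one_tmul x B.e, B.R_mul_e]

theorem e_mul_C : ((1 : G) ⊗ₜ B.e) * B.C = 0 := by
  rw [C, commute_conj B.e_comm_rhoA, B.e_mul_R, map_zero]

theorem reducedComul_mul_e :
    reducedComul P γ B.C * ((1 : G) ⊗ₜ ((1 : G) ⊗ₜ B.e)) = reducedComul P γ B.C := by
  rw [reducedComul, mul_assoc, ← (B.e_comm_tensor₂ _).eq, ← mul_assoc, mul_assoc (leg312 γ _),
    ← tensorSplit_one_tmul H.comul, ← map_mul, B.C_mul_e]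

theorem e_mul_reducedComul :
    ((1 : G) ⊗ₜ ((1 : G) ⊗ₜ B.e)) * reducedComul P γ B.C = 0 := by
  rw [reducedComul, ← mul_assoc, ← mul_assoc, (B.e_comm_leg312 _).eq, mul_assoc (leg312 γ _),
    ← tensorSplit_one_tmul H.comul, ← map_mul, B.e_mul_C, map_zero, mul_zero, zero_mul]

/-- The value of `R¹³ T²³`. -/
def K : G ⊗[ℂ] (G ⊗[ℂ] A) :=
  conj H.antipode (rhoTwo P γ) Algebra.TensorProduct.includeLeft
    ((P.mixed⁻¹ : (G ⊗[ℂ] (M ⊗[ℂ] G))ˣ) : G ⊗[ℂ] (M ⊗[ℂ] G))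
    (reducedComul P γ B.C * tensorRight G (lamA P γ) (pLambda H P.left))

theorem K_mul_e : B.K * ((1 : G) ⊗ₜ ((1 : G) ⊗ₜ B.e)) = B.K := by
  rw [K, ← conj_mul _ _ _ _ _ fun x => commute_includeLeft_one_tmul x _, mul_assoc,
    ← (B.e_comm_tensorRight_lamA _).eq, ← mul_assoc, B.reducedComul_mul_e]

theorem e_mul_K : ((1 : G) ⊗ₜ ((1 : G) ⊗ₜ B.e)) * B.K = 0 := by
  rw [K, commute_conj B.e_comm_rhoTwo, ← mul_assoc, B.e_mul_reducedComul, zero_mul, map_zero]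

/-- The intertwiner of the block model. -/
def T : G ⊗[ℂ] A := liftJ B.j G B.K

/-- By `e_mul_K` and `K_mul_e`, `K` lies in the corner `(1 - e) · e`, where `liftJ` is also a right
inverse of multiplication by `R¹³`. The equation for `T` is therefore solvable. -/
theorem leg13_R_mul_T : leg13 G A B.R * ((1 : G) ⊗ₜ B.T) = B.K := by
  rw [T, mul_liftJ B.R_mul_j, TensorProduct.tmul_sub, TensorProduct.tmul_sub, sub_mul, sub_mul,
    B.e_mul_K, zero_mul, sub_zero, mul_assoc, B.K_mul_e]
  simp [← Algebra.TensorProduct.one_def]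

theorem e_mul_T : ((1 : G) ⊗ₜ B.e) * B.T = B.T := by
  rw [T]
  induction B.K using tensor_induction₃ with
  | add a b ha hb => simp only [map_add, mul_add, ha, hb]
  | tmul => simp [B.e_mul_j]

theorem leg13_mul_one_tmul {R : G ⊗[ℂ] A} (hR : ∀ m, R * ((1 : G) ⊗ₜ γ m) =
    conj H.antipode (rhoA P γ) Algebra.TensorProduct.includeLeft (P.left.coact m) R)
    (y : M ⊗[ℂ] G) :
    leg13 G A R * ((1 : G) ⊗ₜ tensorRight G γ (Algebra.TensorProduct.comm ℂ M G y)) =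
      conj H.antipode (rhoTwo P γ) Algebra.TensorProduct.includeLeft
        (tensorSplit P.left.coact G y) (leg13 G A R) := by
  induction y using tensor_induction with
  | add a b ha hb => simp only [TensorProduct.tmul_add, mul_add, map_add, ha, hb,
      LinearMap.add_apply]
  | tmul m h =>
    have h₁ : leg13 G A R * ((1 : G) ⊗ₜ (h ⊗ₜ γ m)) =
        leg13 G A (R * ((1 : G) ⊗ₜ γ m)) * ((1 : G) ⊗ₜ (h ⊗ₜ (1 : A))) := by
      rw [map_mul, mul_assoc]; simp
    rw [Algebra.TensorProduct.comm_tmul, tensorRight_tmul, h₁, hR, tensorSplit_tmul]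
    generalize P.left.coact m = u
    induction u using tensor_induction with
    | add a b ha hb => simp only [TensorProduct.add_tmul, add_mul, map_add, ha, hb,
        LinearMap.add_apply]
    | tmul x n =>
      rw [Algebra.TensorProduct.assoc_tmul, conj_tmul, conj_tmul, rhoTwo_tmul, map_mul, map_mul]
      simp only [mul_assoc, ← leg13_mul_middle R h]
      simp

theorem isIntertwiner_T : IsIntertwiner P γ B.T := fun m => by
  have h₁ : ((1 : G) ⊗ₜ B.e) * (B.T * lamA P γ m) = B.T * lamA P γ m := by
    rw [← mul_assoc, B.e_mul_T]
  have h₂ : ((1 : G) ⊗ₜ B.e) * (rhoA P γ m * B.T) = rhoA P γ m * B.T := by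
    rw [← mul_assoc, (B.e_comm_rhoA m).eq, mul_assoc, B.e_mul_T]
  rw [← h₁, ← h₂]
  -- Both sides are fixed by `e`, so they may be compared after `R¹³`, where `R¹³ T²³ = K`. The
  -- behaviour of `K` under `M` comes from the straightened coproduct of `C`, and quasi-commutation
  -- identifies the two resulting actions.
  refine B.cancel₂ ?_
  have h : ((P.mixed⁻¹ : (G ⊗[ℂ] (M ⊗[ℂ] G))ˣ) : G ⊗[ℂ] (M ⊗[ℂ] G)) *
      tensorRight G P.right.coact (P.left.coact m) =
      tensorSplit P.left.coact G (P.right.coact m) *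
        ((P.mixed⁻¹ : (G ⊗[ℂ] (M ⊗[ℂ] G))ˣ) : G ⊗[ℂ] (M ⊗[ℂ] G)) := by
    rw [Units.inv_mul_eq_iff_eq_mul, ← mul_assoc, P.intertwine, Units.mul_inv_cancel_right]
  have hU := tensor_straighten_mul_right (a := (rhoTwo P γ).comp P.right.coact)
    (isStraightening_left P) (reducedComul P γ B.C)
    (reducedComul_intertwine B.isIntertwiner_C) m
  have e₁ : ((1 : G) ⊗ₜ[ℂ] (B.T * lamA P γ m)) =
      ((1 : G) ⊗ₜ[ℂ] B.T) * ((1 : G) ⊗ₜ[ℂ] lamA P γ m) := by simp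
  have e₂ : ((1 : G) ⊗ₜ[ℂ] (rhoA P γ m * B.T)) =
      ((1 : G) ⊗ₜ[ℂ] rhoA P γ m) * ((1 : G) ⊗ₜ[ℂ] B.T) := by simp
  rw [e₁, e₂, ← mul_assoc, ← mul_assoc, B.leg13_R_mul_T]
  have h₃ : leg13 G A B.R * ((1 : G) ⊗ₜ rhoA P γ m) = _ :=
    leg13_mul_one_tmul B.R_mul (P.right.coact m)
  rw [h₃, ← conj_mul _ _ _ _ _ fun x => commute_includeLeft_one_tmul x _, B.leg13_R_mul_T]
  rw [K, ← conj_mul _ _ _ _ _ fun x => commute_includeLeft_one_tmul x _, hU,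
    ← conj_tensorRight, ← Module.End.mul_apply, ← Module.End.mul_apply, ← map_mul, ← map_mul, h]

/-- Both sides satisfy the same intertwining relation, hence are determined by their products with
`p_λ`. `K` was chosen so that these products agree. -/
theorem legProduct_C_T : legProduct P γ B.C B.T = reducedComul P γ B.C := by
  have h₁ := tensor_conj_straighten (a := (rhoTwo P γ).comp P.right.coact)
    (isStraightening_left P) (reducedComul P γ B.C)
    (reducedComul_intertwine B.isIntertwiner_C)
  have h₂ := tensor_conj_straighten (a := (rhoTwo P γ).comp P.right.coact)
    (isStraightening_left P) (legProduct P γ B.C B.T)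
    (legProduct_intertwine B.isIntertwiner_C B.isIntertwiner_T)
  rw [← h₁, ← h₂, legProduct_mul_pLambda B.isIntertwiner_C B.isIntertwiner_T, B.C_mul_p,
    B.leg13_R_mul_T, K, conj_conj_inv]

end BlockModel

end BlockModel

/-! ### Counits of the coherence equation -/

section Counits

variable {G M A : Type*} [Ring G] [Algebra ℂ G] [Ring M] [Algebra ℂ M] [Ring A] [Algebra ℂ A]
  {H : QuasiHopfAlgebra G} {P : QuasiCommutingPair H.toQuasiBialgebra M} {γ : M →ₐ[ℂ] A}

theorem killLeft_tensorRight {N N' : Type*} [Ring N] [Algebra ℂ N] [Ring N'] [Algebra ℂ N']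
    (ε : G →ₐ[ℂ] ℂ) (f : N →ₐ[ℂ] N') (t : G ⊗[ℂ] N) :
    killLeft ε N' (tensorRight G f t) = f (killLeft ε N t) := by
  induction t using tensor_induction with
  | add a b ha hb => simp only [map_add, ha, hb]
  | tmul => simp

theorem killLeft_lamA (m : M) : killLeft H.counit A (lamA P γ m) = γ m := by
  rw [lamA, AlgHom.comp_apply, killLeft_tensorRight, P.left.counit_coact]

theorem killLeft_rhoA (m : M) : killLeft H.counit A (rhoA P γ m) = γ m := by
  rw [rhoA, AlgHom.comp_apply, killLeft_tensorRight, coactFlip_apply]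
  rw [killLeft_comm, P.right.counit_coact]

theorem commute_killLeft {T : G ⊗[ℂ] A} (hT : IsIntertwiner P γ T) (m : M) :
    Commute (killLeft H.counit A T) (γ m) := by
  have h := congrArg (killLeft H.counit A) (hT m)
  rwa [map_mul, map_mul, killLeft_lamA, killLeft_rhoA] at h

theorem commute_one_tmul_tensorRight {a : A} (h : ∀ m, Commute a (γ m)) (t : G ⊗[ℂ] M) :
    Commute ((1 : G) ⊗ₜ[ℂ] a) (tensorRight G γ t) := by
  induction t using tensor_induction with
  | add a b ha hb => rw [map_add]; exact ha.add_right hb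
  | tmul x m => simp [Commute, SemiconjBy, (h m).eq]

theorem killLeft_leg13 (ε : G →ₐ[ℂ] ℂ) (t : G ⊗[ℂ] A) :
    killLeft ε (G ⊗[ℂ] A) (leg13 G A t) = (1 : G) ⊗ₜ killLeft ε A t := by
  induction t using tensor_induction with
  | add a b ha hb => simp only [map_add, TensorProduct.tmul_add, ha, hb]
  | tmul => simp

theorem tensorRight_killLeft_leg13 (ε : G →ₐ[ℂ] ℂ) (t : G ⊗[ℂ] A) :
    tensorRight G (killLeft ε A) (leg13 G A t) = t := by
  induction t using tensor_induction with
  | add a b ha hb => simp only [map_add, ha, hb]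
  | tmul => simp

theorem tensorRight_killLeft_leg132 (ε : G →ₐ[ℂ] ℂ) (t : G ⊗[ℂ] (M ⊗[ℂ] G)) :
    tensorRight G (killLeft ε A) (leg132 γ t) =
      tensorRight G γ (tensorRight G (killRight M ε) t) := by
  induction t using tensor_induction₃ with
  | add a b ha hb => simp only [map_add, ha, hb]
  | tmul => simp

theorem killLeft_leg132 (ε : G →ₐ[ℂ] ℂ) (t : G ⊗[ℂ] (M ⊗[ℂ] G)) :
    killLeft ε (G ⊗[ℂ] A) (leg132 γ t) = tensorRight G γ
      (Algebra.TensorProduct.comm ℂ M G (killLeft ε (M ⊗[ℂ] G) t)) := by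
  induction t using tensor_induction₃ with
  | add a b ha hb => simp only [map_add, ha, hb]
  | tmul => simp

theorem tensorRight_killLeft_leg312 (ε : G →ₐ[ℂ] ℂ) (t : M ⊗[ℂ] (G ⊗[ℂ] G)) :
    tensorRight G (killLeft ε A) (leg312 γ t) = tensorRight G γ
      (Algebra.TensorProduct.comm ℂ M G (tensorRight M (killRight G ε) t)) := by
  induction t using tensor_induction₃ with
  | add a b ha hb => simp only [map_add, ha, hb]
  | tmul => simp

theorem killLeft_leg312 (ε : G →ₐ[ℂ] ℂ) (t : M ⊗[ℂ] (G ⊗[ℂ] G)) :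
    killLeft ε (G ⊗[ℂ] A) (leg312 γ t) = tensorRight G γ
      (Algebra.TensorProduct.comm ℂ M G (tensorRight M (killLeft ε G) t)) := by
  induction t using tensor_induction₃ with
  | add a b ha hb => simp only [map_add, ha, hb]
  | tmul => simp [TensorProduct.smul_tmul']

theorem tensorRight_killLeft_tensorRight (ε : G →ₐ[ℂ] ℂ) (t : G ⊗[ℂ] (G ⊗[ℂ] M)) :
    tensorRight G (killLeft ε A) (tensorRight G (tensorRight G γ) t) =
      tensorRight G γ (tensorRight G (killLeft ε M) t) := by
  induction t using tensor_induction₃ with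
  | add a b ha hb => simp only [map_add, ha, hb]
  | tmul => simp

theorem killLeft_tensorSplit {N : Type*} [Ring N] [Algebra ℂ N] (Δ : G →ₐ[ℂ] G ⊗[ℂ] G)
    (ε : G →ₐ[ℂ] ℂ) (h : ∀ x, killLeft ε G (Δ x) = x) (t : G ⊗[ℂ] N) :
    killLeft ε (G ⊗[ℂ] N) (tensorSplit Δ N t) = t :=
  tensorRight_killLeft_tensorSplit ε Δ h t

theorem tensorRight_killLeft_legProduct (C T : G ⊗[ℂ] A) :
    tensorRight G (killLeft H.counit A) (legProduct P γ C T) =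
      C * ((1 : G) ⊗ₜ killLeft H.counit A T) := by
  rw [legProduct, map_mul, map_mul, tensorRight_killLeft_leg13, tensorRight_killLeft_leg132,
    map_inv_eq_one _ _ (tensorRight_killRight_mixed P), map_one, mul_one, tensorRight_tmul]

theorem killLeft_legProduct (C T : G ⊗[ℂ] A) :
    killLeft H.counit (G ⊗[ℂ] A) (legProduct P γ C T) =
      ((1 : G) ⊗ₜ killLeft H.counit A C) * T := by
  rw [legProduct, map_mul, map_mul, killLeft_leg13, killLeft_leg132,
    map_inv_eq_one _ _ (killLeft_mixed P), map_one, map_one, mul_one]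
  simp

theorem tensorRight_killLeft_reducedComul (C : G ⊗[ℂ] A) :
    tensorRight G (killLeft H.counit A) (reducedComul P γ C) = C := by
  rw [reducedComul, map_mul, map_mul, tensorRight_killLeft_leg312,
    map_inv_eq_one _ _ P.right.counit_reassoc_right, map_one, map_one, one_mul,
    tensorRight_killLeft_tensorSplit_comul _ _ H.counit_right, tensorRight_killLeft_tensorRight,
    map_inv_eq_one _ _ P.left.counit_reassoc_middle, map_one, mul_one]

theorem killLeft_reducedComul (C : G ⊗[ℂ] A) :
    killLeft H.counit (G ⊗[ℂ] A) (reducedComul P γ C) = C := by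
  rw [reducedComul, map_mul, map_mul, killLeft_leg312,
    map_inv_eq_one _ _ P.right.counit_reassoc_middle, map_one, map_one, one_mul,
    killLeft_tensorSplit _ _ H.counit_left, killLeft_tensorRight,
    map_inv_eq_one _ _ P.left.counit_reassoc_left, map_one, mul_one]

end Counits

/-! ### Normality and coherence of the block intertwiner -/

namespace BlockModel

variable {G M A : Type*} [Ring G] [Algebra ℂ G] [Ring M] [Algebra ℂ M] [Ring A] [Algebra ℂ A]
  {H : QuasiHopfAlgebra G} {P : QuasiCommutingPair H.toQuasiBialgebra M} {γ : M →ₐ[ℂ] A}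
  (B : BlockModel P γ)

/-- The counit on the second leg of the defining equation of `T` gives `C (1 ⊗ (ε ⊗ id)(T)) = C`;
multiplying by `p_λ` turns `C` into `R`, which cancels. The value is `e` and not `1`: normality
holds only in the lower corner. -/
theorem killLeft_T : killLeft H.counit A B.T = B.e := by
  have h := congrArg (tensorRight G (killLeft H.counit A)) B.legProduct_C_T
  rw [tensorRight_killLeft_legProduct, tensorRight_killLeft_reducedComul] at h
  have h₁ : B.R * ((1 : G) ⊗ₜ killLeft H.counit A B.T) = B.R * ((1 : G) ⊗ₜ (1 : A)) := by
    rw [← B.C_mul_p, mul_assoc,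
      ← (commute_one_tmul_tensorRight (commute_killLeft B.isIntertwiner_T) _).eq, ← mul_assoc, h,
      ← Algebra.TensorProduct.one_def, mul_one]
  have h₂ := B.cancel h₁
  have h₃ := congrArg (killLeft H.counit A) B.e_mul_T
  rw [map_mul, killLeft_tmul, map_one, one_smul, h₂, mul_one] at h₃
  exact h₃.symm

/-- The counit on the first leg. In the coinduced picture `(ε ⊗ id)(C)` is evaluation at `1`, and
`C` is `T` followed by that evaluation. -/
theorem killLeft_C_mul_T : ((1 : G) ⊗ₜ killLeft H.counit A B.C) * B.T = B.C := by
  have h := congrArg (killLeft H.counit (G ⊗[ℂ] A)) B.legProduct_C_T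
  rwa [killLeft_legProduct, killLeft_reducedComul] at h

/-- `legProduct_mul_pLambda` with one more leg. It turns `C` into the cancellable `R` for any `Z`
with the stated intertwining relation, so it serves both sides of the coherence equation. -/
theorem leg₁_C_mul (Z : G ⊗[ℂ] (G ⊗[ℂ] A))
    (hZ : ∀ m, Z * tensorSplit H.comul A (lamA P γ m) =
      tensorSplit H.comul A (rhoA P γ m) * Z) :
    leg₁ G A B.C * tensorRight G (tensorSplit H.comul A)
        (leg132 γ ((P.mixed⁻¹ : (G ⊗[ℂ] (M ⊗[ℂ] G))ˣ) : G ⊗[ℂ] (M ⊗[ℂ] G))) *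
        ((1 : G) ⊗ₜ Z) * tensorRight G (tensorSplit H.comul A)
          (tensorRight G (lamA P γ) (pLambda H P.left)) =
      conj H.antipode ((tensorRight G (tensorSplit H.comul A)).comp (rhoTwo P γ))
        ((tensorRight G (tensorSplit H.comul A)).comp Algebra.TensorProduct.includeLeft)
        (P.mixed : G ⊗[ℂ] (M ⊗[ℂ] G)) (leg₁ G A B.R * ((1 : G) ⊗ₜ Z)) := by
  have h₁ : ∀ t : G ⊗[ℂ] M, ((1 : G) ⊗ₜ Z) * tensorRight G (tensorSplit H.comul A)
      (tensorRight G (lamA P γ) t) = tensorRight G (tensorSplit H.comul A)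
      (tensorRight G (rhoA P γ) t) * ((1 : G) ⊗ₜ Z) := fun t => by
    induction t using tensor_induction with
    | add a b ha hb => simp only [map_add, add_mul, mul_add, ha, hb]
    | tmul x m => simp [hZ m]
  rw [mul_assoc, h₁, ← mul_assoc, mul_assoc (leg₁ G A B.C), ← map_mul, ← leg132_tensorRight,
    ← map_mul, mixed_inv_mul_pLambda, ← tensorRight_tensorSplit_leg13 (Δ := H.comul), ← map_mul,
    leg13_mul_leg132_conj B.isIntertwiner_C, map_conj, B.C_mul_p, tensorRight_tensorSplit_leg13,
    conj_mul]
  intro x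
  simp [Commute, SemiconjBy]

/-- `leg₁_mul_coherence` gives the equation only behind `C`. Multiplication by the coproduct of
`p_λ` exchanges `C` for `R`, the action of `φ_λρ` is inverted, and `R` cancels because both sides
are fixed by `e`. -/
theorem legProduct_T_T :
    leg312 γ (P.right.reassoc : M ⊗[ℂ] (G ⊗[ℂ] G)) * leg13 G A B.T *
        leg132 γ ((P.mixed⁻¹ : (G ⊗[ℂ] (M ⊗[ℂ] G))ˣ) : G ⊗[ℂ] (M ⊗[ℂ] G)) *
        ((1 : G) ⊗ₜ[ℂ] B.T) *
        tensorRight G (tensorRight G γ) (P.left.reassoc : G ⊗[ℂ] (G ⊗[ℂ] M)) =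
      tensorSplit H.comul A B.T := by
  have key := leg₁_mul_coherence B.isIntertwiner_C B.isIntertwiner_T B.legProduct_C_T
  set X := leg312 γ (P.right.reassoc : M ⊗[ℂ] (G ⊗[ℂ] G)) * leg13 G A B.T *
        leg132 γ ((P.mixed⁻¹ : (G ⊗[ℂ] (M ⊗[ℂ] G))ˣ) : G ⊗[ℂ] (M ⊗[ℂ] G)) *
        ((1 : G) ⊗ₜ[ℂ] B.T) *
        tensorRight G (tensorRight G γ) (P.left.reassoc : G ⊗[ℂ] (G ⊗[ℂ] M)) with hX
  have hX' : X = leg312 γ (P.right.reassoc : M ⊗[ℂ] (G ⊗[ℂ] G)) * legProduct P γ B.T B.T *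
      tensorRight G (tensorRight G γ) (P.left.reassoc : G ⊗[ℂ] (G ⊗[ℂ] M)) := by
    rw [hX, legProduct]; simp only [mul_assoc]
  have iX : ∀ m, X * tensorSplit H.comul A (lamA P γ m) =
      tensorSplit H.comul A (rhoA P γ m) * X := fun m => by
    have h₁ : tensorSplit H.comul A (lamA P γ m) =
        tensorRight G (tensorRight G γ) (tensorSplit H.comul M (P.left.coact m)) :=
      tensorSplit_tensorRight _ _
    have h₂ : tensorSplit H.comul A (rhoA P γ m) =
        leg312 γ (tensorRight M H.comul (P.right.coact m)) := leg312_tensorRight _ _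
    have h₃ := legProduct_intertwine B.isIntertwiner_T B.isIntertwiner_T m
    rw [lamA, ← tensorRight_tensorRight] at h₃
    rw [hX', h₁, h₂, mul_assoc, ← map_mul, ← P.left.intertwine, map_mul, ← mul_assoc,
      mul_assoc (leg312 γ _), h₃, rhoTwo, AlgHom.comp_apply, ← mul_assoc, ← map_mul,
      P.right.intertwine, map_mul]
    simp only [mul_assoc]
  have iY : ∀ m, tensorSplit H.comul A B.T * tensorSplit H.comul A (lamA P γ m) =
      tensorSplit H.comul A (rhoA P γ m) * tensorSplit H.comul A B.T := fun m => by
    rw [← map_mul, ← map_mul, B.isIntertwiner_T]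
  have h := congrArg (· * tensorRight G (tensorSplit H.comul A)
    (tensorRight G (lamA P γ) (pLambda H P.left))) key
  simp only [B.leg₁_C_mul _ iX, B.leg₁_C_mul _ iY] at h
  have h' := congrArg (conj H.antipode
    ((tensorRight G (tensorSplit H.comul A)).comp (rhoTwo P γ))
    ((tensorRight G (tensorSplit H.comul A)).comp Algebra.TensorProduct.includeLeft)
    ((P.mixed⁻¹ : (G ⊗[ℂ] (M ⊗[ℂ] G))ˣ) : G ⊗[ℂ] (M ⊗[ℂ] G))) h
  rw [conj_inv_conj, conj_inv_conj] at h'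
  have h'' := B.cancel₃ h'
  have eX : ((1 : G) ⊗ₜ[ℂ] ((1 : G) ⊗ₜ[ℂ] B.e)) * X = X := by
    have : ((1 : G) ⊗ₜ[ℂ] ((1 : G) ⊗ₜ[ℂ] B.e)) * leg13 G A B.T = leg13 G A B.T := by
      conv_rhs => rw [← B.e_mul_T, map_mul]
      simp
    rw [hX', legProduct, ← mul_assoc, ← mul_assoc, (B.e_comm_leg312 _).eq,
      mul_assoc (leg312 γ _)]
    simp only [← mul_assoc, this]
  have eY : ((1 : G) ⊗ₜ[ℂ] ((1 : G) ⊗ₜ[ℂ] B.e)) * tensorSplit H.comul A B.T =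
      tensorSplit H.comul A B.T := by
    rw [← tensorSplit_one_tmul H.comul, ← map_mul, B.e_mul_T]
  rwa [eX, eY] at h''

end BlockModel

/-! ### Tensors with prescribed slices -/

section Slices

variable {G A : Type*} [Ring G] [Algebra ℂ G] [Ring A] [Algebra ℂ A]

/-- The linear map `t ↦ (φ ⊗ id)(t)`, depending linearly on `φ`. -/
def sliceHom (V W : Type*) [AddCommGroup V] [Module ℂ V] [AddCommGroup W] [Module ℂ W] :
    Module.Dual ℂ V →ₗ[ℂ] V ⊗[ℂ] W →ₗ[ℂ] W :=
  LinearMap.compRight ℂ (TensorProduct.lid ℂ W).toLinearMap ∘ₗ LinearMap.rTensorHom W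

theorem sliceHom_apply {V W : Type*} [AddCommGroup V] [Module ℂ V] [AddCommGroup W] [Module ℂ W]
    (φ : Module.Dual ℂ V) (t : V ⊗[ℂ] W) : sliceHom V W φ t = sliceLeft t φ := rfl

/-- The tensor in `V ⊗ W` with prescribed slices. -/
noncomputable def tensorOfSlices {V W : Type*} [AddCommGroup V] [Module ℂ V] [AddCommGroup W] [Module ℂ W]
    [FiniteDimensional ℂ V] (F : Module.Dual ℂ V →ₗ[ℂ] W) : V ⊗[ℂ] W :=
  ∑ i, Module.finBasis ℂ V i ⊗ₜ[ℂ] F ((Module.finBasis ℂ V).coord i)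

@[simp] theorem sliceLeft_tensorOfSlices {V W : Type*} [AddCommGroup V] [Module ℂ V]
    [AddCommGroup W] [Module ℂ W] [FiniteDimensional ℂ V] (F : Module.Dual ℂ V →ₗ[ℂ] W) :
    sliceLeft (tensorOfSlices F) = F := by
  ext φ
  rw [tensorOfSlices, ← sliceHom_apply, map_sum]
  simp only [sliceHom_apply, sliceLeft_tmul, ← map_smul, ← map_sum]
  congr 1
  refine (Module.finBasis ℂ V).ext fun j => ?_
  simp

theorem sliceLeft_tmul_mul_mul (h k : G) (a : A) (t : G ⊗[ℂ] A) (φ : Module.Dual ℂ G) :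
    sliceLeft ((h ⊗ₜ a) * t * (k ⊗ₜ (1 : A))) φ =
      a * sliceLeft t (φ ∘ₗ LinearMap.mulLeft ℂ h ∘ₗ LinearMap.mulRight ℂ k) := by
  induction t using tensor_induction with
  | add a b ha hb => simp only [mul_add, add_mul, sliceLeft_add, ha, hb]
  | tmul => simp [mul_assoc]

end Slices

/-! ### Block triangular endomorphisms -/

section Triangular

variable {V W : Type*} [AddCommGroup V] [Module ℂ V] [AddCommGroup W] [Module ℂ W]

/-- The algebra of endomorphisms of `V × W` that preserve `V`. -/
def triangular (V W : Type*) [AddCommGroup V] [Module ℂ V] [AddCommGroup W] [Module ℂ W] :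
    Subalgebra ℂ (Module.End ℂ (V × W)) where
  carrier := {f | ∀ v, (f (v, 0)).2 = 0}
  mul_mem' {f g} hf hg v := by
    rw [Module.End.mul_apply, show g (v, 0) = ((g (v, 0)).1, 0) from Prod.ext rfl (hg v), hf]
  add_mem' {f g} hf hg v := by simp [hf v, hg v]
  algebraMap_mem' c v := by simp [Module.algebraMap_end_apply]

theorem triangular_snd (f : triangular V W) (v : V) (w : W) :
    (f.1 (v, w)).2 = (f.1 (0, w)).2 := by
  have : f.1 (v, w) = f.1 (v, 0) + f.1 (0, w) := by rw [← map_add]; simp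
  rw [this, Prod.snd_add, f.2 v, zero_add]

theorem triangular_ext {f g : triangular V W} (h : ∀ v w, f.1 (v, w) = g.1 (v, w)) : f = g :=
  Subtype.ext (LinearMap.ext fun x => h x.1 x.2)

/-- The block in `Hom(W, V)`. -/
def upperBlock : (W →ₗ[ℂ] V) →ₗ[ℂ] triangular V W where
  toFun h := ⟨LinearMap.inl ℂ V W ∘ₗ h ∘ₗ LinearMap.snd ℂ V W, fun v => rfl⟩
  map_add' _ _ := triangular_ext fun _ _ => by simp
  map_smul' _ _ := triangular_ext fun _ _ => by simp

@[simp] theorem upperBlock_apply (h : W →ₗ[ℂ] V) (x : V × W) :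
    (upperBlock h).1 x = (h x.2, 0) := rfl

/-- The block in `End(W)`. -/
def lowerBlock : Module.End ℂ W →ₗ[ℂ] triangular V W where
  toFun h := ⟨LinearMap.inr ℂ V W ∘ₗ h ∘ₗ LinearMap.snd ℂ V W, fun v => by simp⟩
  map_add' _ _ := triangular_ext fun _ _ => by simp
  map_smul' _ _ := triangular_ext fun _ _ => by simp

@[simp] theorem lowerBlock_apply (h : Module.End ℂ W) (x : V × W) :
    (lowerBlock h : triangular V W).1 x = (0, h x.2) := rfl

/-- The projection to `End(W)`. -/
def corner : triangular V W →ₐ[ℂ] Module.End ℂ W where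
  toFun f := LinearMap.snd ℂ V W ∘ₗ f.1 ∘ₗ LinearMap.inr ℂ V W
  map_one' := LinearMap.ext fun _ => rfl
  map_mul' f g := LinearMap.ext fun w => by
    have := triangular_snd f (g.1 (0, w)).1 (g.1 (0, w)).2
    simpa using this
  map_zero' := LinearMap.ext fun _ => rfl
  map_add' _ _ := LinearMap.ext fun _ => rfl
  commutes' _ := LinearMap.ext fun _ => by simp [Module.algebraMap_end_apply]

@[simp] theorem corner_apply (f : triangular V W) (w : W) : corner f w = (f.1 (0, w)).2 := rfl

/-- Block diagonal endomorphisms. -/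
def blockDiagonal {X : Type*} [Ring X] [Algebra ℂ X] (f : X →ₐ[ℂ] Module.End ℂ V)
    (g : X →ₐ[ℂ] Module.End ℂ W) : X →ₐ[ℂ] triangular V W where
  toFun x := ⟨(f x).prodMap (g x), fun v => by simp⟩
  map_one' := triangular_ext fun _ _ => by simp
  map_mul' _ _ := triangular_ext fun _ _ => by simp
  map_zero' := triangular_ext fun _ _ => by simp
  map_add' _ _ := triangular_ext fun _ _ => by simp
  commutes' _ := triangular_ext fun _ _ => by simp [Module.algebraMap_end_apply]

@[simp] theorem blockDiagonal_apply {X : Type*} [Ring X] [Algebra ℂ X]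
    (f : X →ₐ[ℂ] Module.End ℂ V) (g : X →ₐ[ℂ] Module.End ℂ W) (x : X) (y : V × W) :
    (blockDiagonal f g x).1 y = (f x y.1, g x y.2) := rfl

end Triangular

/-! ### The block model on `M × (G ⊗ M)` -/

section Model

variable {G M : Type*} [Ring G] [Algebra ℂ G] [Ring M] [Algebra ℂ M]
  {H : QuasiHopfAlgebra G} (P : QuasiCommutingPair H.toQuasiBialgebra M)

/-- The action `m · Z = ρ^op(m₍₀₎) Z (S⁻¹(m₍₋₁₎) ⊗ 1)` of `M` on `G ⊗ M`. -/
def tensorAction : M →ₐ[ℂ] Module.End ℂ (G ⊗[ℂ] M) :=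
  (conj H.antipode (coactFlip P.right.coact) Algebra.TensorProduct.includeLeft).comp P.left.coact

/-- The action of `M` on `M × (G ⊗ M)`. -/
def blockAction : M →ₐ[ℂ] triangular M (G ⊗[ℂ] M) :=
  blockDiagonal (Algebra.lmul ℂ M) (tensorAction P)

@[simp] theorem blockAction_apply (m : M) (y : M × (G ⊗[ℂ] M)) :
    (blockAction P m).1 y = (m * y.1, tensorAction P m y.2) := rfl

/-- `x ⊗ f ↦ (w ↦ x ⊗ f(w))`. -/
def tensorLower : G ⊗[ℂ] triangular M (G ⊗[ℂ] M) →ₗ[ℂ] triangular M (G ⊗[ℂ] M) :=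
  TensorProduct.lift (LinearMap.mk₂ ℂ (fun x f => lowerBlock
    (TensorProduct.mk ℂ G M x ∘ₗ LinearMap.fst ℂ M (G ⊗[ℂ] M) ∘ₗ f.1 ∘ₗ
      LinearMap.inr ℂ M (G ⊗[ℂ] M)))
    (fun _ _ _ => triangular_ext fun _ _ => by simp)
    (fun _ _ _ => triangular_ext fun _ _ => by simp [TensorProduct.smul_tmul'])
    (fun _ _ _ => triangular_ext fun _ _ => by simp [TensorProduct.tmul_add])
    (fun _ _ _ => triangular_ext fun _ _ => by simp))

@[simp] theorem tensorLower_tmul (x : G) (f : triangular M (G ⊗[ℂ] M))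
    (y : M × (G ⊗[ℂ] M)) : (tensorLower (x ⊗ₜ f)).1 y = (0, x ⊗ₜ (f.1 (0, y.2)).1) := rfl

variable [FiniteDimensional ℂ G]

/-- The canonical tensor of `G ⊗ Hom(G ⊗ M, M)`. -/
noncomputable def canonicalTensor (G M : Type*) [Ring G] [Algebra ℂ G] [Ring M] [Algebra ℂ M]
    [FiniteDimensional ℂ G] : G ⊗[ℂ] triangular M (G ⊗[ℂ] M) :=
  tensorOfSlices (upperBlock ∘ₗ sliceHom G M)

@[simp] theorem sliceLeft_canonicalTensor (φ : Module.Dual ℂ G) :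
    sliceLeft (canonicalTensor G M) φ = upperBlock (sliceHom G M φ) := by
  rw [canonicalTensor, sliceLeft_tensorOfSlices]; rfl

/-- For the canonical tensor, multiplying its `G`-leg and acting on its values in `M` is the same as
performing these operations on the argument in `G ⊗ M`. The action `tensorAction` is thereby forced:
at `Y = λ(m)` it is what gives `R` the commutation rule of a straightened intertwiner. -/
theorem sliceLeft_conj_canonicalTensor (Y : G ⊗[ℂ] M) (φ : Module.Dual ℂ G) :
    sliceLeft (conj H.antipode (rhoA P (blockAction P)) Algebra.TensorProduct.includeLeft Y
      (canonicalTensor G M)) φ = upperBlock (sliceHom G M φ ∘ₗ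
        conj H.antipode (coactFlip P.right.coact) Algebra.TensorProduct.includeLeft Y) := by
  induction Y using tensor_induction with
  | add a b ha hb => simp only [map_add, LinearMap.add_apply, sliceLeft_add, ha, hb,
      LinearMap.comp_add]
  | tmul x m =>
    rw [conj_tmul, rhoA, AlgHom.comp_apply]
    have : ∀ Z : G ⊗[ℂ] M, conj H.antipode (coactFlip P.right.coact)
        Algebra.TensorProduct.includeLeft (x ⊗ₜ m) Z = _ := fun Z => conj_tmul _ _ _ _ _ _
    refine triangular_ext fun n w => ?_
    rw [upperBlock_apply, LinearMap.comp_apply, this, sliceHom_apply]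
    generalize coactFlip P.right.coact m = u
    induction u using tensor_induction with
    | add a b ha hb =>
      simp only [map_add, add_mul, sliceLeft_add]
      exact (congrArg₂ (· + ·) ha hb).trans (by rw [Prod.mk_add_mk, add_zero])
    | tmul h n =>
      rw [tensorRight_tmul, Algebra.TensorProduct.includeLeft_apply,
        Algebra.TensorProduct.includeLeft_apply, sliceLeft_tmul_mul_mul, sliceLeft_tmul_mul_mul,
        sliceLeft_canonicalTensor]
      simp [sliceHom_apply]

theorem canonicalTensor_mul_tensorLower (Y : G ⊗[ℂ] triangular M (G ⊗[ℂ] M)) :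
    canonicalTensor G M * ((1 : G) ⊗ₜ tensorLower Y) =
      ((1 : G) ⊗ₜ (1 - lowerBlock 1)) * Y * ((1 : G) ⊗ₜ lowerBlock 1) := by
  refine sliceLeft_injective <| LinearMap.ext fun φ => ?_
  rw [sliceLeft_mul_one_tmul, sliceLeft_canonicalTensor, sliceLeft_mul_one_tmul,
    sliceLeft_one_tmul_mul]
  induction Y using tensor_induction with
  | add a b ha hb => simp only [map_add, mul_add, add_mul, sliceLeft_add, ha, hb]
  | tmul =>
    refine triangular_ext fun n w => Prod.ext ?_ ?_ <;> simp [sliceHom_apply, sub_mul]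

theorem tensorLower_canonicalTensor_mul (a : triangular M (G ⊗[ℂ] M)) :
    tensorLower (canonicalTensor G M * ((1 : G) ⊗ₜ a)) = lowerBlock 1 * a := by
  refine triangular_ext fun n w => ?_
  -- Slicing along a basis and tensoring back reassembles the component in `G ⊗ M`.
  have h := sum_tmul_sliceLeft (Module.finBasis ℂ G) (a.1 (0, w)).2
  rw [canonicalTensor, tensorOfSlices, Finset.sum_mul, map_sum]
  simp only [Algebra.TensorProduct.tmul_mul_tmul, mul_one]
  simp only [AddSubmonoidClass.coe_finsetSum, LinearMap.sum_apply, tensorLower_tmul]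
  refine Prod.ext ?_ ?_
  · simp [Prod.fst_sum]
  · simp only [Prod.snd_sum]
    refine h.trans ?_
    simp [triangular_snd a n w]

theorem canonicalTensor_mul_blockAction (m : M) :
    canonicalTensor G M * ((1 : G) ⊗ₜ blockAction P m) =
      conj H.antipode (rhoA P (blockAction P)) Algebra.TensorProduct.includeLeft
        (P.left.coact m) (canonicalTensor G M) := by
  refine sliceLeft_injective <| LinearMap.ext fun φ => ?_
  rw [sliceLeft_conj_canonicalTensor, sliceLeft_mul_one_tmul, sliceLeft_canonicalTensor]
  exact triangular_ext fun n w => rfl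

/-- The block model on `M × (G ⊗ M)`. -/
noncomputable def blockModel : BlockModel P (blockAction P) where
  e := lowerBlock 1
  R := canonicalTensor G M
  j := tensorLower
  e_comm m := triangular_ext fun _ _ => by simp
  e_mul_j Y := by
    induction Y using tensor_induction with
    | add a b ha hb => rw [map_add, mul_add, ha, hb]
    | tmul => exact triangular_ext fun n w => by simp
  R_mul_e := sliceLeft_injective <| LinearMap.ext fun φ => by
    rw [sliceLeft_mul_one_tmul, sliceLeft_canonicalTensor]
    exact triangular_ext fun n w => by simp
  e_mul_R := sliceLeft_injective <| LinearMap.ext fun φ => by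
    rw [sliceLeft_one_tmul_mul, sliceLeft_canonicalTensor]
    exact triangular_ext fun n w => by simp [sliceLeft]
  R_mul_j := canonicalTensor_mul_tensorLower
  j_R_mul := tensorLower_canonicalTensor_mul
  R_mul := canonicalTensor_mul_blockAction P

end Model

/-! ### Intertwiners under algebra maps -/

section Transport

variable {G M A A' A'' : Type*} [Ring G] [Algebra ℂ G] [Ring M] [Algebra ℂ M] [Ring A]
  [Algebra ℂ A] [Ring A'] [Algebra ℂ A'] [Ring A''] [Algebra ℂ A'']
  {H : QuasiHopfAlgebra G} {P : QuasiCommutingPair H.toQuasiBialgebra M} {γ : M →ₐ[ℂ] A}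
  {T : G ⊗[ℂ] A}

theorem sliceLeft_tensorRight (f : A →ₐ[ℂ] A') (t : G ⊗[ℂ] A) (φ : Module.Dual ℂ G) :
    sliceLeft (tensorRight G f t) φ = f (sliceLeft t φ) :=
  (map_sliceLeft f.toLinearMap t φ).symm

theorem tensorRight_leg312 (f : A →ₐ[ℂ] A') (t : M ⊗[ℂ] (G ⊗[ℂ] G)) :
    tensorRight G (tensorRight G f) (leg312 γ t) = leg312 (f.comp γ) t := by
  induction t using tensor_induction₃ with
  | add a b ha hb => simp only [map_add, ha, hb]
  | tmul => simp

theorem tensorRight_leg132 (f : A →ₐ[ℂ] A') (t : G ⊗[ℂ] (M ⊗[ℂ] G)) :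
    tensorRight G (tensorRight G f) (leg132 γ t) = leg132 (f.comp γ) t := by
  induction t using tensor_induction₃ with
  | add a b ha hb => simp only [map_add, ha, hb]
  | tmul => simp

theorem tensorRight_tensorRight_comp (f : A →ₐ[ℂ] A') (t : G ⊗[ℂ] (G ⊗[ℂ] M)) :
    tensorRight G (tensorRight G f) (tensorRight G (tensorRight G γ) t) =
      tensorRight G (tensorRight G (f.comp γ)) t := by
  induction t using tensor_induction₃ with
  | add a b ha hb => simp only [map_add, ha, hb]
  | tmul => simp

variable (P γ T) in
theorem map_coherence (f : A →ₐ[ℂ] A') :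
    tensorRight G (tensorRight G f)
      (leg312 γ (P.right.reassoc : M ⊗[ℂ] (G ⊗[ℂ] G)) * leg13 G A T *
        leg132 γ ((P.mixed⁻¹ : (G ⊗[ℂ] (M ⊗[ℂ] G))ˣ) : G ⊗[ℂ] (M ⊗[ℂ] G)) *
        ((1 : G) ⊗ₜ[ℂ] T) *
        tensorRight G (tensorRight G γ) (P.left.reassoc : G ⊗[ℂ] (G ⊗[ℂ] M))) =
      leg312 (f.comp γ) (P.right.reassoc : M ⊗[ℂ] (G ⊗[ℂ] G)) * leg13 G A' (tensorRight G f T) *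
        leg132 (f.comp γ) ((P.mixed⁻¹ : (G ⊗[ℂ] (M ⊗[ℂ] G))ˣ) : G ⊗[ℂ] (M ⊗[ℂ] G)) *
        ((1 : G) ⊗ₜ[ℂ] tensorRight G f T) *
        tensorRight G (tensorRight G (f.comp γ)) (P.left.reassoc : G ⊗[ℂ] (G ⊗[ℂ] M)) := by
  simp only [map_mul, tensorRight_leg312, tensorRight_leg132, tensorRight_tensorRight_comp,
    leg13_tensorRight, tensorRight_tmul]

theorem map_intertwine (f : A →ₐ[ℂ] A') (t : G ⊗[ℂ] M) :
    tensorRight G f (tensorRight G γ t) = tensorRight G (f.comp γ) t :=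
  tensorRight_tensorRight _ _ _

/-- The image of a coherent intertwiner that is normal up to `f`. -/
theorem isNormalCoherentIntertwiner_map (f : A →ₐ[ℂ] A')
    (hn : f (killLeft H.counit A T) = 1) (hi : IsIntertwiner P γ T)
    (hc : leg312 γ (P.right.reassoc : M ⊗[ℂ] (G ⊗[ℂ] G)) * leg13 G A T *
        leg132 γ ((P.mixed⁻¹ : (G ⊗[ℂ] (M ⊗[ℂ] G))ˣ) : G ⊗[ℂ] (M ⊗[ℂ] G)) *
        ((1 : G) ⊗ₜ[ℂ] T) *
        tensorRight G (tensorRight G γ) (P.left.reassoc : G ⊗[ℂ] (G ⊗[ℂ] M)) =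
      tensorSplit H.comul A T) :
    IsNormalCoherentIntertwiner P (f.comp γ) (tensorRight G f T) where
  normal := by rw [killLeft_tensorRight, hn]
  intertwine m := by
    rw [← map_intertwine, ← map_mul, show T * tensorRight G γ (P.left.coact m) = _ from hi m, map_mul,
      ← map_intertwine]
    rfl
  coherent := by rw [← map_coherence, hc, ← tensorSplit_tensorRight]

theorem map_isNormalCoherentIntertwiner (hT : IsNormalCoherentIntertwiner P γ T)
    (f : A →ₐ[ℂ] A') : IsNormalCoherentIntertwiner P (f.comp γ) (tensorRight G f T) :=
  isNormalCoherentIntertwiner_map f (by rw [hT.normal, map_one]) hT.intertwine hT.coherent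

variable [FiniteDimensional ℂ G]

theorem tensorRight_jointly_injective {f : A →ₐ[ℂ] A'} {g : A →ₐ[ℂ] A''}
    (h : ∀ x y, f x = f y → g x = g y → x = y) (s t : G ⊗[ℂ] A)
    (hf : tensorRight G f s = tensorRight G f t) (hg : tensorRight G g s = tensorRight G g t) :
    s = t := by
  refine sliceLeft_injective (LinearMap.ext fun φ => h _ _ ?_ ?_)
  · rw [← sliceLeft_tensorRight, hf, sliceLeft_tensorRight]
  · rw [← sliceLeft_tensorRight, hg, sliceLeft_tensorRight]

/-- Since `G` is finite dimensional, equality of tensors is tested on slices, so the conditions may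
be checked after `f` and `g`. This serves the two projections of a product algebra and, with `f =
g`, the inclusion of a subalgebra. -/
theorem isNormalCoherentIntertwiner_of_jointly_injective {f : A →ₐ[ℂ] A'} {g : A →ₐ[ℂ] A''}
    (h : ∀ x y, f x = f y → g x = g y → x = y)
    (hf : IsNormalCoherentIntertwiner P (f.comp γ) (tensorRight G f T))
    (hg : IsNormalCoherentIntertwiner P (g.comp γ) (tensorRight G g T)) :
    IsNormalCoherentIntertwiner P γ T where
  normal := by
    refine h _ _ ?_ ?_
    · rw [← killLeft_tensorRight, hf.normal, map_one]
    · rw [← killLeft_tensorRight, hg.normal, map_one]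
  intertwine m := by
    refine tensorRight_jointly_injective h _ _ ?_ ?_
    · rw [map_mul, map_mul, map_intertwine, map_intertwine, hf.intertwine]
    · rw [map_mul, map_mul, map_intertwine, map_intertwine, hg.intertwine]
  coherent := by
    refine tensorRight_jointly_injective (tensorRight_jointly_injective h) _ _ ?_ ?_
    · rw [map_coherence, hf.coherent, tensorSplit_tensorRight]
    · rw [map_coherence, hg.coherent, tensorSplit_tensorRight]

end Transport

/-! ### The maps `μ_L` and `μ_R` in terms of slices -/

section Spanning

variable {G M A A' : Type*} [Ring G] [Algebra ℂ G] [Ring M] [Algebra ℂ M] [Ring A]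
  [Algebra ℂ A] [Ring A'] [Algebra ℂ A']

/-- `m ⊗ φ ↦ γ(m) (φ ⊗ id)(R)`. -/
def leftMap (γ : M →ₐ[ℂ] A) (R : G ⊗[ℂ] A) : M ⊗[ℂ] Module.Dual ℂ G →ₗ[ℂ] A :=
  mulTwo γ.toLinearMap (sliceLeft R)

/-- `φ ⊗ m ↦ (φ ⊗ id)(L) γ(m)`. -/
def rightMap (γ : M →ₐ[ℂ] A) (L : G ⊗[ℂ] A) : Module.Dual ℂ G ⊗[ℂ] M →ₗ[ℂ] A :=
  mulTwo (sliceLeft L) γ.toLinearMap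

@[simp] theorem leftMap_tmul (γ : M →ₐ[ℂ] A) (R : G ⊗[ℂ] A) (m : M) (φ : Module.Dual ℂ G) :
    leftMap γ R (m ⊗ₜ φ) = γ m * sliceLeft R φ := rfl

@[simp] theorem rightMap_tmul (γ : M →ₐ[ℂ] A) (L : G ⊗[ℂ] A) (m : M) (φ : Module.Dual ℂ G) :
    rightMap γ L (φ ⊗ₜ m) = sliceLeft L φ * γ m := rfl

theorem leftSpan_le_range (γ : M →ₐ[ℂ] A) (R : G ⊗[ℂ] A) :
    leftSpan γ R ≤ LinearMap.range (leftMap γ R) := by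
  refine Submodule.span_le.2 ?_
  rintro _ ⟨m, φ, rfl⟩
  exact ⟨m ⊗ₜ φ, rfl⟩

theorem rightSpan_le_range (γ : M →ₐ[ℂ] A) (L : G ⊗[ℂ] A) :
    rightSpan γ L ≤ LinearMap.range (rightMap γ L) := by
  refine Submodule.span_le.2 ?_
  rintro _ ⟨φ, m, rfl⟩
  exact ⟨φ ⊗ₜ m, rfl⟩

theorem map_leftMap (f : A →ₐ[ℂ] A') (γ : M →ₐ[ℂ] A) (R : G ⊗[ℂ] A)
    (t : M ⊗[ℂ] Module.Dual ℂ G) :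
    f (leftMap γ R t) = leftMap (f.comp γ) (tensorRight G f R) t := by
  induction t using tensor_induction with
  | add a b ha hb => simp only [map_add, ha, hb]
  | tmul => simp [sliceLeft_tensorRight]

/-- If `γ m = 0` then `m ⊗ ε` is sent to `0`, hence vanishes, and evaluating `ε` at `1` gives `m =
0`. -/
theorem injective_of_leftMap {γ : M →ₐ[ℂ] A} {R : G ⊗[ℂ] A} (ε : G →ₐ[ℂ] ℂ)
    (h : Function.Injective (leftMap γ R)) : Function.Injective γ := by
  refine (injective_iff_map_eq_zero γ).2 fun m hm => ?_
  have h₁ : m ⊗ₜ[ℂ] ε.toLinearMap = 0 := h (by simp [hm])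
  simpa using congrArg (fun t => TensorProduct.rid ℂ M ((Module.Dual.eval ℂ G 1).lTensor M t)) h₁

theorem eq_zero_of_forall_eval [FiniteDimensional ℂ G] (t : M ⊗[ℂ] Module.Dual ℂ G)
    (h : ∀ x : G, TensorProduct.rid ℂ M ((Module.Dual.eval ℂ G x).lTensor M t) = 0) :
    t = 0 := by
  have : TensorProduct.comm ℂ _ _ t = (0 : Module.Dual ℂ G ⊗[ℂ] M) := by
    refine sliceLeft_injective (LinearMap.ext fun Ψ => ?_)
    obtain ⟨x, rfl⟩ := (Module.evalEquiv ℂ G).surjective Ψ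
    refine Eq.trans ?_ ((h x).trans (by simp [sliceLeft]))
    clear h
    induction t using tensor_induction with
    | add a b ha hb => simp only [map_add, sliceLeft_add, ha, hb]
    | tmul => simp
  simpa using this

variable [FiniteDimensional ℂ G]

theorem mulTwo_dualComul (x y : G) (a b : A)
    (φ : Module.Dual ℂ G) :
    mulTwo (sliceLeft (x ⊗ₜ[ℂ] a)) (sliceLeft (y ⊗ₜ[ℂ] b)) (dualComul G φ) =
      φ (x * y) • (a * b) := by
  have h : TensorProduct.dualDistrib ℂ G G (dualComul G φ) (x ⊗ₜ y) = φ (x * y) := by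
    have := (TensorProduct.dualDistribEquiv ℂ G G).apply_symm_apply
      ((LinearMap.mul' ℂ G).dualMap φ)
    exact (LinearMap.congr_fun this (x ⊗ₜ y)).trans (by simp)
  rw [← h]
  generalize dualComul G φ = D
  induction D using tensor_induction with
  | add a b ha hb => simp only [map_add, LinearMap.add_apply, add_smul, ha, hb]
  | tmul => simp [mulTwo, smul_smul, mul_comm]

/-- The coproduct of `Ĝ` is dual to the product of `G`, so convolving slices amounts to slicing a
product. This is how the formulas for `μ_R` and `μ_L` become slices of `T p_λ` and `q_ρ T`. -/
theorem mulTwo_sliceLeft_dualComul (s t : G ⊗[ℂ] A) (φ : Module.Dual ℂ G) :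
    mulTwo (sliceLeft s) (sliceLeft t) (dualComul G φ) = sliceLeft (s * t) φ := by
  have hadd : ∀ s t : G ⊗[ℂ] A, sliceLeft (s + t) = sliceLeft s + sliceLeft t := fun s t =>
    LinearMap.ext fun φ => sliceLeft_add φ s t
  induction s using tensor_induction with
  | add a b ha hb =>
    rw [add_mul, sliceLeft_add, ← ha, ← hb, hadd]
    simp only [mulTwo, TensorProduct.map_add_left, LinearMap.comp_add, LinearMap.add_apply]
  | tmul x a =>
    induction t using tensor_induction with
    | add a b ha hb =>
      rw [mul_add, sliceLeft_add, ← ha, ← hb, hadd]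
      simp only [mulTwo, TensorProduct.map_add_right, LinearMap.comp_add, LinearMap.add_apply]
    | tmul y b => rw [mulTwo_dualComul]; simp

theorem muRight_eq (ι : M →ₐ[ℂ] A) (T : G ⊗[ℂ] A) (p : G ⊗[ℂ] M) :
    muRight ι (sliceLeft T) p = leftMap ι (T * tensorRight G ι p) := by
  rw [muRight, leftMap]
  congr 1
  refine LinearMap.ext fun φ => ?_
  rw [LinearMap.comp_apply, ← mulTwo_sliceLeft_dualComul]
  congr 2
  exact LinearMap.ext fun φ => (sliceLeft_tensorRight ι p φ).symm

theorem muLeft_eq (ι : M →ₐ[ℂ] A) (T : G ⊗[ℂ] A) (q : M ⊗[ℂ] G) :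
    muLeft ι (sliceLeft T) q =
      rightMap ι (tensorRight G ι (Algebra.TensorProduct.comm ℂ M G q) * T) := by
  rw [muLeft, rightMap]
  congr 1
  refine LinearMap.ext fun φ => ?_
  rw [LinearMap.comp_apply, ← mulTwo_sliceLeft_dualComul]
  congr 2
  refine LinearMap.ext fun φ => ?_
  rw [sliceLeft_tensorRight, LinearMap.comp_apply]
  refine congrArg ι ?_
  induction q using tensor_induction with
  | add a b ha hb => simp only [map_add, sliceLeft_add, ← ha, ← hb]; simp [sliceRight]
  | tmul => simp [sliceRight]

variable {H : QuasiHopfAlgebra G} {P : QuasiCommutingPair H.toQuasiBialgebra M} {γ : M →ₐ[ℂ] A}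
  {T : G ⊗[ℂ] A}

theorem adjoin_le_range_leftMap (hT : IsNormalCoherentIntertwiner P γ T) {a : A}
    (ha : a ∈ Algebra.adjoin ℂ (Set.range γ ∪ Set.range (sliceLeft T))) :
    a ∈ LinearMap.range (leftMap γ (T * tensorRight G γ (pLambda H P.left))) :=
  leftSpan_le_range _ _ (bimoduleSpan_le_leftSpan hT.intertwine
    (mem_bimoduleSpan_of_mem_adjoin hT ha))

theorem adjoin_le_range_rightMap (hT : IsNormalCoherentIntertwiner P γ T) {a : A}
    (ha : a ∈ Algebra.adjoin ℂ (Set.range γ ∪ Set.range (sliceLeft T))) :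
    a ∈ LinearMap.range (rightMap γ
      (tensorRight G γ (Algebra.TensorProduct.comm ℂ M G (qRho H P.right)) * T)) :=
  rightSpan_le_range _ _ (bimoduleSpan_le_rightSpan hT.intertwine
    (mem_bimoduleSpan_of_mem_adjoin hT ha))

end Spanning

/-! ### Universality from injectivity -/

section Universal

variable {G M : Type*} [Ring G] [Algebra ℂ G] [FiniteDimensional ℂ G] [Ring M] [Algebra ℂ M]
  {H : QuasiHopfAlgebra G} {P : QuasiCommutingPair H.toQuasiBialgebra M}

universe z

variable {A₀ A : Type z} [Ring A₀] [Algebra ℂ A₀] {γ₀ : M →ₐ[ℂ] A₀} {T₀ : G ⊗[ℂ] A₀}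
  [Ring A] [Algebra ℂ A] {γ : M →ₐ[ℂ] A} {T : G ⊗[ℂ] A}

/-- The map is obtained through its graph: the subalgebra of `A₀ × A` generated by the pairs of
corresponding generators. -/
theorem exists_extension (h₀ : IsNormalCoherentIntertwiner P γ₀ T₀)
    (hg : Algebra.adjoin ℂ (Set.range γ₀ ∪ Set.range (sliceLeft T₀)) = ⊤)
    (hi : Function.Injective (leftMap γ₀ (T₀ * tensorRight G γ₀ (pLambda H P.left))))
    (hT : IsNormalCoherentIntertwiner P γ T) :
    ∃ f : A₀ →ₐ[ℂ] A, f.comp γ₀ = γ ∧ ∀ φ, f (sliceLeft T₀ φ) = sliceLeft T φ := by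
  let γ' : M →ₐ[ℂ] A₀ × A := γ₀.prod γ
  let F : Module.Dual ℂ G →ₗ[ℂ] A₀ × A := (sliceLeft T₀).prod (sliceLeft T)
  let T' : G ⊗[ℂ] (A₀ × A) := tensorOfSlices F
  have hF : sliceLeft T' = F := sliceLeft_tensorOfSlices F
  have e₁ : tensorRight G (AlgHom.fst ℂ A₀ A) T' = T₀ :=
    sliceLeft_injective (LinearMap.ext fun φ => by rw [sliceLeft_tensorRight, hF]; rfl)
  have e₂ : tensorRight G (AlgHom.snd ℂ A₀ A) T' = T :=
    sliceLeft_injective (LinearMap.ext fun φ => by rw [sliceLeft_tensorRight, hF]; rfl)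
  have hT' : IsNormalCoherentIntertwiner P γ' T' :=
    isNormalCoherentIntertwiner_of_jointly_injective (f := AlgHom.fst ℂ A₀ A)
      (g := AlgHom.snd ℂ A₀ A) (fun _ _ => Prod.ext) (by rw [e₁]; exact h₀)
      (by rw [e₂]; exact hT)
  let S := Algebra.adjoin ℂ (Set.range γ' ∪ Set.range (sliceLeft T'))
  let π : S →ₐ[ℂ] A₀ := (AlgHom.fst ℂ A₀ A).comp S.val
  -- Spanning holds for the paired intertwiner, so an element of `S` is the image of some `t ∈ M ⊗
  -- Ĝ`. Its first component already determines `t` by `hi`.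
  have hinj : Function.Injective π := by
    refine (injective_iff_map_eq_zero π).2 fun x hx => ?_
    obtain ⟨t, ht⟩ := adjoin_le_range_leftMap hT' x.2
    have h : AlgHom.fst ℂ A₀ A (leftMap γ' (T' * tensorRight G γ' (pLambda H P.left)) t) = 0 := by
      rw [ht]; exact hx
    rw [map_leftMap, map_mul, map_intertwine, e₁] at h
    have ht0 : t = 0 := hi (h.trans (map_zero _).symm)
    rw [ht0, map_zero] at ht
    exact Subtype.ext ht.symm
  have hsurj : Function.Surjective π := by
    rw [← AlgHom.range_eq_top, eq_top_iff, ← hg, Algebra.adjoin_le_iff]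
    rintro _ (⟨m, rfl⟩ | ⟨φ, rfl⟩)
    · exact ⟨⟨γ' m, Algebra.subset_adjoin (Or.inl ⟨m, rfl⟩)⟩, rfl⟩
    · exact ⟨⟨sliceLeft T' φ, Algebra.subset_adjoin (Or.inr ⟨φ, rfl⟩)⟩, by
        change (sliceLeft T' φ).1 = _; rw [hF]; rfl⟩
  let E := AlgEquiv.ofBijective π ⟨hinj, hsurj⟩
  have hE : ∀ x : S, E.symm (π x) = x := fun x => E.symm_apply_apply x
  refine ⟨((AlgHom.snd ℂ A₀ A).comp S.val).comp E.symm.toAlgHom, ?_, fun φ => ?_⟩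
  · refine AlgHom.ext fun m => ?_
    exact congrArg (fun x : S => x.1.2)
      (hE ⟨γ' m, Algebra.subset_adjoin (Or.inl ⟨m, rfl⟩)⟩)
  · have := congrArg (fun x : S => x.1.2)
      (hE ⟨sliceLeft T' φ, Algebra.subset_adjoin (Or.inr ⟨φ, rfl⟩)⟩)
    change ((E.symm (sliceLeft T' φ).1).1).2 = (sliceLeft T' φ).2 at this
    rwa [hF] at this

/-- A normal coherent intertwiner is universal if `m ⊗ φ ↦ γ₀(m) (φ ⊗ id)(T₀ p_λ)` is injective. -/
theorem isUniversalExtension_of_injective (h₀ : IsNormalCoherentIntertwiner P γ₀ T₀)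
    (hg : Algebra.adjoin ℂ (Set.range γ₀ ∪ Set.range (sliceLeft T₀)) = ⊤)
    (hi : Function.Injective (leftMap γ₀ (T₀ * tensorRight G γ₀ (pLambda H P.left)))) :
    IsUniversalExtension P γ₀ (sliceLeft T₀) where
  injective := injective_of_leftMap H.counit hi
  generated := hg
  exists_unique_intertwiner A _ _ γ f hf := by
    refine ⟨tensorRight G f T₀, ⟨hf ▸ map_isNormalCoherentIntertwiner h₀ f, fun φ => (sliceLeft_tensorRight f T₀ φ).symm⟩,
      fun T h => sliceLeft_injective (LinearMap.ext fun φ => ?_)⟩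
    rw [← h.2, sliceLeft_tensorRight]
  exists_unique_map A _ _ γ T hT := by
    obtain ⟨f, hf, hf'⟩ := exists_extension h₀ hg hi hT
    refine ⟨f, ⟨hf, hf'⟩, fun g hg' => AlgHom.ext_of_adjoin_eq_top hg ?_⟩
    rintro _ (⟨m, rfl⟩ | ⟨φ, rfl⟩)
    · exact (DFunLike.congr_fun hg'.1 m).trans (DFunLike.congr_fun hf m).symm
    · rw [hg'.2, hf']

theorem exists_isUniversalExtension (hT : IsNormalCoherentIntertwiner P γ T)
    (hi : Function.Injective (leftMap γ (T * tensorRight G γ (pLambda H P.left)))) :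
    ∃ (M₁ : Type z) (_ : Ring M₁) (_ : Algebra ℂ M₁) (ι : M →ₐ[ℂ] M₁)
      (Γ : Module.Dual ℂ G →ₗ[ℂ] M₁), IsUniversalExtension P ι Γ := by
  let S := Algebra.adjoin ℂ (Set.range γ ∪ Set.range (sliceLeft T))
  let γ₀ : M →ₐ[ℂ] S := γ.codRestrict S fun m => Algebra.subset_adjoin (Or.inl ⟨m, rfl⟩)
  let Γ₀ : Module.Dual ℂ G →ₗ[ℂ] S := (sliceLeft T).codRestrict S.toSubmodule
    fun φ => Algebra.subset_adjoin (Or.inr ⟨φ, rfl⟩)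
  let T₀ : G ⊗[ℂ] S := tensorOfSlices Γ₀
  have hΓ : sliceLeft T₀ = Γ₀ := sliceLeft_tensorOfSlices Γ₀
  have e : tensorRight G S.val T₀ = T :=
    sliceLeft_injective (LinearMap.ext fun φ => by rw [sliceLeft_tensorRight, hΓ]; rfl)
  have h₀ : IsNormalCoherentIntertwiner P γ₀ T₀ :=
    isNormalCoherentIntertwiner_of_jointly_injective (f := S.val) (g := S.val)
      (fun _ _ h _ => Subtype.ext h) (by rw [e]; exact hT) (by rw [e]; exact hT)
  refine ⟨S, inferInstance, inferInstance, γ₀, sliceLeft T₀,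
    isUniversalExtension_of_injective h₀ ?_ fun s t hst => hi ?_⟩
  · rw [eq_top_iff, ← Algebra.adjoin_adjoin_coe_preimage]
    refine Algebra.adjoin_mono ?_
    rintro x (⟨m, hm⟩ | ⟨φ, hφ⟩)
    · exact Or.inl ⟨m, Subtype.ext hm⟩
    · exact Or.inr ⟨φ, by rw [hΓ]; exact Subtype.ext hφ⟩
  · have h := congrArg S.val hst
    rw [map_leftMap, map_leftMap, map_mul, map_intertwine, e] at h
    exact h

end Universal

/-! ### The operator model is faithful -/

section Faithful

variable {G M : Type*} [Ring G] [Algebra ℂ G] [Ring M] [Algebra ℂ M]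
  {H : QuasiHopfAlgebra G} (P : QuasiCommutingPair H.toQuasiBialgebra M)

theorem corner_comp_blockAction :
    (corner (V := M)).comp (blockAction P) = tensorAction P :=
  AlgHom.ext fun _ => LinearMap.ext fun _ => rfl

theorem eq_zero_of_corner_eq_zero {V W : Type*} [AddCommGroup V] [Module ℂ V] [AddCommGroup W]
    [Module ℂ W] {f : triangular V W} (he : lowerBlock 1 * f = f) (h : corner f = 0) : f = 0 := by
  rw [← he]
  refine triangular_ext fun v w => ?_
  have := LinearMap.congr_fun h w
  refine Prod.ext rfl ?_
  change (f.1 (v, w)).2 = 0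
  rw [triangular_snd]
  exact this

theorem mul_leftMap {A : Type*} [Ring A] [Algebra ℂ A] {γ : M →ₐ[ℂ] A} {a : A}
    (h : ∀ m, Commute a (γ m)) (R : G ⊗[ℂ] A) (t : M ⊗[ℂ] Module.Dual ℂ G) :
    a * leftMap γ R t = leftMap γ (((1 : G) ⊗ₜ a) * R) t := by
  induction t using tensor_induction with
  | add a b ha hb => simp only [map_add, mul_add, ha, hb]
  | tmul m φ =>
    rw [leftMap_tmul, leftMap_tmul, sliceLeft_one_tmul_mul, ← mul_assoc, (h m).eq, mul_assoc]

variable [FiniteDimensional ℂ G]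

/-- The intertwiner in `G ⊗ End(G ⊗ M)`. -/
noncomputable def tensorIntertwiner : G ⊗[ℂ] Module.End ℂ (G ⊗[ℂ] M) :=
  tensorRight G corner (blockModel P).T

theorem isNormalCoherentIntertwiner_tensorIntertwiner :
    IsNormalCoherentIntertwiner P (tensorAction P) (tensorIntertwiner P) := by
  rw [← corner_comp_blockAction]
  refine isNormalCoherentIntertwiner_map corner ?_ (blockModel P).isIntertwiner_T
    (blockModel P).legProduct_T_T
  rw [(blockModel P).killLeft_T]
  exact LinearMap.ext fun w => rfl

theorem leftMap_canonicalTensor (t : M ⊗[ℂ] Module.Dual ℂ G) (x : G) :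
    ((leftMap (blockAction P) (canonicalTensor G M) t).1 (0, x ⊗ₜ[ℂ] (1 : M))).1 =
      TensorProduct.rid ℂ M ((Module.Dual.eval ℂ G x).lTensor M t) := by
  induction t using tensor_induction with
  | add a b ha hb =>
    rw [map_add, map_add, map_add, ← ha, ← hb]; rfl
  | tmul m φ =>
    simp [sliceHom_apply]

/-- Multiplying by `(ε ⊗ id)(C)`, which commutes with `M`, turns `T p_λ` into `C p_λ = R`; applying
the resulting operator to `x ⊗ 1` gives `φ(x) m` for `m ⊗ φ`, and these values determine the
element. -/
theorem leftMap_tensorIntertwiner_injective : Function.Injective (leftMap (tensorAction P)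
    (tensorIntertwiner P * tensorRight G (tensorAction P) (pLambda H P.left))) := by
  refine (injective_iff_map_eq_zero _).2 fun t ht => eq_zero_of_forall_eval t fun x => ?_
  let B := blockModel P
  -- `(ε ⊗ id)(C)` lives outside the corner `End(G ⊗ M)`, so the vanishing is first lifted to the
  -- triangular algebra; there an element fixed by `e` is determined by its corner.
  have h₁ : leftMap (blockAction P)
      (B.T * tensorRight G (blockAction P) (pLambda H P.left)) t = 0 := by
    refine eq_zero_of_corner_eq_zero ?_ ?_
    · change B.e * _ = _
      rw [mul_leftMap B.e_comm, ← mul_assoc, B.e_mul_T]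
    · rw [map_leftMap, map_mul, map_intertwine, corner_comp_blockAction]
      exact ht
  have h₂ := mul_leftMap (commute_killLeft B.isIntertwiner_C)
    (B.T * tensorRight G (blockAction P) (pLambda H P.left)) t
  rw [h₁, mul_zero, ← mul_assoc, B.killLeft_C_mul_T, B.C_mul_p] at h₂
  rw [← leftMap_canonicalTensor P]
  change ((leftMap (blockAction P) B.R t).1 _).1 = 0
  rw [← h₂]; rfl

end Faithful

/-! ### Uniqueness, and bijectivity of `μ_R` -/

section Universal

variable {G : Type u} [Ring G] [Algebra ℂ G] {M : Type v} [Ring M] [Algebra ℂ M]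
  {H : QuasiHopfAlgebra G} {P : QuasiCommutingPair H.toQuasiBialgebra M}
  {M₁ : Type (max u v w)} [Ring M₁] [Algebra ℂ M₁] {ι : M →ₐ[ℂ] M₁}
  {Γ : Module.Dual ℂ G →ₗ[ℂ] M₁}

theorem exists_intertwiner (h : IsUniversalExtension P ι Γ) :
    ∃ T : G ⊗[ℂ] M₁, IsNormalCoherentIntertwiner P ι T ∧ Γ = sliceLeft T := by
  obtain ⟨T, hT, -⟩ := h.exists_unique_intertwiner M₁ ι (AlgHom.id ℂ M₁) rfl
  exact ⟨T, hT.1, LinearMap.ext hT.2⟩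

theorem universal_algHom_ext (h : IsUniversalExtension P ι Γ) {A : Type*} [Ring A]
    [Algebra ℂ A] {f g : M₁ →ₐ[ℂ] A} (h₁ : ∀ m, f (ι m) = g (ι m))
    (h₂ : ∀ φ, f (Γ φ) = g (Γ φ)) : f = g := by
  refine AlgHom.ext_of_adjoin_eq_top h.generated ?_
  rintro _ (⟨m, rfl⟩ | ⟨φ, rfl⟩)
  exacts [h₁ m, h₂ φ]

theorem existsUnique_algEquiv {M₂ : Type (max u v w)} [Ring M₂]
    [Algebra ℂ M₂] {ι₂ : M →ₐ[ℂ] M₂} {T₁ : G ⊗[ℂ] M₁} {T₂ : G ⊗[ℂ] M₂}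
    (h₁ : IsUniversalExtension P ι (sliceLeft T₁)) (h₂ : IsUniversalExtension P ι₂ (sliceLeft T₂))
    (hT₁ : IsNormalCoherentIntertwiner P ι T₁) (hT₂ : IsNormalCoherentIntertwiner P ι₂ T₂) :
    ∃! f : M₁ ≃ₐ[ℂ] M₂, (∀ m : M, f (ι m) = ι₂ m) ∧ ∀ φ, sliceLeft T₂ φ = f (sliceLeft T₁ φ) := by
  obtain ⟨f, ⟨hf, hfT⟩, -⟩ := h₁.exists_unique_map M₂ ι₂ T₂ hT₂
  obtain ⟨g, ⟨hg, hgT⟩, -⟩ := h₂.exists_unique_map M₁ ι T₁ hT₁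
  replace hf := fun m => DFunLike.congr_fun hf m
  replace hg := fun m => DFunLike.congr_fun hg m
  simp only [AlgHom.comp_apply] at hf hg
  have hfg : f.comp g = AlgHom.id ℂ M₂ := universal_algHom_ext h₂
    (fun m => (congrArg f (hg m)).trans (hf m)) fun φ => (congrArg f (hgT φ)).trans (hfT φ)
  have hgf : g.comp f = AlgHom.id ℂ M₁ := universal_algHom_ext h₁
    (fun m => (congrArg g (hf m)).trans (hg m)) fun φ => (congrArg g (hfT φ)).trans (hgT φ)
  refine ⟨AlgEquiv.ofAlgHom f g hfg hgf,
    ⟨hf, fun φ => (hfT φ).symm⟩, fun e he => ?_⟩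
  have : (e : M₁ →ₐ[ℂ] M₂) = f :=
    universal_algHom_ext h₁ (fun m => (he.1 m).trans (hf m).symm) fun φ => (he.2 φ).symm.trans (hfT φ).symm
  exact AlgEquiv.ext fun x => DFunLike.congr_fun this x

variable [FiniteDimensional ℂ G]

variable (P) in
theorem exists_injective_leftMap :
    ∃ (A : Type (max u v w)) (_ : Ring A) (_ : Algebra ℂ A) (γ : M →ₐ[ℂ] A) (T : G ⊗[ℂ] A),
      IsNormalCoherentIntertwiner P γ T ∧
        Function.Injective (leftMap γ (T * tensorRight G γ (pLambda H P.left))) := by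
  -- The universal property only tests algebras in the universe of the extension, so the model is
  -- lifted there.
  let E : Module.End ℂ (G ⊗[ℂ] M) ≃ₐ[ℂ] ULift.{w} (Module.End ℂ (G ⊗[ℂ] M)) :=
    ULift.algEquiv.symm
  refine ⟨ULift.{w} (Module.End ℂ (G ⊗[ℂ] M)), inferInstance, inferInstance,
    E.toAlgHom.comp (tensorAction P), tensorRight G E.toAlgHom (tensorIntertwiner P),
    map_isNormalCoherentIntertwiner (isNormalCoherentIntertwiner_tensorIntertwiner P) _, ?_⟩
  intro s t h
  rw [← map_intertwine, ← map_mul, ← map_leftMap, ← map_leftMap] at h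
  exact leftMap_tensorIntertwiner_injective P (E.injective h)

/-- The homomorphism to the operator model carries this map to an injective one; surjectivity is
spanning together with generation. -/
theorem bijective_leftMap {T : G ⊗[ℂ] M₁}
    (h : IsUniversalExtension P ι (sliceLeft T)) (hT : IsNormalCoherentIntertwiner P ι T) :
    Function.Bijective (leftMap ι (T * tensorRight G ι (pLambda H P.left))) := by
  constructor
  · obtain ⟨A, _, _, γ, T', hT', hi⟩ := exists_injective_leftMap.{u, v, w} P
    obtain ⟨f, ⟨hf, hfT⟩, -⟩ := h.exists_unique_map A γ T' hT'
    have e : tensorRight G f T = T' := sliceLeft_injective (LinearMap.ext fun φ => by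
      rw [sliceLeft_tensorRight, hfT])
    intro s t hst
    have := congrArg f hst
    rw [map_leftMap, map_leftMap, map_mul, map_intertwine, hf, e] at this
    exact hi this
  · intro a
    exact adjoin_le_range_leftMap hT (h.generated ▸ Algebra.mem_top)

end Universal

/-! ### Left linear maps and right multiplication -/

section RightMap

variable {G M A A' : Type*} [Ring G] [Algebra ℂ G] [Ring M] [Algebra ℂ M] [Ring A] [Algebra ℂ A]
  [Ring A'] [Algebra ℂ A'] {H : QuasiHopfAlgebra G}
  {P : QuasiCommutingPair H.toQuasiBialgebra M} {γ : M →ₐ[ℂ] A} {γ' : M →ₐ[ℂ] A'}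
  {T : G ⊗[ℂ] A} {T' : G ⊗[ℂ] A'} {f : A →ₗ[ℂ] A'}

theorem lTensor_tensorRight_mul (hf : ∀ m a, f (γ m * a) = γ' m * f a) (u : G ⊗[ℂ] M)
    (Z : G ⊗[ℂ] A) :
    f.lTensor G (tensorRight G γ u * Z) = tensorRight G γ' u * f.lTensor G Z := by
  induction u using tensor_induction with
  | add a b ha hb => simp only [map_add, add_mul, ha, hb]
  | tmul =>
    induction Z using tensor_induction with
    | add a b ha hb => simp only [map_add, mul_add, ha, hb]
    | tmul => simp [hf]

theorem lTensor_mul_includeLeft (Z : G ⊗[ℂ] A) (x : G) :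
    f.lTensor G (Z * (Algebra.TensorProduct.includeLeft : G →ₐ[ℂ] G ⊗[ℂ] A) x) =
      f.lTensor G Z * (Algebra.TensorProduct.includeLeft : G →ₐ[ℂ] G ⊗[ℂ] A') x := by
  induction Z using tensor_induction with
  | add a b ha hb => simp only [map_add, add_mul, ha, hb]
  | tmul => simp

theorem lTensor_conj_rhoA (hf : ∀ m a, f (γ m * a) = γ' m * f a) (Y : G ⊗[ℂ] M) (Z : G ⊗[ℂ] A) :
    f.lTensor G (conj H.antipode (rhoA P γ) Algebra.TensorProduct.includeLeft Y Z) =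
      conj H.antipode (rhoA P γ') Algebra.TensorProduct.includeLeft Y (f.lTensor G Z) := by
  induction Y using tensor_induction with
  | add a b ha hb => simp only [map_add, LinearMap.add_apply, ha, hb]
  | tmul =>
    rw [conj_tmul, conj_tmul, lTensor_mul_includeLeft, rhoA, AlgHom.comp_apply,
      lTensor_tensorRight_mul hf]
    rfl

/-- By `intertwiner_mul`, `q T (1 ⊗ m)` arises from `T p_λ` by multiplying with `M` on the left and
with the `G`-leg. A left `M`-linear `f` respects both, so neither multiplicativity of `f` nor
coherence of `T` is needed. -/
theorem map_rightMap (hf : ∀ m a, f (γ m * a) = γ' m * f a) (hT : IsIntertwiner P γ T)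
    (hT' : IsIntertwiner P γ' T')
    (h : f.lTensor G (T * tensorRight G γ (pLambda H P.left)) =
      T' * tensorRight G γ' (pLambda H P.left)) (q : G ⊗[ℂ] M) (t : Module.Dual ℂ G ⊗[ℂ] M) :
    f (rightMap γ (tensorRight G γ q * T) t) = rightMap γ' (tensorRight G γ' q * T') t := by
  induction t using tensor_induction with
  | add a b ha hb => simp only [map_add, ha, hb]
  | tmul φ m =>
    rw [rightMap_tmul, rightMap_tmul, ← sliceLeft_mul_one_tmul, ← sliceLeft_mul_one_tmul,
      map_sliceLeft, mul_assoc, mul_assoc, lTensor_tensorRight_mul hf, intertwiner_mul hT,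
      intertwiner_mul hT', lTensor_conj_rhoA hf, h]

end RightMap

/-! ### An intertwiner detecting `μ_L` -/

section RightModel

variable {G M : Type*} [Ring G] [Algebra ℂ G] [Ring M] [Algebra ℂ M]
  {H : QuasiHopfAlgebra G} (P : QuasiCommutingPair H.toQuasiBialgebra M)

/-- Unlike `conj`, this action reverses products, so it gives right actions; for that reason the
model for `μ_L` uses the opposite of an endomorphism algebra. -/
theorem coconj_mul_coconj {B N : Type*} [Ring B] [Algebra ℂ B] [Ring N] [Algebra ℂ N]
    (S : G ≃ₐ[ℂ] Gᵐᵒᵖ) (b : N →ₐ[ℂ] B) (s : G →ₐ[ℂ] B) (X Y : G ⊗[ℂ] N) :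
    coconj S b s (X * Y) = coconj S b s Y * coconj S b s X := by
  induction X using tensor_induction with
  | add a b ha hb => simp only [map_add, add_mul, mul_add, ha, hb]
  | tmul =>
    induction Y using tensor_induction with
    | add a b ha hb => simp only [map_add, mul_add, add_mul, ha, hb]
    | tmul => exact LinearMap.ext fun Z => by simp [antipodeMap_mul, mul_assoc]

theorem coconj_one {B N : Type*} [Ring B] [Algebra ℂ B] [Ring N] [Algebra ℂ N]
    (S : G ≃ₐ[ℂ] Gᵐᵒᵖ) (b : N →ₐ[ℂ] B) (s : G →ₐ[ℂ] B) : coconj S b s 1 = 1 :=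
  LinearMap.ext fun Z => by simp [Algebra.TensorProduct.one_def]

/-- The right action of `M` on `M × (G ⊗ M)`. -/
def rightAction : M →ₐ[ℂ] (Module.End ℂ (M × (G ⊗[ℂ] M)))ᵐᵒᵖ :=
  AlgHom.ofLinearMap ((MulOpposite.opLinearEquiv ℂ).toLinearMap ∘ₗ
    LinearMap.prodMapLinear ℂ M (G ⊗[ℂ] M) M (G ⊗[ℂ] M) ℂ ∘ₗ
      (LinearMap.mul ℂ M).flip.prod (coconj (antipodeSymm H.antipode) P.left.coact
        Algebra.TensorProduct.includeLeft ∘ₗ (coactFlip P.right.coact).toLinearMap))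
    (MulOpposite.unop_injective (LinearMap.ext fun x => by simp [coconj_one]))
    fun m n => MulOpposite.unop_injective (LinearMap.ext fun x => by
      simp [coconj_mul_coconj, mul_assoc])

theorem unop_rightAction_apply (m : M) (x : M × (G ⊗[ℂ] M)) :
    (rightAction P m).unop x = (x.1 * m, coconj (antipodeSymm H.antipode) P.left.coact
      Algebra.TensorProduct.includeLeft (coactFlip P.right.coact m) x.2) := rfl

/-- The block in `Hom(G ⊗ M, M)`. -/
def opUpperBlock : (G ⊗[ℂ] M →ₗ[ℂ] M) →ₗ[ℂ] (Module.End ℂ (M × (G ⊗[ℂ] M)))ᵐᵒᵖ where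
  toFun h := MulOpposite.op (upperBlock h).1
  map_add' _ _ := by simp
  map_smul' _ _ := by simp

theorem unop_opUpperBlock_apply (h : G ⊗[ℂ] M →ₗ[ℂ] M) (x : M × (G ⊗[ℂ] M)) :
    (opUpperBlock h).unop x = (h x.2, 0) := rfl

theorem sliceLeft_mul_mul_tmul {A : Type*} [Ring A] [Algebra ℂ A] (h k : G) (a : A)
    (t : G ⊗[ℂ] A) (φ : Module.Dual ℂ G) :
    sliceLeft ((h ⊗ₜ (1 : A)) * t * (k ⊗ₜ a)) φ =
      sliceLeft t (φ ∘ₗ LinearMap.mulLeft ℂ h ∘ₗ LinearMap.mulRight ℂ k) * a := by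
  induction t using tensor_induction with
  | add a b ha hb => simp only [mul_add, add_mul, sliceLeft_add, ha, hb]
  | tmul => simp [mul_assoc]

variable [FiniteDimensional ℂ G]

/-- The canonical tensor of `G ⊗ Hom(G ⊗ M, M)`. -/
noncomputable def opCanonicalTensor (G M : Type*) [Ring G] [Algebra ℂ G] [Ring M] [Algebra ℂ M]
    [FiniteDimensional ℂ G] : G ⊗[ℂ] (Module.End ℂ (M × (G ⊗[ℂ] M)))ᵐᵒᵖ :=
  tensorOfSlices (opUpperBlock ∘ₗ sliceHom G M)

@[simp] theorem sliceLeft_opCanonicalTensor (φ : Module.Dual ℂ G) :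
    sliceLeft (opCanonicalTensor G M) φ = opUpperBlock (sliceHom G M φ) := by
  rw [opCanonicalTensor, sliceLeft_tensorOfSlices]; rfl

theorem sliceLeft_coconj_opCanonicalTensor (Y : G ⊗[ℂ] M) (φ : Module.Dual ℂ G) :
    sliceLeft (coconj (antipodeSymm H.antipode) (lamA P (rightAction P))
      Algebra.TensorProduct.includeLeft Y (opCanonicalTensor G M)) φ =
      opUpperBlock (sliceHom G M φ ∘ₗ coconj (antipodeSymm H.antipode) P.left.coact
        Algebra.TensorProduct.includeLeft Y) := by
  induction Y using tensor_induction with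
  | add a b ha hb => simp only [map_add, LinearMap.add_apply, sliceLeft_add, ha, hb,
      LinearMap.comp_add]
  | tmul x m =>
    rw [coconj_tmul, lamA, AlgHom.comp_apply]
    have : ∀ Z : G ⊗[ℂ] M, coconj (antipodeSymm H.antipode) P.left.coact
        Algebra.TensorProduct.includeLeft (x ⊗ₜ m) Z = _ := fun Z => coconj_tmul _ _ _ _ _ _
    refine MulOpposite.unop_injective (LinearMap.ext fun y => ?_)
    rw [unop_opUpperBlock_apply, LinearMap.comp_apply, this, sliceHom_apply]
    generalize P.left.coact m = u
    induction u using tensor_induction with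
    | add a b ha hb =>
      simp only [map_add, mul_add, sliceLeft_add]
      exact (congrArg₂ (· + ·) ha hb).trans (by rw [Prod.mk_add_mk, add_zero])
    | tmul h n =>
      rw [tensorRight_tmul, Algebra.TensorProduct.includeLeft_apply,
        Algebra.TensorProduct.includeLeft_apply, sliceLeft_mul_mul_tmul, sliceLeft_mul_mul_tmul,
        sliceLeft_opCanonicalTensor, MulOpposite.unop_mul, Module.End.mul_apply,
        unop_opUpperBlock_apply, unop_rightAction_apply]
      simp [sliceHom_apply]

theorem rightAction_mul_opCanonicalTensor (m : M) :
    ((1 : G) ⊗ₜ rightAction P m) * opCanonicalTensor G M =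
      coconj (antipodeSymm H.antipode) (lamA P (rightAction P))
        Algebra.TensorProduct.includeLeft (coactFlip P.right.coact m) (opCanonicalTensor G M) := by
  refine sliceLeft_injective (LinearMap.ext fun φ => ?_)
  rw [sliceLeft_coconj_opCanonicalTensor, sliceLeft_one_tmul_mul, sliceLeft_opCanonicalTensor]
  exact MulOpposite.unop_injective (LinearMap.ext fun x => rfl)

theorem rightMap_opCanonicalTensor (t : Module.Dual ℂ G ⊗[ℂ] M) (x : G) :
    ((rightMap (rightAction P) (opCanonicalTensor G M) t).unop (0, x ⊗ₜ[ℂ] (1 : M))).1 =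
      TensorProduct.rid ℂ M ((Module.Dual.eval ℂ G x).lTensor M (TensorProduct.comm ℂ _ _ t)) := by
  induction t using tensor_induction with
  | add a b ha hb =>
    rw [map_add, map_add, map_add, map_add, ← ha, ← hb]; rfl
  | tmul φ m =>
    simp [sliceHom_apply, unop_opUpperBlock_apply, unop_rightAction_apply]

theorem rightMap_opCanonicalTensor_injective :
    Function.Injective (rightMap (rightAction P) (opCanonicalTensor G M)) := by
  refine (injective_iff_map_eq_zero _).2 fun t ht => ?_
  have : TensorProduct.comm ℂ _ _ t = 0 := eq_zero_of_forall_eval _ fun x => by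
    rw [← rightMap_opCanonicalTensor P, ht]; rfl
  simpa using this

/-- An intertwiner `T` with `q_ρ T` the canonical tensor. -/
theorem exists_isIntertwiner_rightMap_injective :
    ∃ T : G ⊗[ℂ] (Module.End ℂ (M × (G ⊗[ℂ] M)))ᵐᵒᵖ, IsIntertwiner P (rightAction P) T ∧
      Function.Injective (rightMap (rightAction P) (tensorRight G (rightAction P)
        (Algebra.TensorProduct.comm ℂ M G (qRho H P.right)) * T)) := by
  refine ⟨coconj (antipodeSymm H.antipode) (lamA P (rightAction P))
    Algebra.TensorProduct.includeLeft (rightAntipodeCoaction H P.right).p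
    (opCanonicalTensor G M), fun m => ?_, ?_⟩
  · exact tensor_coconj_p_mul (isStraightening_right P) _ (rightAction_mul_opCanonicalTensor P) m
  · rw [tensor_q_mul_coconj_p (isStraightening_right P) _ (rightAction_mul_opCanonicalTensor P)]
    exact rightMap_opCanonicalTensor_injective P

/-- Bijectivity on the other side makes `A` free enough to define a left `M`-linear map to the
comparison algebra with prescribed value on `T p_λ`. `map_rightMap` then reduces the claim to the
canonical tensor. -/
theorem rightMap_injective {A : Type*} [Ring A] [Algebra ℂ A] {γ : M →ₐ[ℂ] A} {T : G ⊗[ℂ] A}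
    (hT : IsIntertwiner P γ T)
    (h : Function.Bijective (leftMap γ (T * tensorRight G γ (pLambda H P.left)))) :
    Function.Injective (rightMap γ
      (tensorRight G γ (Algebra.TensorProduct.comm ℂ M G (qRho H P.right)) * T)) := by
  obtain ⟨T', hT', hi⟩ := exists_isIntertwiner_rightMap_injective P
  let E := LinearEquiv.ofBijective _ h
  let R' := T' * tensorRight G (rightAction P) (pLambda H P.left)
  -- The left `M`-linear map which sends `γ(m) (T p_λ)(φ)` to the corresponding product for `T'`.
  let f := leftMap (rightAction P) R' ∘ₗ E.symm.toLinearMap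
  have hE : ∀ t, f (leftMap γ (T * tensorRight G γ (pLambda H P.left)) t) =
      leftMap (rightAction P) R' t := fun t =>
    congrArg (leftMap (rightAction P) R') (E.symm_apply_apply t)
  have hmul : ∀ m a, f (γ m * a) = rightAction P m * f a := fun m a => by
    obtain ⟨t, rfl⟩ := h.2 a
    rw [hE]
    induction t using tensor_induction with
    | add a b ha hb => simp only [map_add, mul_add, ha, hb]
    | tmul n φ =>
      have := hE ((m * n) ⊗ₜ φ)
      simpa only [leftMap_tmul, map_mul, mul_assoc] using this
  have hf : f.lTensor G (T * tensorRight G γ (pLambda H P.left)) = R' :=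
    sliceLeft_injective (LinearMap.ext fun φ => by
      rw [← map_sliceLeft]
      simpa using hE (1 ⊗ₜ φ))
  intro s t hst
  have := congrArg f hst
  rw [map_rightMap hmul hT hT' hf, map_rightMap hmul hT hT' hf] at this
  exact hi this

end RightModel

end DiagonalCrossedProduct

theorem mainTheorem1 {G : Type u} [Ring G] [Algebra ℂ G] [FiniteDimensional ℂ G]
    (H : QuasiHopfAlgebra G) {M : Type v} [Ring M] [Algebra ℂ M]
    (P : QuasiCommutingPair H.toQuasiBialgebra M) :
    (∃ (M₁ : Type (max u v w)) (_ : Ring M₁) (_ : Algebra ℂ M₁) (ι : M →ₐ[ℂ] M₁)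
      (Γ : Module.Dual ℂ G →ₗ[ℂ] M₁), IsUniversalExtension P ι Γ) ∧
    (∀ (M₁ M₂ : Type (max u v w)) [Ring M₁] [Algebra ℂ M₁] [Ring M₂] [Algebra ℂ M₂]
      (ι₁ : M →ₐ[ℂ] M₁) (Γ₁ : Module.Dual ℂ G →ₗ[ℂ] M₁)
      (ι₂ : M →ₐ[ℂ] M₂) (Γ₂ : Module.Dual ℂ G →ₗ[ℂ] M₂),
      IsUniversalExtension P ι₁ Γ₁ → IsUniversalExtension P ι₂ Γ₂ →
        ∃! f : M₁ ≃ₐ[ℂ] M₂, (∀ m : M, f (ι₁ m) = ι₂ m) ∧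
          ∀ φ : Module.Dual ℂ G, Γ₂ φ = f (Γ₁ φ)) ∧
    (∀ (M₁ : Type (max u v w)) [Ring M₁] [Algebra ℂ M₁]
      (ι : M →ₐ[ℂ] M₁) (Γ : Module.Dual ℂ G →ₗ[ℂ] M₁), IsUniversalExtension P ι Γ →
        Function.Bijective (muLeft ι Γ (qRho H P.right)) ∧
        Function.Bijective (muRight ι Γ (pLambda H P.left))) := by
  refine ⟨?_, ?_, ?_⟩
  · obtain ⟨A, _, _, γ, T, hT, hi⟩ := DiagonalCrossedProduct.exists_injective_leftMap.{u, v, w} P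
    exact DiagonalCrossedProduct.exists_isUniversalExtension hT hi
  · intro M₁ M₂ _ _ _ _ ι₁ Γ₁ ι₂ Γ₂ h₁ h₂
    obtain ⟨T₁, hT₁, rfl⟩ := DiagonalCrossedProduct.exists_intertwiner h₁
    obtain ⟨T₂, hT₂, rfl⟩ := DiagonalCrossedProduct.exists_intertwiner h₂
    exact DiagonalCrossedProduct.existsUnique_algEquiv h₁ h₂ hT₁ hT₂
  · intro M₁ _ _ ι Γ h
    obtain ⟨T, hT, rfl⟩ := DiagonalCrossedProduct.exists_intertwiner h
    have hb := DiagonalCrossedProduct.bijective_leftMap h hT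
    rw [DiagonalCrossedProduct.muRight_eq, DiagonalCrossedProduct.muLeft_eq]
    exact ⟨⟨DiagonalCrossedProduct.rightMap_injective P hT.intertwine hb, fun a =>
      DiagonalCrossedProduct.adjoin_le_range_rightMap hT (h.generated ▸ Algebra.mem_top)⟩, hb⟩
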